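/- Theorem (Unified hidden stabilizer group algorithm). Let $d$ be a prime, $\omega=e^{2\pi i/d}$, $\tau=e^{\pi i(d^2+1)/d}$, and let $D=d$ if $d$ is odd, $D=4$ if $d=2$. On a qudit with basis $|q\rangle$, $q\in\mathbb Z_d$, let $X|q\rangle=|q+1\rangle$ and $Z|q\rangle=\omega^q|q\rangle$. For $x=(a,b)\in\mathbb Z_d^{2n}$ let $W_x=\tau^{-a\cdot b}\,Z^{a_1}X^{b_1}\otimes\cdots\otimes Z^{a_n}X^{b_n}$ (with $a\cdot b$ computed from the representatives in $\{0,\dots,d-1\}$), and let $[(a,b),(a',b')]=a\cdot b'-a'\cdot b$. Let $\mathcal P_n=\langle\tau I,X,Z\rangle^{\otimes n}$ be the $n$-qudit Pauli group; a stabilizer group is an abelian subgroup of $\mathcal P_n$ that contains no non-trivial multiple of the identity. In the hidden stabilizer group problem one is given copies of a unit vector $\psi\in(\mathbb C^{d})^{\otimes n}$ for which there is a stabilizer group $S\neq\{I\}$ with $P\psi=\psi$ for all $P\in S$, and $|\langle\psi|P|\psi\rangle|\le 1-\epsilon$ for all $P\in\mathcal P_n$ that are not a scalar multiple of an element of $S$,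 where $\epsilon>0$. The task is to identify $S$. Write $\mathrm{Weyl}(\psi)=\{x\in\mathbb Z_d^{2n}: W_x\psi=\omega^s\psi\text{ for some }s\in\mathbb Z_d\}$. There are one algorithm, uniform in $d$ and $n$ and in a number $m$ of rounds, and absolute constants, such that the following holds for all primes $d$ and all $n,m$. 1. (Non-adaptive stage.) In each of $m$ independent rounds, one fixed circuit of Clifford gates, which depends only on $d,n,m$, is applied to $\psi^{\otimes D}$ and all qudits are measured in the computational basis. Up to a relabelling of the outcomes by $y\in\mathbb Z_d^{2n}$, this is the character POVM $$\Pi_y=\frac1{d^{2n}}\sum_{x\in\mathbb Z_d^{2n}}\omega^{-[y,x]}\,W_x^{\otimes D}$$ of the representation $x\mapsto W_x^{\otimes D}$ of $\mathbb Z_d^{2n}$. The circuit has depth $O(d)$, uses no auxiliary systems, and acts coherently on at most $d$ copies at a time: on all $D=d$ copies for odd $d$, and for qubits on two separate pairs out of the four copies (Bell difference sampling). From the $m$ outcomes $y$ alone the algorithm computes a list of points of $\mathbb Z_d^{2n}$. 2. (Phases.) Depending on the outcomes of the first stage, the algorithm measures at most $n$ further copies of $\psi$, one at a time, by Clifford circuits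 of depth $O(d)$ without auxiliary systems, and outputs for each point $x$ in the list a multiple $\tau^kW_x$. In all, at most $Dm+n$ copies of $\psi$ are used. 3. (Time.) The total running time, that is, the logarithmic cost of all classical computations on a random access machine (including writing down the circuits), plus the number of executed gates and of measured qudits, is polynomial in $n$, $d$ and $m$. 4. (Success.) Let $\psi$, $S$, $\epsilon$ be as in the hidden stabilizer group problem, let $0<\delta<1$, and let $$m\ \ge\ C\,\frac{n\log d+\log(1/\delta)}{\min(1,d\epsilon)} .$$ Then with probability at least $1-\delta$ the list computed in 1. generates $\mathrm{Weyl}(\psi)$, and with probability at least $1-\delta$ the operators output in 2. generate exactly $S$. In particular, for constant success probability and $\epsilon\le 1/d$, $O\big(n\log d/(d\epsilon)\big)$ rounds suffice, each a measurement of $\psi^{\otimes D}$. -/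

import Mathlib

open scoped Matrix

noncomputable section

/-! ## Qudits, Weyl operators and stabilizer groups

The computational basis of a family of qudits of local dimension `d` labelled by `Q` is the type
`Q → ZMod d`; state vectors are functions on it and operators are matrices over it. -/

namespace Qudit

/-- Vectors of the Hilbert space of the qudits `Q`. -/
abbrev Vec (d : ℕ) (Q : Type) : Type := (Q → ZMod d) → ℂ

/-- Operators on the Hilbert space of the qudits `Q`. -/
abbrev Op (d : ℕ) (Q : Type) : Type := Matrix (Q → ZMod d) (Q → ZMod d) ℂ

/-- The phase space `ℤ_d^{2n}`, with elements `x = (a, b)`. -/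
abbrev PhaseSpace (d n : ℕ) : Type := (Fin n → ZMod d) × (Fin n → ZMod d)

/-- `ω = exp(2πi/d)`. -/
def omega (d : ℕ) : ℂ := Complex.exp (2 * Real.pi * Complex.I / d)

/-- `τ = exp(πi(d²+1)/d)`, a square root of `ω`. -/
def tau (d : ℕ) : ℂ := Complex.exp (Real.pi * Complex.I * ((d : ℂ) ^ 2 + 1) / d)

/-- The number `D` of copies (the order of `τ`): `d` for odd `d`, and `2d` for even `d`. -/
def numCopies (d : ℕ) : ℕ := if d % 2 = 1 then d else 2 * d

section
variable (d : ℕ) [NeZero d]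

/-- The shift operator `X|q⟩ = |q+1⟩` of one qudit. -/
def shift : Matrix (ZMod d) (ZMod d) ℂ := Matrix.of fun r q => if r = q + 1 then 1 else 0

/-- The clock operator `Z|q⟩ = ω^q|q⟩` of one qudit. -/
def clock : Matrix (ZMod d) (ZMod d) ℂ := Matrix.diagonal fun q => omega d ^ q.val

/-- The Fourier gate `|q⟩ ↦ d^{-1/2} ∑_r ω^{rq}|r⟩` of one qudit. -/
def fourierGate : Matrix (ZMod d) (ZMod d) ℂ :=
  Matrix.of fun r q => omega d ^ (r.val * q.val) / (Real.sqrt d : ℂ)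

/-- The phase gate `|q⟩ ↦ τ^{q²}|q⟩` of one qudit. -/
def phaseGate : Matrix (ZMod d) (ZMod d) ℂ := Matrix.diagonal fun q => tau d ^ (q.val ^ 2)

end

section
variable {d : ℕ} [NeZero d] {Q : Type} [Fintype Q] [DecidableEq Q]

/-- The tensor product `⨂_j A_j` of one-qudit operators. -/
def tensor (A : Q → Matrix (ZMod d) (ZMod d) ℂ) : Op d Q := Matrix.of fun r s => ∏ j, A j (r j) (s j)

/-- The one-qudit operator `A` acting on the qudit `j`. -/
def localOp (j : Q) (A : Matrix (ZMod d) (ZMod d) ℂ) : Op d Q :=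
  tensor (Function.update (fun _ => 1) j A)

/-- The SUM gate `|s⟩ ↦ |…, s_q, …, s_{q'} + s_q, …⟩` with control `q` and target `q'`. -/
def sumGate (q q' : Q) : Op d Q :=
  Matrix.of fun r s => if r = Function.update s q' (s q' + s q) then 1 else 0

end

section
variable {d n : ℕ} [NeZero d]

/-- The Weyl operator `W_x = τ^{-a·b} (Z^{a₁}X^{b₁}) ⊗ ⋯ ⊗ (Z^{aₙ}X^{bₙ})` for `x = (a, b)`, the
integer `a·b` being formed with the representatives in `{0, …, d-1}`. -/
def weyl (x : PhaseSpace d n) : Op d (Fin n) :=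
  (tau d)⁻¹ ^ (∑ j, (x.1 j).val * (x.2 j).val) •
    tensor fun j => clock d ^ (x.1 j).val * shift d ^ (x.2 j).val

/-- The symplectic form `[(a,b),(a',b')] = a·b' - a'·b` modulo `d`. -/
def symp (x y : PhaseSpace d n) : ZMod d := ∑ j, (x.1 j * y.2 j - y.1 j * x.2 j)

/-- The `n`-qudit Pauli group, generated by `τI` and the local operators `X_j`, `Z_j`. -/
def pauliGroup (d n : ℕ) [NeZero d] : Subgroup (Op d (Fin n))ˣ :=
  Subgroup.closure {u | (u : Op d (Fin n)) = tau d • 1 ∨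
    ∃ j, (u : Op d (Fin n)) = localOp j (shift d) ∨ (u : Op d (Fin n)) = localOp j (clock d)}

/-- A stabilizer group: an abelian subgroup of the Pauli group without non-trivial multiples of
the identity. -/
structure IsStabilizerGroup (S : Subgroup (Op d (Fin n))ˣ) : Prop where
  le_pauli : S ≤ pauliGroup d n
  comm : ∀ P ∈ S, ∀ P' ∈ S, P * P' = P' * P
  scalar : ∀ P ∈ S, ∀ c : ℂ, (P : Op d (Fin n)) = c • 1 → P = 1

/-- The promise of the hidden stabilizer group problem: `S` is a non-trivial stabilizer group that
fixes `ψ`, and `|⟨ψ|P|ψ⟩| ≤ 1 - ε` for every Pauli operator `P` that is not in `S` up to phase. -/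
structure IsHiddenStabilizerGroup (ψ : Vec d (Fin n)) (S : Subgroup (Op d (Fin n))ˣ) (ε : ℝ) :
    Prop where
  isStabilizerGroup : IsStabilizerGroup S
  nontrivial : S ≠ ⊥
  fixes : ∀ P ∈ S, (P : Op d (Fin n)) *ᵥ ψ = ψ
  gap : ∀ P ∈ pauliGroup d n,
    (∀ P' ∈ S, ∀ c : ℂ, (P : Op d (Fin n)) ≠ c • (P' : Op d (Fin n))) →
      ‖star ψ ⬝ᵥ ((P : Op d (Fin n)) *ᵥ ψ)‖ ≤ 1 - ε

/-- The phaseless stabilizer group `Weyl(ψ) = {x : W_x ψ = ω^s ψ for some s}`. -/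
def weylSet (ψ : Vec d (Fin n)) : Set (PhaseSpace d n) :=
  {x | ∃ s : ZMod d, weyl x *ᵥ ψ = omega d ^ s.val • ψ}

/-- `ψ^{⊗k}`. The `j`-th qudit of copy `c` has the label `(c, j)`. -/
def vecPow (k : ℕ) (ψ : Vec d (Fin n)) : Vec d (Fin k × Fin n) :=
  fun q => ∏ c, ψ fun j => q (c, j)

/-- `M^{⊗k}`. -/
def opPow (k : ℕ) (M : Op d (Fin n)) : Op d (Fin k × Fin n) :=
  Matrix.of fun r s => ∏ c, M (fun j => r (c, j)) (fun j => s (c, j))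

/-- The effect `Π_y = d^{-2n} ∑_x ω^{-[y,x]} W_x^{⊗D}` of the character POVM of the representation
`x ↦ W_x^{⊗D}` of `ℤ_d^{2n}`. -/
def characterPOVM (y : PhaseSpace d n) : Op d (Fin (numCopies d) × Fin n) :=
  ((d : ℂ) ^ (2 * n))⁻¹ •
    ∑ x : PhaseSpace d n, (omega d)⁻¹ ^ (symp y x).val • opPow (numCopies d) (weyl x)

end

/-! ## Clifford circuits on `k` copies of an `n`-qudit system -/

/-- The Clifford generators, acting on the qudits of `k` copies of an `n`-qudit system. -/
inductive Gate (k n : ℕ) : Type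
  | fourier (q : Fin k × Fin n)
  | phase (q : Fin k × Fin n)
  | pauliX (q : Fin k × Fin n)
  | pauliZ (q : Fin k × Fin n)
  | sum (q q' : Fin k × Fin n) (h : q ≠ q')

namespace Gate
variable {k n : ℕ}

def toOp (d : ℕ) [NeZero d] : Gate k n → Op d (Fin k × Fin n)
  | fourier q => localOp q (fourierGate d)
  | phase q => localOp q (phaseGate d)
  | pauliX q => localOp q (shift d)
  | pauliZ q => localOp q (clock d)
  | sum q q' _ => sumGate q q'

/-- The qudits on which a gate acts. -/
def support : Gate k n → Finset (Fin k × Fin n)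
  | fourier q => {q}
  | phase q => {q}
  | pauliX q => {q}
  | pauliZ q => {q}
  | sum q q' _ => {q, q'}

/-- The description of a gate by five natural numbers: its kind and the labels of its qudits. -/
def code : Gate k n → Fin 5 → ℕ
  | fourier q => ![0, q.1, q.2, 0, 0]
  | phase q => ![1, q.1, q.2, 0, 0]
  | pauliX q => ![2, q.1, q.2, 0, 0]
  | pauliZ q => ![3, q.1, q.2, 0, 0]
  | sum q q' _ => ![4, q.1, q.2, q'.1, q'.2]

end Gate

/-- A circuit: the list of its gates, the first one being applied first. There are no auxiliary
systems: the gates act on the qudits of the given copies only. -/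
abbrev Circuit (k n : ℕ) : Type := List (Gate k n)

namespace Circuit
variable {k n : ℕ}

/-- The unitary operator of a circuit. -/
def toOp (d : ℕ) [NeZero d] : Circuit k n → Op d (Fin k × Fin n)
  | [] => 1
  | g :: c => toOp d c * g.toOp d

/-- The gates can be scheduled in `t` time steps, gates with a common qudit being executed one
after the other in their order. -/
def DepthLE (c : Circuit k n) (t : ℕ) : Prop :=
  ∃ time : Fin c.length → Fin t, ∀ i j : Fin c.length, i < j →
    ¬ Disjoint (c.get i).support (c.get j).support → time i < time j

/-- The copies `0, …, k-1` are cut into the consecutive groups `{0, …, b-1}`, `{b, …, 2b-1}`, … of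
at most `b` copies, and no gate couples two groups: the circuit acts coherently on at most `b`
copies at a time. -/
def CoherentOn (b : ℕ) (c : Circuit k n) : Prop :=
  ∀ g ∈ c, ∀ q ∈ g.support, ∀ q' ∈ g.support, (q.1 : ℕ) / b = (q'.1 : ℕ) / b

/-- The probability of the outcome `r` when the circuit is applied to `ψ^{⊗k}` and all qudits are
measured in the computational basis. -/
def prob {d : ℕ} [NeZero d] (c : Circuit k n) (ψ : Vec d (Fin n)) (r : Fin k × Fin n → ZMod d) :
    ℝ :=
  ‖(c.toOp d *ᵥ vecPow k ψ) r‖ ^ 2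

/-- The circuit on `D` copies, followed by the measurement of all qudits in the computational
basis and the relabelling `f` of the outcomes, is the character POVM. -/
def ImplementsCharacterPOVM {d : ℕ} [NeZero d] (c : Circuit (numCopies d) n)
    (f : (Fin (numCopies d) × Fin n → ZMod d) → PhaseSpace d n) : Prop :=
  ∀ y, ∑ r with f r = y, (c.toOp d)ᴴ * Matrix.single r r (1 : ℂ) * c.toOp d = characterPOVM y

end Circuit

/-! ## A random access machine with logarithmic cost -/

/-- A memory consists of arrays of natural numbers: `σ a i` is cell `i` of array `a`. -/
abbrev Mem : Type := ℕ → ℕ → ℕ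

inductive BinOp : Type
  | add | sub | mul | div | mod

def BinOp.eval : BinOp → ℕ → ℕ → ℕ
  | add, a, b => a + b
  | sub, a, b => a - b
  | mul, a, b => a * b
  | div, a, b => a / b
  | mod, a, b => a % b

inductive Expr : Type
  | lit (k : ℕ)
  | get (a : ℕ) (e : Expr)
  | bin (o : BinOp) (e f : Expr)

namespace Expr

def eval (σ : Mem) : Expr → ℕ
  | lit k => k
  | get a e => σ a (e.eval σ)
  | bin o e f => o.eval (e.eval σ) (f.eval σ)

/-- Every operation costs one plus the bit length of its result. -/
def cost (σ : Mem) : Expr → ℕ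
  | lit k => 1 + k.size
  | get a e => e.cost σ + (1 + (σ a (e.eval σ)).size)
  | bin o e f => e.cost σ + f.cost σ + (1 + (o.eval (e.eval σ) (f.eval σ)).size)

end Expr

/-- Programs: `store a e f` writes the value of `f` into cell `e` of array `a`; a condition holds if
its value is not zero. -/
inductive Cmd : Type
  | skip
  | store (a : ℕ) (e f : Expr)
  | seq (c c' : Cmd)
  | cond (e : Expr) (c c' : Cmd)
  | loop (e : Expr) (c : Cmd)

/-- `Exec c σ σ' t`: started in the memory `σ`, the program `c` halts in the memory `σ'` at the
cost `t`. -/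
inductive Exec : Cmd → Mem → Mem → ℕ → Prop
  | skip (σ : Mem) : Exec Cmd.skip σ σ 1
  | store (a : ℕ) (e f : Expr) (σ : Mem) :
      Exec (Cmd.store a e f) σ
        (Function.update σ a (Function.update (σ a) (e.eval σ) (f.eval σ)))
        (e.cost σ + f.cost σ + 1)
  | seq {c c' : Cmd} {σ σ' σ'' : Mem} {t t' : ℕ} :
      Exec c σ σ' t → Exec c' σ' σ'' t' → Exec (Cmd.seq c c') σ σ'' (t + t')
  | condTrue {e : Expr} {c c' : Cmd} {σ σ' : Mem} {t : ℕ} :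
      e.eval σ ≠ 0 → Exec c σ σ' t → Exec (Cmd.cond e c c') σ σ' (e.cost σ + 1 + t)
  | condFalse {e : Expr} {c c' : Cmd} {σ σ' : Mem} {t : ℕ} :
      e.eval σ = 0 → Exec c' σ σ' t → Exec (Cmd.cond e c c') σ σ' (e.cost σ + 1 + t)
  | loopTrue {e : Expr} {c : Cmd} {σ σ' σ'' : Mem} {t t' : ℕ} :
      e.eval σ ≠ 0 → Exec c σ σ' t → Exec (Cmd.loop e c) σ' σ'' t' →
        Exec (Cmd.loop e c) σ σ'' (e.cost σ + 1 + t + t')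
  | loopFalse {e : Expr} {c : Cmd} {σ : Mem} :
      e.eval σ = 0 → Exec (Cmd.loop e c) σ σ (e.cost σ + 1)

/-- Array `a` holds the list `l` of rows of `w` numbers: its length, then the rows one after the
other. -/
def Mem.Holds (σ : Mem) (a : ℕ) {w : ℕ} (l : List (Fin w → ℕ)) : Prop :=
  σ a 0 = l.length ∧ ∀ (i : Fin l.length) (t : Fin w), σ a (1 + w * i + t) = l.get i t

/-- The array with the entries `f 0, …, f (N-1)`, followed by zeros. -/
def tabulate {N : ℕ} (f : Fin N → ℕ) : ℕ → ℕ := fun i => if h : i < N then f ⟨i, h⟩ else 0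

/-- The initial memory: `n`, `d`, `m` in array 0. -/
def inputMem (d n m : ℕ) : Mem := Function.update (fun _ _ => 0) 0 (tabulate ![n, d, m])

/-- The outcomes of one measurement of all qudits of `k` copies, as a table of digits. -/
def digits {d k n : ℕ} (s : Fin k × Fin n → ZMod d) : Fin (k * n) → ℕ :=
  fun i => (s (finProdFinEquiv.symm i)).val

/-- The outcomes of `m` such measurements, as a table of digits. -/
def digitsRounds {d k n m : ℕ} (r : Fin m → Fin k × Fin n → ZMod d) : Fin (m * (k * n)) → ℕ :=
  fun i => digits (r (finProdFinEquiv.symm i).1) (finProdFinEquiv.symm i).2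

/-- The digits of `x = (a, b)`: those of `a`, then those of `b`. -/
def pointDigits {d n : ℕ} (x : PhaseSpace d n) : Fin (n + n) → ℕ :=
  Fin.append (fun j => (x.1 j).val) (fun j => (x.2 j).val)

/-! ## Quantum algorithms with one non-adaptive stage and a final phase readout -/

/-- The classical parts of an algorithm, run one after the other on the same memory:
* `prep` writes a circuit on `D` copies into array 1. It is then applied to `D` fresh copies of the
  unknown state, followed by a measurement of all qudits in the computational basis, in each of `m`
  independent rounds; all outcomes are written into array 2.
* `post` writes a list of points of `ℤ_d^{2n}` into array 3, a number `k` into cell 0 of array 5,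
  and a circuit on `k` copies into array 4. It is applied to `k` fresh copies of the unknown state,
  all qudits are measured, and the outcomes are written into array 6.
* `finish` writes into array 7, for each point in the list, the exponent of a phase.
-/
structure HybridProgram : Type where
  prep : Cmd
  post : Cmd
  finish : Cmd

/-- The execution of a program on the input `n`, `d`, `m`, for all possible outcomes `r` of the
`m` rounds and `s` of the final readout. -/
structure HybridProgram.Execution (A : HybridProgram) (d n m : ℕ) [NeZero d] : Type where
  mem₁ : Mem
  cost₁ : ℕ
  circuit : Circuit (numCopies d) n
  exec₁ : Exec A.prep (inputMem d n m) mem₁ cost₁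
  holds₁ : mem₁.Holds 1 (circuit.map Gate.code)
  mem₂ : (Fin m → Fin (numCopies d) × Fin n → ZMod d) → Mem
  cost₂ : (Fin m → Fin (numCopies d) × Fin n → ZMod d) → ℕ
  points : (Fin m → Fin (numCopies d) × Fin n → ZMod d) → List (PhaseSpace d n)
  extra : (Fin m → Fin (numCopies d) × Fin n → ZMod d) → ℕ
  readout : ∀ r : Fin m → Fin (numCopies d) × Fin n → ZMod d, Circuit (extra r) n
  exec₂ : ∀ r, Exec A.post (Function.update mem₁ 2 (tabulate (digitsRounds r))) (mem₂ r) (cost₂ r)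
  holds_points : ∀ r, (mem₂ r).Holds 3 ((points r).map pointDigits)
  holds_extra : ∀ r, mem₂ r 5 0 = extra r
  holds_readout : ∀ r, (mem₂ r).Holds 4 ((readout r).map Gate.code)
  mem₃ : ∀ r : Fin m → Fin (numCopies d) × Fin n → ZMod d,
    (Fin (extra r) × Fin n → ZMod d) → Mem
  cost₃ : ∀ r : Fin m → Fin (numCopies d) × Fin n → ZMod d,
    (Fin (extra r) × Fin n → ZMod d) → ℕ
  exec₃ : ∀ r s,
    Exec A.finish (Function.update (mem₂ r) 6 (tabulate (digits s))) (mem₃ r s) (cost₃ r s)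

namespace HybridProgram.Execution
variable {A : HybridProgram} {d n m : ℕ} [NeZero d] (E : A.Execution d n m)

/-- The number of copies of the unknown state that are used. -/
def copies (r : Fin m → Fin (numCopies d) × Fin n → ZMod d) : ℕ := m * numCopies d + E.extra r

/-- The running time: classical cost, number of gates, and number of measured qudits. -/
def time (r : Fin m → Fin (numCopies d) × Fin n → ZMod d)
    (s : Fin (E.extra r) × Fin n → ZMod d) : ℕ :=
  E.cost₁ + E.cost₂ r + E.cost₃ r s + m * E.circuit.length + (E.readout r).length +
    E.copies r * n

/-- The probability of the outcomes `r` of the `m` rounds. -/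
def roundsProb (ψ : Vec d (Fin n)) (r : Fin m → Fin (numCopies d) × Fin n → ZMod d) : ℝ :=
  ∏ i, E.circuit.prob ψ (r i)

/-- The group generated by the Pauli operators `τ^{k_i} W_{x_i}`, where `x_i` are the points in
array 3 and `k_i` the exponents in array 7. -/
def output (r : Fin m → Fin (numCopies d) × Fin n → ZMod d)
    (s : Fin (E.extra r) × Fin n → ZMod d) : Subgroup (Op d (Fin n))ˣ :=
  Subgroup.closure {u | ∃ i : Fin (E.points r).length,
    (u : Op d (Fin n)) = tau d ^ (E.mem₃ r s 7 i) • weyl ((E.points r).get i)}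

open Classical in
/-- The probability that the points found by the non-adaptive stage generate `Weyl(ψ)`. -/
def probPhaseless (ψ : Vec d (Fin n)) : ℝ :=
  ∑ r, if (AddSubgroup.closure {x | x ∈ E.points r} : Set (PhaseSpace d n)) = weylSet ψ
    then E.roundsProb ψ r else 0

open Classical in
/-- The probability that the output of the algorithm is `S`. -/
def probIdentifies (ψ : Vec d (Fin n)) (S : Subgroup (Op d (Fin n))ˣ) : ℝ :=
  ∑ r, E.roundsProb ψ r * ∑ s, if E.output r s = S then (E.readout r).prob ψ s else 0

end HybridProgram.Execution

end Qudit

end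

set_option linter.unusedSectionVars false

noncomputable section

namespace Qudit

/-! ## Reasoning about programs -/

/-! Since `τ^D = 1` and `d ∣ D`, the operators `W_x^{⊗D}` carry no phases (`opPow_numCopies_weyl`)
and one circuit diagonalises all of them. In every group of `d` copies, each copy but the first adds
its digits to the first one by SUM gates and is then Fourier transformed. The X exponents arriving
at the first copy add up to `d·b = 0`, the Z exponents of the other copies cancel, and their X
exponents become Z exponents. So `W_x^{⊗D}` turns into multiplication by `ω^{[y,x]}`, where `y` is
read off from the outcome (`prepCircuit_conj`), and orthogonality of characters gives the POVM.

The characteristic function of one outcome is therefore `⟨ψ|W_x|ψ⟩^D`. For `x` in `Weyl(ψ)` the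
outcome satisfies `[y,x] = 0` with certainty. For other `x`, averaging over the multiples `kx`
bounds the probability of `[y,x] = 0` by `1 - η/4` with `η = min(1, dε)`, because `(1-ε)^d ≤ 1 -
η/2` (`sum_prob_symp_eq_zero_le`). A union bound over the `d^{2n}` points shows that `m` outcomes
have exactly `Weyl(ψ)` as their symplectic complement, except with probability `δ`
(`sum_determines_ge`, `pow_mul_pow_le`).

The complement is computed by elimination without divisions, in which the number of non-zero rows
never exceeds the dimension (`card_eliminate`). As `Weyl(ψ)` is isotropic, at most `n` points
remain, and each gets one further copy. The state is an eigenvector of their Weyl operators, so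
measuring these with one-qudit gates reveals the phases with certainty (`tau_pow_phaseExponent`).
The gap forces every Pauli operator fixing `ψ` into `S`, and therefore the operators with these
phases generate `S` (`closure_eq_of_phases`).

The classical parts are explicit programs, verified in a Hoare logic (`Spec`) in which all cells
stay below `V = (n+d+m)^4` and no loop has more than `V` iterations. The time bound is then a power
of `V` whose exponent depends on the program alone (`PolyBdd.cmd_timeBound`). -/

/-- All cells of the memory are at most `V`. -/
def Mem.Bdd (V : ℕ) (σ : Mem) : Prop := ∀ a i, σ a i ≤ V

/-- The memories agree outside the arrays in `A`. -/
def Mem.Agree (A : List ℕ) (σ σ' : Mem) : Prop := ∀ a, a ∉ A → σ' a = σ a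

theorem Mem.Agree.refl (A : List ℕ) (σ : Mem) : Mem.Agree A σ σ := fun _ _ => rfl

theorem Mem.Agree.trans {A : List ℕ} {σ σ' σ'' : Mem} (h : Mem.Agree A σ σ')
    (h' : Mem.Agree A σ' σ'') : Mem.Agree A σ σ'' := fun a ha => (h' a ha).trans (h a ha)

theorem Mem.Agree.mono {A B : List ℕ} {σ σ' : Mem} (h : Mem.Agree A σ σ') (hAB : A ⊆ B) :
    Mem.Agree B σ σ' := fun a ha => h a fun h' => ha (hAB h')

theorem Mem.Agree.update {A : List ℕ} {σ σ' : Mem} (h : Mem.Agree A σ σ') {a : ℕ} (ha : a ∈ A)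
    (f : ℕ → ℕ) : Mem.Agree A σ (Function.update σ' a f) := by
  intro b hb
  have hne : b ≠ a := by rintro rfl; exact hb ha
  rw [Function.update_of_ne hne]; exact h b hb

/-! ### Values and costs of expressions -/

namespace Expr

instance : Add Expr := ⟨bin .add⟩
instance : Sub Expr := ⟨bin .sub⟩
instance : Mul Expr := ⟨bin .mul⟩
instance : Div Expr := ⟨bin .div⟩
instance : Mod Expr := ⟨bin .mod⟩
instance (k : ℕ) : OfNat Expr k := ⟨lit k⟩

/-- The scalar variable in cell `0` of array `a`. -/
def var (a : ℕ) : Expr := get a (lit 0)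

variable (σ : Mem) (e f : Expr)

@[simp] theorem eval_add : (e + f).eval σ = e.eval σ + f.eval σ := rfl
@[simp] theorem eval_sub : (e - f).eval σ = e.eval σ - f.eval σ := rfl
@[simp] theorem eval_mul : (e * f).eval σ = e.eval σ * f.eval σ := rfl
@[simp] theorem eval_div : (e / f).eval σ = e.eval σ / f.eval σ := rfl
@[simp] theorem eval_mod : (e % f).eval σ = e.eval σ % f.eval σ := rfl
@[simp] theorem eval_zero : (0 : Expr).eval σ = 0 := rfl
@[simp] theorem eval_one : (1 : Expr).eval σ = 1 := rfl
@[simp] theorem eval_two : (2 : Expr).eval σ = 2 := rfl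
@[simp] theorem eval_three : (3 : Expr).eval σ = 3 := rfl
@[simp] theorem eval_four : (4 : Expr).eval σ = 4 := rfl
@[simp] theorem eval_five : (5 : Expr).eval σ = 5 := rfl
@[simp] theorem eval_get (a : ℕ) : (get a e).eval σ = σ a (e.eval σ) := rfl
@[simp] theorem eval_var (a : ℕ) : (var a).eval σ = σ a 0 := rfl

/-- A bound for the value of an expression in a memory with cells at most `V`. -/
def valueBound (V : ℕ) : Expr → ℕ
  | lit k => k
  | get _ _ => V
  | bin .mul e f => e.valueBound V * f.valueBound V
  -- Differences, quotients and remainders are at most their first operand, so the sum bounds them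
  -- as well.
  | bin _ e f => e.valueBound V + f.valueBound V

/-- A bound for the cost of an expression in a memory with cells at most `V`. -/
def costBound (V : ℕ) : Expr → ℕ
  | lit k => 1 + k
  | get _ e => e.costBound V + (1 + V)
  | bin o e f => e.costBound V + f.costBound V + (1 + (bin o e f).valueBound V)

variable {σ}

theorem eval_le_valueBound {V : ℕ} (h : σ.Bdd V) : ∀ e : Expr, e.eval σ ≤ e.valueBound V
  | lit _ => le_rfl
  | get a _ => h a _
  | bin .mul e f => Nat.mul_le_mul (eval_le_valueBound h e) (eval_le_valueBound h f)
  | bin .add e f => Nat.add_le_add (eval_le_valueBound h e) (eval_le_valueBound h f)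
  | bin .sub e _ => (Nat.sub_le _ _).trans ((eval_le_valueBound h e).trans (Nat.le_add_right _ _))
  | bin .div e _ => (Nat.div_le_self _ _).trans
      ((eval_le_valueBound h e).trans (Nat.le_add_right _ _))
  | bin .mod e _ => (Nat.mod_le _ _).trans ((eval_le_valueBound h e).trans (Nat.le_add_right _ _))

/-- A crude bound for the logarithmic cost. It suffices because all values stay polynomially small.
-/
theorem size_le_self (k : ℕ) : k.size ≤ k := Nat.size_le.2 Nat.lt_two_pow_self

theorem cost_le_costBound {V : ℕ} (h : σ.Bdd V) : ∀ e : Expr, e.cost σ ≤ e.costBound V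
  | lit k => Nat.add_le_add_left (size_le_self k) 1
  | get a e => Nat.add_le_add (cost_le_costBound h e)
      (Nat.add_le_add_left ((size_le_self _).trans (h a _)) 1)
  | bin o e f => Nat.add_le_add
      (Nat.add_le_add (cost_le_costBound h e) (cost_le_costBound h f))
      (Nat.add_le_add_left ((size_le_self _).trans (eval_le_valueBound h (bin o e f))) 1)

end Expr

/-- A bound for the running time of a program in which all cells stay at most `V` and no loop has
more than `V` iterations. -/
def Cmd.timeBound (V : ℕ) : Cmd → ℕ
  | skip => 1
  | store _ e f => e.costBound V + f.costBound V + 1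
  | seq c c' => c.timeBound V + c'.timeBound V
  | cond e c c' => e.costBound V + 1 + (c.timeBound V + c'.timeBound V)
  -- The additional summand pays for the final test that ends the loop.
  | loop e c => (V + 1) * (e.costBound V + 1 + c.timeBound V)

/-- `f V` is at most a power of `V`. -/
def PolyBdd (f : ℕ → ℕ) : Prop := ∃ k, ∀ V, 2 ≤ V → f V ≤ V ^ k

namespace PolyBdd
variable {f g : ℕ → ℕ}

theorem const (k : ℕ) : PolyBdd fun _ => k :=
  ⟨k, fun _ hV => Nat.lt_two_pow_self.le.trans (Nat.pow_le_pow_left hV k)⟩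

theorem id : PolyBdd fun V => V := ⟨1, fun V _ => (pow_one V).ge⟩

theorem add (hf : PolyBdd f) (hg : PolyBdd g) : PolyBdd fun V => f V + g V := by
  obtain ⟨k, hk⟩ := hf
  obtain ⟨l, hl⟩ := hg
  refine ⟨k + l + 1, fun V hV => ?_⟩
  have h1 : V ^ k ≤ V ^ (k + l) := Nat.pow_le_pow_right (by omega) (by omega)
  have h2 : V ^ l ≤ V ^ (k + l) := Nat.pow_le_pow_right (by omega) (by omega)
  calc f V + g V ≤ V ^ (k + l) + V ^ (k + l) := Nat.add_le_add ((hk V hV).trans h1) ((hl V hV).trans h2)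
    _ = V ^ (k + l) * 2 := by ring
    _ ≤ V ^ (k + l) * V := Nat.mul_le_mul_left _ hV
    _ = _ := (pow_succ _ _).symm

theorem mul (hf : PolyBdd f) (hg : PolyBdd g) : PolyBdd fun V => f V * g V := by
  obtain ⟨k, hk⟩ := hf
  obtain ⟨l, hl⟩ := hg
  exact ⟨k + l, fun V hV => (Nat.mul_le_mul (hk V hV) (hl V hV)).trans (pow_add _ _ _).ge⟩

/-- Passes from the bound `V` on the cells to the input size, of which `V` is a power. -/
theorem comp_pow (hf : PolyBdd f) {k : ℕ} (hk : k ≠ 0) : PolyBdd fun V => f (V ^ k) := by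
  obtain ⟨l, hl⟩ := hf
  exact ⟨k * l, fun V hV => (hl _ (hV.trans (Nat.le_self_pow hk V))).trans (pow_mul _ _ _).ge⟩

theorem expr_valueBound : ∀ e : Expr, PolyBdd fun V => e.valueBound V
  | .lit k => const k
  | .get _ _ => id
  | .bin .mul e f => (expr_valueBound e).mul (expr_valueBound f)
  | .bin .add e f => (expr_valueBound e).add (expr_valueBound f)
  | .bin .sub e f => (expr_valueBound e).add (expr_valueBound f)
  | .bin .div e f => (expr_valueBound e).add (expr_valueBound f)
  | .bin .mod e f => (expr_valueBound e).add (expr_valueBound f)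

theorem expr_costBound : ∀ e : Expr, PolyBdd fun V => e.costBound V
  | .lit k => const (1 + k)
  | .get _ e => (expr_costBound e).add ((const 1).add id)
  | .bin o e f => ((expr_costBound e).add (expr_costBound f)).add
      ((const 1).add (expr_valueBound (.bin o e f)))

/-- The exponent depends on the program only. For a fixed program this makes the running time
polynomial uniformly in `d`, `n` and `m`. -/
theorem cmd_timeBound : ∀ c : Cmd, PolyBdd fun V => c.timeBound V
  | .skip => const 1
  | .store _ e f => ((expr_costBound e).add (expr_costBound f)).add (const 1)
  | .seq c c' => (cmd_timeBound c).add (cmd_timeBound c')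
  | .cond e c c' => ((expr_costBound e).add (const 1)).add
      ((cmd_timeBound c).add (cmd_timeBound c'))
  | .loop e c => (id.add (const 1)).mul (((expr_costBound e).add (const 1)).add (cmd_timeBound c))

end PolyBdd

/-- Started in the memory `σ`, the program `c` halts within its time bound in a memory that
satisfies `Q`, and all cells stay at most `V`. -/
def Spec (V : ℕ) (c : Cmd) (σ : Mem) (Q : Mem → Prop) : Prop :=
  ∃ σ' t, Exec c σ σ' t ∧ t ≤ c.timeBound V ∧ σ'.Bdd V ∧ Q σ'

theorem Mem.Bdd.update {V : ℕ} {σ : Mem} (h : σ.Bdd V) (a i x : ℕ) (hx : x ≤ V) :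
    Mem.Bdd V (Function.update σ a (Function.update (σ a) i x)) := by
  intro b j
  by_cases hb : b = a
  · subst hb
    by_cases hj : j = i
    · subst hj; simpa using hx
    · simpa [hj] using h b j
  · simpa [hb] using h b j

namespace Spec
variable {V : ℕ} {c c' : Cmd} {σ : Mem} {Q R : Mem → Prop} {e f : Expr}

theorem mono (h : Spec V c σ R) (hQ : ∀ σ', R σ' → Q σ') : Spec V c σ Q := by
  obtain ⟨σ', t, h1, h2, h3, h4⟩ := h
  exact ⟨σ', t, h1, h2, h3, hQ _ h4⟩

theorem skip (hσ : σ.Bdd V) (h : Q σ) : Spec V .skip σ Q := ⟨σ, 1, .skip σ, le_rfl, hσ, h⟩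

theorem store {a : ℕ} (hσ : σ.Bdd V) (hf : f.eval σ ≤ V)
    (h : Q (Function.update σ a (Function.update (σ a) (e.eval σ) (f.eval σ)))) :
    Spec V (.store a e f) σ Q :=
  ⟨_, _, .store a e f σ, Nat.add_le_add_right (Nat.add_le_add (e.cost_le_costBound hσ)
    (f.cost_le_costBound hσ)) 1, hσ.update _ _ _ hf, h⟩

theorem seq (h : Spec V c σ R) (h' : ∀ σ', σ'.Bdd V → R σ' → Spec V c' σ' Q) :
    Spec V (.seq c c') σ Q := by
  obtain ⟨σ', t, h1, h2, h3, h4⟩ := h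
  obtain ⟨σ'', t', h1', h2', h3', h4'⟩ := h' σ' h3 h4
  exact ⟨σ'', _, .seq h1 h1', Nat.add_le_add h2 h2', h3', h4'⟩

theorem store_seq {a : ℕ} (hσ : σ.Bdd V) (hf : f.eval σ ≤ V)
    (h : Mem.Bdd V (Function.update σ a (Function.update (σ a) (e.eval σ) (f.eval σ))) →
      Spec V c (Function.update σ a (Function.update (σ a) (e.eval σ) (f.eval σ))) Q) :
    Spec V (.seq (.store a e f) c) σ Q :=
  seq (R := fun σ' => σ' = Function.update σ a (Function.update (σ a) (e.eval σ) (f.eval σ)))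
    (store hσ hf rfl) fun σ' h' e => by subst e; exact h h'

/-- The new memory is handed on as a variable, known only through the changed array and agreement
elsewhere. This keeps the terms small in long sequences of assignments. -/
theorem assign {a p x : ℕ} (hσ : σ.Bdd V) (he : e.eval σ = p) (hf : f.eval σ = x) (hx : x ≤ V)
    (h : ∀ σ', σ'.Bdd V → Mem.Agree [a] σ σ' → σ' a = Function.update (σ a) p x → Q σ') :
    Spec V (.store a e f) σ Q := by
  subst he hf
  exact store hσ hx (h _ (hσ.update _ _ _ hx) ((Mem.Agree.refl _ _).update (by simp) _) (by simp))

theorem assign_seq {a p x : ℕ} (hσ : σ.Bdd V) (he : e.eval σ = p) (hf : f.eval σ = x) (hx : x ≤ V)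
    (h : ∀ σ', σ'.Bdd V → Mem.Agree [a] σ σ' → σ' a = Function.update (σ a) p x →
      Spec V c σ' Q) : Spec V (.seq (.store a e f) c) σ Q :=
  seq (assign (Q := fun σ' => Mem.Agree [a] σ σ' ∧ σ' a = Function.update (σ a) p x) hσ he hf hx
    fun _ _ h1 h2 => ⟨h1, h2⟩) fun σ' h1 h2 => h σ' h1 h2.1 h2.2

theorem cond (hσ : σ.Bdd V) (h : e.eval σ ≠ 0 → Spec V c σ Q) (h' : e.eval σ = 0 → Spec V c' σ Q) :
    Spec V (.cond e c c') σ Q := by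
  by_cases he : e.eval σ = 0
  · obtain ⟨σ', t, h1, h2, h3, h4⟩ := h' he
    exact ⟨σ', _, .condFalse he h1, Nat.add_le_add (Nat.add_le_add_right
      (e.cost_le_costBound hσ) 1) (h2.trans (Nat.le_add_left _ _)), h3, h4⟩
  · obtain ⟨σ', t, h1, h2, h3, h4⟩ := h he
    exact ⟨σ', _, .condTrue he h1, Nat.add_le_add (Nat.add_le_add_right
      (e.cost_le_costBound hσ) 1) (h2.trans (Nat.le_add_right _ _)), h3, h4⟩

/-- `J i` is the invariant after `i` iterations. The induction is on the number of iterations that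
are left. -/
theorem loop {N : ℕ} (J : ℕ → Mem → Prop) (hN : N ≤ V) (hσ : σ.Bdd V) (h0 : J 0 σ)
    (hs : ∀ i < N, ∀ σ', σ'.Bdd V → J i σ' → e.eval σ' ≠ 0 ∧ Spec V c σ' (J (i + 1)))
    (he : ∀ σ', J N σ' → e.eval σ' = 0) : Spec V (.loop e c) σ (J N) := by
  suffices H : ∀ k ≤ N, ∀ σ : Mem, σ.Bdd V → J (N - k) σ → ∃ σ' t, Exec (.loop e c) σ σ' t ∧
      t ≤ (k + 1) * (e.costBound V + 1 + c.timeBound V) ∧ σ'.Bdd V ∧ J N σ' by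
    obtain ⟨σ', t, h1, h2, h3, h4⟩ := H N le_rfl σ hσ (by simpa using h0)
    exact ⟨σ', t, h1, h2.trans (Nat.mul_le_mul_right _ (by omega)), h3, h4⟩
  intro k
  induction k with
  | zero =>
    intro _ σ hσ hJ
    exact ⟨σ, _, .loopFalse (he σ hJ), by have := e.cost_le_costBound hσ; omega, hσ, hJ⟩
  | succ k ih =>
    intro hk σ hσ hJ
    obtain ⟨h1, σ', t, h2, h3, h4, h5⟩ := hs _ (by omega) σ hσ hJ
    rw [show N - (k + 1) + 1 = N - k by omega] at h5
    obtain ⟨σ'', t', h2', h3', h4', h5'⟩ := ih (by omega) σ' h4 h5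
    refine ⟨σ'', _, .loopTrue h1 h2 h2', ?_, h4', h5'⟩
    have := e.cost_le_costBound hσ
    rw [add_mul _ 1, one_mul]
    omega

end Spec

/-! ### Counting loops and tables -/

/-- `for v = 0, …, e - 1 do c`. -/
def Cmd.forTo (v : ℕ) (e : Expr) (c : Cmd) : Cmd :=
  .seq (.store v 0 0) (.loop (e - .var v) (.seq c (.store v 0 (.var v + 1))))

namespace Spec
variable {V : ℕ} {c c' : Cmd} {σ : Mem} {Q R : Mem → Prop} {e f : Expr}

/-- The loop condition is a truncated difference, hence non-zero exactly while the counter is below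
the bound. The bound is evaluated anew in each iteration, so it must not depend on the arrays in
`A`. The body has to leave the counter unchanged, and `hJ` lets the invariant survive its increment.
-/
theorem forTo {v N : ℕ} {A : List ℕ} (J : ℕ → Mem → Prop) (hσ : σ.Bdd V) (hN : N ≤ V) (hv : v ∈ A)
    (he : ∀ σ', Mem.Agree A σ σ' → e.eval σ' = N) (h0 : J 0 σ)
    (hJ : ∀ i σ₁ σ₂, Mem.Agree [v] σ₁ σ₂ → J i σ₁ → J i σ₂)
    (hs : ∀ i < N, ∀ σ', σ'.Bdd V → Mem.Agree A σ σ' → σ' v 0 = i → J i σ' →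
      Spec V c σ' fun σ'' => Mem.Agree A σ σ'' ∧ σ'' v 0 = i ∧ J (i + 1) σ'') :
    Spec V (.forTo v e c) σ fun σ' => Mem.Agree A σ σ' ∧ J N σ' := by
  have hu : ∀ (σ' : Mem) g, Mem.Agree [v] σ' (Function.update σ' v g) := fun σ' g =>
    (Mem.Agree.refl _ _).update (by simp) g
  refine store_seq hσ (Nat.zero_le _) fun hσ' => ?_
  refine (loop (N := N) (fun i σ' => Mem.Agree A σ σ' ∧ σ' v 0 = i ∧ J i σ') hN hσ' ?_ ?_ ?_).mono
    fun σ' h => ⟨h.1, h.2.2⟩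
  · exact ⟨(Mem.Agree.refl _ _).update hv _, by simp, hJ _ _ _ (hu _ _) h0⟩
  · rintro i hi σ' hb ⟨h1, h2, h3⟩
    refine ⟨by simp [he σ' h1, h2]; omega, ?_⟩
    refine seq (hs i hi σ' hb h1 h2 h3) ?_
    rintro σ'' hb' ⟨h1', h2', h3'⟩
    refine store hb' (by simp [h2']; omega) ⟨h1'.update hv _, by simp [h2'], hJ _ _ _ (hu _ _) h3'⟩
  · rintro σ' ⟨h1, h2, -⟩
    simp [he σ' h1, h2]

/-- A loop that updates a scalar variable. -/
theorem scalarLoop {v a N : ℕ} (s : ℕ → ℕ) (hσ : σ.Bdd V) (hN : N ≤ V) (hva : a ≠ v)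
    (he : ∀ σ', Mem.Agree [a, v] σ σ' → e.eval σ' = N) (h0 : σ a 0 = s 0)
    (hs : ∀ i < N, ∀ σ', Mem.Agree [a, v] σ σ' → σ' v 0 = i → σ' a 0 = s i →
      f.eval σ' = s (i + 1)) (hV : ∀ i < N, s (i + 1) ≤ V) :
    Spec V (.forTo v e (.store a 0 f)) σ fun σ' => Mem.Agree [a, v] σ σ' ∧ σ' a 0 = s N := by
  refine forTo (fun i σ' => σ' a 0 = s i) hσ hN (by simp) he h0
    (fun i σ₁ σ₂ h h' => by rw [h a (by simpa using hva), h']) ?_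
  intro i hi σ' hb h1 h2 h3
  have hf := hs i hi σ' h1 h2 h3
  refine store hb (hf ▸ hV i hi) ⟨h1.update (by simp) _, ?_, ?_⟩
  · rw [Function.update_of_ne hva.symm, h2]
  · simp [hf]

/-- A loop that writes the entries of an array one after the other. -/
theorem fillLoop {v a N : ℕ} {A : List ℕ} (F : ℕ → ℕ) (hσ : σ.Bdd V) (hN : N ≤ V) (hv : v ∈ A)
    (hva : a ≠ v) (he : ∀ σ', Mem.Agree A σ σ' → e.eval σ' = N)
    (hs : ∀ i < N, ∀ σ', σ'.Bdd V → Mem.Agree A σ σ' → σ' v 0 = i →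
      (∀ x, σ' a x = if x < i then F x else σ a x) →
      Spec V c σ' fun σ'' => Mem.Agree A σ σ'' ∧ σ'' v 0 = i ∧
        σ'' a = Function.update (σ' a) i (F i)) :
    Spec V (.forTo v e c) σ fun σ' => Mem.Agree A σ σ' ∧
      ∀ x, σ' a x = if x < N then F x else σ a x := by
  refine forTo (fun i σ' => ∀ x, σ' a x = if x < i then F x else σ a x) hσ hN hv he (by simp)
    (fun i σ₁ σ₂ h h' x => by rw [h a (by simpa using hva), h']) ?_
  intro i hi σ' hb h1 h2 h3
  refine (hs i hi σ' hb h1 h2 h3).mono fun σ'' ⟨h1', h2', h3'⟩ => ⟨h1', h2', fun x => ?_⟩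
  rw [h3', Function.update_apply, h3]
  split_ifs <;> first | rfl | omega | (subst_vars; rfl)

/-- A loop that writes the values of an expression into an array. -/
theorem fillExprLoop {v a N : ℕ} (F : ℕ → ℕ) (hσ : σ.Bdd V) (hN : N ≤ V) (hva : a ≠ v)
    (he : ∀ σ', Mem.Agree [a, v] σ σ' → e.eval σ' = N)
    (hs : ∀ i < N, ∀ σ', Mem.Agree [a, v] σ σ' → σ' v 0 = i → σ' a i = σ a i → f.eval σ' = F i)
    (hV : ∀ i < N, F i ≤ V) :
    Spec V (.forTo v e (.store a (.var v) f)) σ fun σ' => Mem.Agree [a, v] σ σ' ∧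
      ∀ x, σ' a x = if x < N then F x else σ a x := by
  refine fillLoop F hσ hN (by simp) hva he ?_
  intro i hi σ' hb h1 h2 h3
  have hf := hs i hi σ' h1 h2 (by simp [h3])
  refine store hb (hf ▸ hV i hi) ⟨h1.update (by simp) _, ?_, ?_⟩
  · rw [Function.update_of_ne hva.symm, h2]
  · simp [hf, h2]

end Spec

theorem Mem.Holds.append {σ σ' : Mem} {a w : ℕ} {l : List (Fin w → ℕ)} (h : σ.Holds a l)
    (row : Fin w → ℕ) (h0 : σ' a 0 = l.length + 1)
    (h1 : ∀ x, x ≠ 0 → x < 1 + w * l.length → σ' a x = σ a x)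
    (h2 : ∀ t : Fin w, σ' a (1 + w * l.length + t) = row t) : σ'.Holds a (l ++ [row]) := by
  refine ⟨by simp [h0], fun i t => ?_⟩
  obtain ⟨i, hi⟩ := i
  simp only [List.length_append, List.length_singleton] at hi
  rcases Nat.lt_succ_iff_lt_or_eq.1 hi with hi' | rfl
  · have : w * (i + 1) ≤ w * l.length := Nat.mul_le_mul_left _ hi'
    have ht := t.2
    rw [h1 _ (by omega) (by rw [mul_add] at this; simp only; omega)]
    simpa [List.getElem_append_left hi'] using h.2 ⟨i, hi'⟩ t
  · simpa using h2 t

/-- Append a row of five numbers to the list in array `a`. -/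
def Cmd.push (a : ℕ) (e₀ e₁ e₂ e₃ e₄ : Expr) : Cmd :=
  .seq (.store a (1 + 5 * .var a) e₀) <| .seq (.store a (1 + 5 * .var a + 1) e₁) <|
  .seq (.store a (1 + 5 * .var a + 2) e₂) <| .seq (.store a (1 + 5 * .var a + 3) e₃) <|
  .seq (.store a (1 + 5 * .var a + 4) e₄) <| .store a 0 (.var a + 1)

/-- The length in cell `0` is increased last, so all five addresses refer to the old length. The
entries may not depend on array `a`, which changes between the stores. -/
theorem Spec.push {V a : ℕ} {σ : Mem} {l : List (Fin 5 → ℕ)} {e₀ e₁ e₂ e₃ e₄ : Expr}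
    {x₀ x₁ x₂ x₃ x₄ : ℕ} (hσ : σ.Bdd V) (hl : σ.Holds a l) (hV : l.length + 1 ≤ V)
    (h : ∀ σ', Mem.Agree [a] σ σ' → e₀.eval σ' = x₀ ∧ e₁.eval σ' = x₁ ∧ e₂.eval σ' = x₂ ∧
      e₃.eval σ' = x₃ ∧ e₄.eval σ' = x₄)
    (hx : x₀ ≤ V ∧ x₁ ≤ V ∧ x₂ ≤ V ∧ x₃ ≤ V ∧ x₄ ≤ V) :
    Spec V (.push a e₀ e₁ e₂ e₃ e₄) σ fun σ' => Mem.Agree [a] σ σ' ∧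
      σ'.Holds a (l ++ [![x₀, x₁, x₂, x₃, x₄]]) := by
  obtain ⟨hx0, hx1, hx2, hx3, hx4⟩ := hx
  have g0 := h σ (Mem.Agree.refl _ _)
  have e0 : ∀ {σ' : Mem} (_ : σ' a 0 = l.length), (1 + 5 * Expr.var a).eval σ' = 1 + 5 * l.length := by
    intro σ' h; simp [h]
  refine assign_seq hσ (e0 hl.1) g0.1 hx0 fun σ1 b1 a1 u1 => ?_
  have z1 : σ1 a 0 = l.length := by rw [u1, Function.update_of_ne (by omega), hl.1]
  refine assign_seq b1 (p := 1 + 5 * l.length + 1) (by simp [z1]) (h _ a1).2.1 hx1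
    fun σ2 b2 a2 u2 => ?_
  have z2 : σ2 a 0 = l.length := by rw [u2, Function.update_of_ne (by omega), z1]
  refine assign_seq b2 (p := 1 + 5 * l.length + 2) (by simp [z2]) (h _ (a1.trans a2)).2.2.1 hx2
    fun σ3 b3 a3 u3 => ?_
  have z3 : σ3 a 0 = l.length := by rw [u3, Function.update_of_ne (by omega), z2]
  refine assign_seq b3 (p := 1 + 5 * l.length + 3) (by simp [z3])
    (h _ ((a1.trans a2).trans a3)).2.2.2.1 hx3 fun σ4 b4 a4 u4 => ?_
  have z4 : σ4 a 0 = l.length := by rw [u4, Function.update_of_ne (by omega), z3]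
  refine assign_seq b4 (p := 1 + 5 * l.length + 4) (by simp [z4])
    (h _ (((a1.trans a2).trans a3).trans a4)).2.2.2.2 hx4 fun σ5 b5 a5 u5 => ?_
  have z5 : σ5 a 0 = l.length := by rw [u5, Function.update_of_ne (by omega), z4]
  refine assign b5 (p := 0) (x := l.length + 1) (by simp) (by simp [z5]) hV fun σ6 b6 a6 u6 =>
    ⟨((((a1.trans a2).trans a3).trans a4).trans a5).trans a6, hl.append _ ?_ ?_ ?_⟩
  · simp [u6]
  · intro x hx0 hx1
    simp only [u6, u5, u4, u3, u2, u1, Function.update_apply]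
    repeat rw [if_neg (by omega)]
  · intro t
    simp only [u6, u5, u4, u3, u2, u1, Function.update_apply]
    fin_cases t <;> simp

/-! ## The programs -/

theorem Mem.Agree.at {A : List ℕ} {σ σ' : Mem} (h : Mem.Agree A σ σ') (a : ℕ)
    (ha : a ∉ A := by decide) : σ' a = σ a := h a ha

/-- Bounds for the numbers that occur in the computation. -/
structure Fits (V n d m : ℕ) : Prop where
  four : 4 ≤ V
  width : n + n ≤ V
  dim : 2 * d ≤ V
  rounds : m ≤ V
  square : (n + n) * (n + n) ≤ V
  prep : numCopies d * (n * 2) ≤ V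
  readout : n * (n * d) ≤ V

/-- The constants of the computation are in their places. -/
structure Env (n d m : ℕ) (σ : Mem) : Prop where
  qudits : σ 0 0 = n
  base : σ 0 1 = d
  rounds : σ 0 2 = m
  copies : σ 20 0 = numCopies d
  width : σ 21 0 = n + n

theorem Env.agree {n d m : ℕ} {A : List ℕ} {σ σ' : Mem} (h : Env n d m σ) (hA : Mem.Agree A σ σ')
    (h0 : 0 ∉ A := by decide) (h20 : 20 ∉ A := by decide) (h21 : 21 ∉ A := by decide) :
    Env n d m σ' := by
  obtain ⟨h1, h2, h3, h4, h5⟩ := h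
  constructor <;> simpa [hA.at 0 h0, hA.at 20 h20, hA.at 21 h21]

namespace Program
open Qudit.Expr

/-- Writing down the circuit of the non-adaptive stage. -/
def prep : Cmd :=
  -- This is `2d - d` for odd `d` and `2d` for even `d`, that is `numCopies d` without a case
  -- distinction.
  .seq (.store 20 0 (2 * get 0 1 - get 0 1 % 2 * get 0 1)) <|
  .seq (.store 21 0 (get 0 0 + get 0 0)) <|
  .forTo 22 (var 20) <| .cond (var 22 % get 0 1)
    (.forTo 23 (get 0 0) <| .seq
      (.push 1 4 (var 22) (var 23) (var 22 / get 0 1 * get 0 1) (var 23))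
      (.push 1 0 (var 22) (var 23) 0 0))
    .skip

end Program

/-- The codes of the gates of the circuit of the non-adaptive stage. -/
def prepCode (d n : ℕ) (N : ℕ) : List (Fin 5 → ℕ) :=
  (List.range N).flatMap fun c => if c % d = 0 then [] else
    (List.range n).flatMap fun j => [![4, c, j, c / d * d, j], ![0, c, j, 0, 0]]

theorem prepCode_length_le (d n N : ℕ) : (prepCode d n N).length ≤ N * (n * 2) := by
  induction N with
  | zero => simp [prepCode]
  | succ N ih =>
    rw [prepCode, List.range_succ, List.flatMap_append, ← prepCode, List.length_append, add_mul]
    refine Nat.add_le_add ih ?_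
    by_cases h : N % d = 0 <;> simp [h]

theorem numCopies_le (d : ℕ) : numCopies d ≤ 2 * d := by
  unfold numCopies; split <;> omega

theorem Mem.Holds.congr {σ σ' : Mem} {a w : ℕ} {l : List (Fin w → ℕ)} (h : σ.Holds a l)
    (h' : σ' a = σ a) : σ'.Holds a l := by
  unfold Mem.Holds; rw [h']; exact h

theorem Mem.Holds.nil {σ : Mem} {a w : ℕ} (h : σ a 0 = 0) :
    σ.Holds a ([] : List (Fin w → ℕ)) := ⟨by simp [h], fun i => i.elim0⟩

theorem spec_prep {V n d m : ℕ} (hF : Fits V n d m) {σ : Mem} (hσ : σ.Bdd V) (h0 : σ 0 0 = n)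
    (h1 : σ 0 1 = d) (h2 : σ 0 2 = m) (h3 : σ 1 0 = 0) :
    Spec V Program.prep σ fun σ' => Mem.Agree [1, 20, 21, 22, 23] σ σ' ∧ Env n d m σ' ∧
      σ'.Holds 1 (prepCode d n (numCopies d)) := by
  have hw := hF.width
  have hd := hF.dim
  have hD := numCopies_le d
  refine Spec.assign_seq hσ (p := 0) (by simp) (x := numCopies d) ?_ (by omega) fun σ1 b1 a1 u1 => ?_
  · simp only [Expr.eval_sub, Expr.eval_mul, Expr.eval_mod, Expr.eval_get,
      Expr.eval_one,
      Expr.eval_two, h1, numCopies]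
    rcases Nat.mod_two_eq_zero_or_one d with h | h <;> simp [h]
    omega
  refine Spec.assign_seq b1 (p := 0) (by simp) (x := n + n) ?_ hw fun σ2 b2 a2 u2 => ?_
  · simp [a1.at 0, h0]
  have A2 : Mem.Agree [1, 20, 21, 22, 23] σ σ2 :=
    (a1.mono (by simp)).trans (a2.mono (by simp))
  have E2 : Env n d m σ2 := by
    constructor <;> simp [a2.at 0, a1.at 0, u1, u2, a2.at 20, h0, h1, h2]
  refine (Spec.forTo (N := numCopies d) (A := [1, 22, 23])
    (fun i σ' => σ'.Holds 1 (prepCode d n i)) b2 (by omega) (by simp)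
    (fun σ' h => by simp [(E2.agree h).copies]) (Mem.Holds.nil (by simp [a2.at 1, a1.at 1, h3]))
    (fun i σ₁ σ₂ h h' => h'.congr (h.at 1)) ?_).mono
    fun σ' ⟨h1, h2⟩ => ⟨A2.trans (h1.mono (by simp)), E2.agree h1, h2⟩
  intro i hi σ3 b3 a3 c3 H3
  have E3 := E2.agree a3
  have hP : prepCode d n (i + 1) = prepCode d n i ++ if i % d = 0 then [] else
      (List.range n).flatMap fun j => [![4, i, j, i / d * d, j], ![0, i, j, 0, 0]] := by
    simp [prepCode, List.range_succ]
  refine Spec.cond b3 (fun he => ?_) fun he => ?_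
  · have he' : ¬ i % d = 0 := by simpa [c3, E3.base] using he
    rw [hP, if_neg he']
    refine (Spec.forTo (N := n) (A := [1, 23])
      (fun k σ' => σ'.Holds 1 (prepCode d n i ++ (List.range k).flatMap fun j =>
        [![4, i, j, i / d * d, j], ![0, i, j, 0, 0]])) b3 (by omega) (by simp)
      (fun σ' h => by simp [(E3.agree h).qudits]) (by simpa using H3)
      (fun i σ₁ σ₂ h h' => h'.congr (h.at 1)) ?_).mono
      fun σ' ⟨h1, h2⟩ => ⟨a3.trans (h1.mono (by simp)), by rw [h1.at 22, c3], h2⟩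
    intro k hk σ4 b4 a4 c4 H4
    have E4 := E3.agree a4
    -- Two free places are needed, as the body appends two gates.
    have hlen : (prepCode d n i ++ (List.range k).flatMap fun j =>
        [![4, i, j, i / d * d, j], ![0, i, j, 0, 0]]).length + 2 ≤ V := by
      have := prepCode_length_le d n i
      have h2 := hF.prep
      have h3 : (i + 1) * (n * 2) ≤ numCopies d * (n * 2) := Nat.mul_le_mul_right _ hi
      rw [add_mul] at h3
      simp; omega
    have h4 := hF.four
    have hdiv := Nat.div_mul_le_self i d
    refine Spec.seq (Spec.push (x₀ := 4) (x₁ := i) (x₂ := k) (x₃ := i / d * d) (x₄ := k) b4 H4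
      (by omega) (fun σ' h => ?_) ?_) ?_
    · have E := E4.agree h
      simp [h.at 22, h.at 23, a4.at 22, c3, c4, E.base]
    · omega
    rintro σ5 b5 ⟨a5, H5⟩
    refine (Spec.push (x₀ := 0) (x₁ := i) (x₂ := k) (x₃ := 0) (x₄ := 0) b5 H5
      (by rw [List.length_append, List.length_singleton]; omega) (fun σ' h => ?_) ?_).mono ?_
    · simp [h.at 22, h.at 23, a5.at 22, a5.at 23, a4.at 22, c3, c4]
    · omega
    rintro σ6 ⟨a6, H6⟩
    refine ⟨(a4.trans (a5.mono (by simp))).trans (a6.mono (by simp)),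
      by rw [a6.at 23, a5.at 23, c4], ?_⟩
    simpa [List.range_succ] using H6
  · have he' : i % d = 0 := by simpa [c3, E3.base] using he
    exact Spec.skip b3 ⟨a3, c3, by rw [hP, if_pos he']; simpa using H3⟩

/-! ### Null spaces over `ZMod d`, computed without divisions -/

section
variable {d : ℕ}

/-- The value of the linear form `h` at `x`. -/
def pairing (w : ℕ) (h x : ℕ → ZMod d) : ZMod d := ∑ l ∈ Finset.range w, h l * x l

/-- The last index below a bound at which `α` does not vanish, or `0`. -/
def pivot (α : ℕ → ZMod d) : ℕ → ℕ
  | 0 => 0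
  | k + 1 => if α k = 0 then pivot α k else k

/-- The value of `α` at the pivot, or `1` if `α` vanishes. -/
def pivotValue (α : ℕ → ZMod d) (w : ℕ) : ZMod d :=
  if α (pivot α w) = 0 then 1 else α (pivot α w)

/-- Intersect the span of the rows of `B` with the kernel of the linear form `h`. -/
def eliminate (w : ℕ) (B : ℕ → ℕ → ZMod d) (h : ℕ → ZMod d) : ℕ → ℕ → ZMod d := fun k l =>
  -- If the form vanishes on all rows, the pivot value is `1` and nothing changes. Otherwise the
  -- pivot row becomes `0` and all rows move into the kernel.
  pivotValue (fun k => pairing w h (B k)) w * B k l -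
    pairing w h (B k) * B (pivot (fun k => pairing w h (B k)) w) l

/-- Rows that span the common kernel of the first linear forms. -/
def kernelRows (w : ℕ) (h : ℕ → ℕ → ZMod d) : ℕ → ℕ → ℕ → ZMod d
  | 0 => fun k l => if k = l then 1 else 0
  | i + 1 => eliminate w (kernelRows w h i) (h i)

theorem pivot_lt (α : ℕ → ZMod d) {w : ℕ} (hw : 0 < w) : pivot α w < w := by
  induction w with
  | zero => omega
  | succ k ih =>
    simp only [pivot]
    split_ifs
    · rcases Nat.eq_zero_or_pos k with rfl | hk
      · simp [pivot]
      · exact (ih hk).trans (Nat.lt_succ_self k)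
    · omega

end

/-- The matrix `B` is stored in array `a`. -/
def Mem.HoldsMatrix {d : ℕ} (σ : Mem) (a w : ℕ) (B : ℕ → ℕ → ZMod d) : Prop :=
  ∀ k < w, ∀ l < w, σ a (k * w + l) = (B k l).val

theorem Mem.HoldsMatrix.congr {d : ℕ} {σ σ' : Mem} {a w : ℕ} {B : ℕ → ℕ → ZMod d}
    (h : σ.HoldsMatrix a w B) (h' : σ' a = σ a) : σ'.HoldsMatrix a w B := by
  unfold Mem.HoldsMatrix; rw [h']; exact h

/-- Matrices are written by a single loop over the flat index, from which row and column are
recovered as quotient and remainder. -/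
theorem Mem.HoldsMatrix.of_flat {d : ℕ} {σ : Mem} {a w : ℕ} {B : ℕ → ℕ → ZMod d}
    (h : ∀ x < w * w, σ a x = (B (x / w) (x % w)).val) : σ.HoldsMatrix a w B := by
  intro k hk l hl
  rw [h]
  · rw [mul_comm k, Nat.mul_add_div (by omega), Nat.div_eq_of_lt hl, Nat.mul_add_mod,
      Nat.mod_eq_of_lt hl, add_zero]
  · calc k * w + l < k * w + w := by omega
      _ = (k + 1) * w := by ring
      _ ≤ w * w := Nat.mul_le_mul_right _ hk

namespace Program
open Qudit.Expr

/-- The unit matrix in array 8. -/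
def unitRows : Cmd :=
  .forTo 23 (var 21 * var 21) <| .store 8 (var 23) <|
    -- The two truncated differences add up to the distance of row and column, and `1` minus this is
    -- the indicator of the diagonal.
    1 - (var 23 / var 21 - var 23 % var 21 + (var 23 % var 21 - var 23 / var 21))

/-- The linear form of sample number `i` in array 9. -/
def sampleForm : Cmd :=
  .forTo 23 (var 21) <| .seq (.store 12 0 0) <| .seq
    (.forTo 24 (var 20) <| .store 12 0 <| (var 12 +
      -- The truncated `1 - c % d` is `1` exactly for the first copy of a group, and `l / n` tells
      -- the first half of the coefficients from the second. So the first half sums the digits of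
      -- the first copies, the second half those of all other copies.
      ((1 - var 24 % get 0 1 + var 23 / get 0 0) % 2) *
      get 2 (var 22 * (var 20 * get 0 0) + (var 24 * get 0 0 + var 23 % get 0 0))) % get 0 1)
    (.store 9 (var 23) (var 12))

/-- The values of the linear form at the rows in array 10. -/
def rowValues : Cmd :=
  .forTo 23 (var 21) <| .seq (.store 12 0 0) <| .seq
    (.forTo 24 (var 21) <| .store 12 0 <|
      (var 12 + get 9 (var 24) * get 8 (var 23 * var 21 + var 24)) % get 0 1)
    (.store 10 (var 23) (var 12))

/-- The pivot and its value. -/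
def findPivot : Cmd :=
  .seq (.store 13 0 0) <| .seq
    (.forTo 23 (var 21) <| .store 13 0 <|
      -- For natural numbers `1 - x` is the indicator of `x = 0`. It selects between the old pivot
      -- and the new index, and in the next line it replaces a pivot value `0` by `1`.
      (1 - get 10 (var 23)) * var 13 + (1 - (1 - get 10 (var 23))) * var 23)
    (.store 14 0 (get 10 (var 13) + (1 - get 10 (var 13))))

/-- The elimination step. -/
def updateRows : Cmd :=
  -- The pivot row is saved first, since it is overwritten together with the other rows.
  .seq (.forTo 23 (var 21) <| .store 11 (var 23) (get 8 (var 13 * var 21 + var 23))) <|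
    .forTo 23 (var 21 * var 21) <| .store 8 (var 23) <|
      -- Adding a multiple by `d - α` replaces the subtraction of a multiple by `α` modulo `d`.
      (var 14 * get 8 (var 23) + (get 0 1 - get 10 (var 23 / var 21)) * get 11 (var 23 % var 21)) %
        get 0 1

def nullSpace : Cmd :=
  .seq unitRows <| .forTo 22 (get 0 2) <| .seq sampleForm <| .seq rowValues <|
    .seq findPivot updateRows

end Program

/-- A loop that forms a sum modulo `M`. -/
theorem Spec.sumLoop {V v a N M : ℕ} {σ : Mem} {e t g : Expr} (f : ℕ → ℕ) (hσ : σ.Bdd V)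
    (hN : N ≤ V) (hva : a ≠ v) (he : ∀ σ', Mem.Agree [a, v] σ σ' → e.eval σ' = N) (h0 : σ a 0 = 0)
    (hM : 0 < M) (hMV : M ≤ V) (hg : ∀ σ', Mem.Agree [a, v] σ σ' → g.eval σ' = M)
    (hs : ∀ i < N, ∀ σ', Mem.Agree [a, v] σ σ' → σ' v 0 = i → t.eval σ' = f i) :
    Spec V (.forTo v e (.store a 0 ((.var a + t) % g))) σ fun σ' =>
      Mem.Agree [a, v] σ σ' ∧ σ' a 0 = (∑ i ∈ Finset.range N, f i) % M := by
  refine Spec.scalarLoop (fun i => (∑ i ∈ Finset.range i, f i) % M) hσ hN hva he (by simp [h0]) ?_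
    fun i _ => (Nat.mod_lt _ hM).le.trans hMV
  intro i hi σ' h1 h2 h3
  simp [hg σ' h1, hs i hi σ' h1 h2, h3, Finset.sum_range_succ]

/-! ### Correctness of the null space program -/

section
variable {V n d m : ℕ} [Fact d.Prime]

theorem spec_unitRows (hF : Fits V n d m) {σ : Mem} (hσ : σ.Bdd V) (hE : Env n d m σ) :
    Spec V Program.unitRows σ fun σ' => Mem.Agree [8, 23] σ σ' ∧
      σ'.HoldsMatrix 8 (n + n) (kernelRows (d := d) (n + n) (fun _ _ => 0) 0) := by
  refine (Spec.fillExprLoop (N := (n + n) * (n + n))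
    (fun x => if x / (n + n) = x % (n + n) then 1 else 0) hσ hF.square (by decide)
    (fun σ' h => by simp [(hE.agree h).width]) ?_ ?_).mono fun σ' h => ⟨h.1, .of_flat fun x hx => ?_⟩
  · intro i hi σ' h c _
    have E := hE.agree h
    simp only [Expr.eval_sub, Expr.eval_add, Expr.eval_div, Expr.eval_mod, Expr.eval_var, c, E.width,
      Expr.eval_one]
    split_ifs <;> omega
  · intro i _
    have := hF.four
    split_ifs <;> omega
  · have : 1 < d := (Fact.out : d.Prime).one_lt
    have : Fact (1 < d) := ⟨this⟩
    rw [h.2, if_pos hx]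
    simp only [kernelRows]
    split_ifs <;> simp [ZMod.val_one]

theorem spec_sampleForm (hF : Fits V n d m) {σ : Mem} (hσ : σ.Bdd V) (hE : Env n d m σ) {i : ℕ}
    (hi : σ 22 0 = i) (h : ℕ → ZMod d)
    (hh : ∀ l < n + n, ((∑ c ∈ Finset.range (numCopies d), ((1 - c % d + l / n) % 2) *
      σ 2 (i * (numCopies d * n) + (c * n + l % n)) : ℕ) : ZMod d) = h l) :
    Spec V Program.sampleForm σ fun σ' => Mem.Agree [9, 12, 23, 24] σ σ' ∧
      ∀ l < n + n, σ' 9 l = (h l).val := by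
  have hd : 0 < d := (Fact.out : d.Prime).pos
  have hw := hF.width
  have hdim := hF.dim
  have hD := numCopies_le d
  refine (Spec.fillLoop (a := 9) (N := n + n) (A := [9, 12, 23, 24]) (fun l => (h l).val) hσ hw
    (by simp) (by decide) (fun σ' h => by simp [(hE.agree h).width]) ?_).mono
    fun σ' h => ⟨h.1, fun x hx => by rw [h.2, if_pos hx]⟩
  intro l hl σ1 b1 a1 c1 _
  have E1 := hE.agree a1
  refine Spec.assign_seq b1 (p := 0) (x := 0) (by simp) (by simp) (by omega) fun σ2 b2 a2 u2 => ?_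
  have E2 := E1.agree a2
  refine Spec.seq (Spec.sumLoop (N := numCopies d) (M := d) (fun c => ((1 - c % d + l / n) % 2) *
      σ 2 (i * (numCopies d * n) + (c * n + l % n))) b2 (by omega) (by decide)
      (fun σ' h => by simp [(E2.agree h).copies]) (by simp [u2]) hd (by omega)
      (fun σ' h => by simp [(E2.agree h).base]) ?_) ?_
  · intro c hc σ3 a3 c3
    have E3 := E2.agree a3
    simp [E3.qudits, E3.base, E3.copies, c3, a3.at 22, a3.at 23, a2.at 22, a2.at 23, a1.at 22, c1,
      a3.at 2, a2.at 2, a1.at 2, hi]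
  · rintro σ3 b3 ⟨a3, v3⟩
    refine Spec.assign b3 (p := l) (x := (h l).val) (by simp [a3.at 23, a2.at 23, c1]) ?_
      ((ZMod.val_lt _).le.trans (by omega)) fun σ4 b4 a4 u4 =>
      ⟨((a1.trans (a2.mono (by simp))).trans (a3.mono (by simp))).trans (a4.mono (by simp)),
        by rw [a4.at 23, a3.at 23, a2.at 23, c1], by rw [u4, a3.at 9, a2.at 9]⟩
    rw [Expr.eval_var, v3, ← hh l hl, ZMod.val_natCast]

theorem spec_rowValues (hF : Fits V n d m) {σ : Mem} (hσ : σ.Bdd V) (hE : Env n d m σ)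
    {h : ℕ → ZMod d} {B : ℕ → ℕ → ZMod d} (hh : ∀ l < n + n, σ 9 l = (h l).val)
    (hB : σ.HoldsMatrix 8 (n + n) B) :
    Spec V Program.rowValues σ fun σ' => Mem.Agree [10, 12, 23, 24] σ σ' ∧
      ∀ k < n + n, σ' 10 k = (pairing (n + n) h (B k)).val := by
  have hd : 0 < d := (Fact.out : d.Prime).pos
  have hw := hF.width
  have hdim := hF.dim
  refine (Spec.fillLoop (a := 10) (N := n + n) (A := [10, 12, 23, 24])
    (fun k => (pairing (n + n) h (B k)).val) hσ hw
    (by simp) (by decide) (fun σ' h => by simp [(hE.agree h).width]) ?_).mono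
    fun σ' h => ⟨h.1, fun x hx => by rw [h.2, if_pos hx]⟩
  intro k hk σ1 b1 a1 c1 _
  have E1 := hE.agree a1
  refine Spec.assign_seq b1 (p := 0) (x := 0) (by simp) (by simp) (by omega) fun σ2 b2 a2 u2 => ?_
  have E2 := E1.agree a2
  refine Spec.seq (Spec.sumLoop (N := n + n) (M := d) (fun l => (h l).val * (B k l).val) b2 hw
      (by decide) (fun σ' h => by simp [(E2.agree h).width]) (by simp [u2]) hd (by omega)
      (fun σ' h => by simp [(E2.agree h).base]) ?_) ?_
  · intro l hl σ3 a3 c3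
    have E3 := E2.agree a3
    simp [E3.width, c3, a3.at 23, a2.at 23, c1, a3.at 9, a2.at 9, a1.at 9, a3.at 8, a2.at 8,
      a1.at 8, hh l hl, hB k hk l hl]
  · rintro σ3 b3 ⟨a3, v3⟩
    refine Spec.assign b3 (p := k) (x := (pairing (n + n) h (B k)).val)
      (by simp [a3.at 23, a2.at 23, c1]) ?_
      ((ZMod.val_lt _).le.trans (by omega)) fun σ4 b4 a4 u4 =>
      ⟨((a1.trans (a2.mono (by simp))).trans (a3.mono (by simp))).trans (a4.mono (by simp)),
        by rw [a4.at 23, a3.at 23, a2.at 23, c1], by rw [u4, a3.at 10, a2.at 10]⟩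
    rw [Expr.eval_var, v3, ← ZMod.val_natCast]
    simp [pairing]

theorem spec_findPivot (hF : Fits V n d m) {σ : Mem} (hσ : σ.Bdd V) (hE : Env n d m σ)
    (hn : 0 < n + n) {α : ℕ → ZMod d} (hα : ∀ k < n + n, σ 10 k = (α k).val) :
    Spec V Program.findPivot σ fun σ' => Mem.Agree [13, 14, 23] σ σ' ∧
      σ' 13 0 = pivot α (n + n) ∧ σ' 14 0 = (pivotValue α (n + n)).val := by
  have hw := hF.width
  have hdim := hF.dim
  have hp := pivot_lt α hn
  have h1d : 1 < d := (Fact.out : d.Prime).one_lt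
  have : Fact (1 < d) := ⟨h1d⟩
  refine Spec.assign_seq hσ (p := 0) (x := 0) (by simp) (by simp) (by omega) fun σ2 b2 a2 u2 => ?_
  have E2 := hE.agree a2
  refine Spec.seq (Spec.scalarLoop (N := n + n) (pivot α) b2 hw
      (by decide) (fun σ' h => by simp [(E2.agree h).width]) (by simp [u2, pivot]) ?_ ?_) ?_
  · intro k hk σ3 a3 c3 v3
    have hz : (α k).val = 0 ↔ α k = 0 := ZMod.val_eq_zero _
    simp only [Expr.eval_add, Expr.eval_mul, Expr.eval_sub, Expr.eval_get, Expr.eval_var, c3,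
      Expr.eval_one, a3.at 10, a2.at 10, hα k hk, v3, pivot]
    by_cases h : α k = 0
    · simp [h]
    · have : (α k).val ≠ 0 := fun h' => h (hz.1 h')
      rw [if_neg h, Nat.sub_eq_zero_of_le (by omega : 1 ≤ (α k).val)]
      simp
  · intro k hk
    exact (pivot_lt α (Nat.succ_pos k)).le.trans (by omega)
  · rintro σ3 b3 ⟨a3, v3⟩
    refine Spec.assign b3 (p := 0) (x := (pivotValue α (n + n)).val) (by simp) ?_
      ((ZMod.val_lt _).le.trans (by omega)) fun σ4 b4 a4 u4 =>
      ⟨((a2.mono (by simp)).trans (a3.mono (by simp))).trans (a4.mono (by simp)),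
        by rw [a4.at 13, v3], by simp [u4]⟩
    have hz : (α (pivot α (n + n))).val = 0 ↔ α (pivot α (n + n)) = 0 := ZMod.val_eq_zero _
    simp only [Expr.eval_add, Expr.eval_sub, Expr.eval_get, Expr.eval_var, v3, Expr.eval_one,
      a3.at 10, a2.at 10, hα _ hp, pivotValue]
    split_ifs with h
    · simp [h, ZMod.val_one]
    · have : (α (pivot α (n + n))).val ≠ 0 := fun h' => h (hz.1 h')
      omega

theorem spec_updateRows (hF : Fits V n d m) {σ : Mem} (hσ : σ.Bdd V) (hE : Env n d m σ)
    {B : ℕ → ℕ → ZMod d} {α : ℕ → ZMod d} {p : ℕ} {pv : ZMod d} (hp : p < n + n ∨ n + n = 0)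
    (hα : ∀ k < n + n, σ 10 k = (α k).val) (h13 : n + n ≠ 0 → σ 13 0 = p)
    (h14 : n + n ≠ 0 → σ 14 0 = pv.val) (hB : σ.HoldsMatrix 8 (n + n) B) :
    Spec V Program.updateRows σ fun σ' => Mem.Agree [8, 11, 23] σ σ' ∧
      σ'.HoldsMatrix 8 (n + n) fun k l => pv * B k l - α k * B p l := by
  have hw := hF.width
  have hdim := hF.dim
  have hVd : ∀ x : ZMod d, x.val ≤ V := fun x => (ZMod.val_lt x).le.trans (by omega)
  refine Spec.seq (Spec.fillExprLoop (N := n + n) (fun l => (B p l).val) hσ hw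
      (by decide) (fun σ' h => by simp [(hE.agree h).width]) ?_ fun _ _ => hVd _) ?_
  · intro l hl σ1 a1 c1 _
    have E1 := hE.agree a1
    simp [c1, E1.width, a1.at 13, h13 (by omega), a1.at 8, hB p (by omega) l hl]
  rintro σ2 b2 ⟨a2, v2⟩
  have E2 := hE.agree a2
  refine (Spec.fillExprLoop (N := (n + n) * (n + n)) (fun x => (pv * B (x / (n + n)) (x % (n + n)) -
      α (x / (n + n)) * B p (x % (n + n))).val) b2 hF.square
      (by decide) (fun σ' h => by simp [(E2.agree h).width]) ?_ fun _ _ => hVd _).mono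
      fun σ' h => ⟨(a2.mono (by simp)).trans (h.1.mono (by simp)),
        .of_flat fun x hx => by rw [h.2, if_pos hx]⟩
  intro x hx σ3 a3 c3 v3
  have E3 := E2.agree a3
  have hn : 0 < n + n := Nat.pos_of_ne_zero (by rintro h; simp [h] at hx)
  have hm := Nat.mod_lt x hn
  have hq : x / (n + n) < n + n := Nat.div_lt_of_lt_mul hx
  have h8 : σ3 8 x = (B (x / (n + n)) (x % (n + n))).val := by
    rw [v3, a2.at 8, ← hB _ hq _ hm]; congr 1; rw [mul_comm]; exact (Nat.div_add_mod x _).symm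
  simp only [Expr.eval_add, Expr.eval_mul, Expr.eval_sub, Expr.eval_mod, Expr.eval_div,
    Expr.eval_get, Expr.eval_var, c3, Expr.eval_one, E3.width, E3.base, h8,
    a3.at 10, a2.at 10, hα _ hq, a3.at 11, v2, if_pos hm, a3.at 14, a2.at 14, h14 hn.ne']
  rw [← ZMod.val_natCast]
  congr 1
  rw [Nat.cast_add, Nat.cast_mul, Nat.cast_mul, Nat.cast_sub (ZMod.val_lt _).le]
  simp [sub_eq_add_neg]

theorem spec_nullSpace (hF : Fits V n d m) {σ : Mem} (hσ : σ.Bdd V) (hE : Env n d m σ)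
    (h : ℕ → ℕ → ZMod d)
    (hh : ∀ i < m, ∀ l < n + n, ((∑ c ∈ Finset.range (numCopies d), ((1 - c % d + l / n) % 2) *
      σ 2 (i * (numCopies d * n) + (c * n + l % n)) : ℕ) : ZMod d) = h i l) :
    Spec V Program.nullSpace σ fun σ' =>
      Mem.Agree [8, 9, 10, 11, 12, 13, 14, 22, 23, 24] σ σ' ∧
      σ'.HoldsMatrix 8 (n + n) (kernelRows (n + n) h m) := by
  have hw := hF.width
  have hr := hF.rounds
  refine Spec.seq (spec_unitRows hF hσ hE) ?_
  rintro σ1 b1 ⟨a1, B1⟩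
  have E1 := hE.agree a1
  refine (Spec.forTo (N := m) (A := [8, 9, 10, 11, 12, 13, 14, 22, 23, 24])
    (fun i σ' => σ'.HoldsMatrix 8 (n + n) (kernelRows (n + n) h i)) b1 hr (by simp)
    (fun σ' h => by simp [(E1.agree h).rounds]) B1
    (fun i σ₁ σ₂ h h' => h'.congr (h.at 8)) ?_).mono
    fun σ' h => ⟨(a1.mono (by simp)).trans h.1, h.2⟩
  intro i hi σ2 b2 a2 c2 B2
  have E2 := E1.agree a2
  refine Spec.seq (spec_sampleForm hF b2 E2 c2 (h i)
    (by rw [a2.at 2, a1.at 2]; exact hh i hi)) ?_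
  rintro σ3 b3 ⟨a3, h3⟩
  have E3 := E2.agree a3
  refine Spec.seq (spec_rowValues hF b3 E3 h3 (B2.congr (a3.at 8))) ?_
  rintro σ4 b4 ⟨a4, h4⟩
  have E4 := E3.agree a4
  have hA : Mem.Agree [8, 9, 10, 11, 12, 13, 14, 22, 23, 24] σ1 σ4 :=
    (a2.trans (a3.mono (by simp))).trans (a4.mono (by simp))
  have B4 : σ4.HoldsMatrix 8 (n + n) (kernelRows (n + n) h i) :=
    B2.congr ((a4.at 8).trans (a3.at 8))
  have c4 : σ4 22 0 = i := by rw [a4.at 22, a3.at 22, c2]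
  set α : ℕ → ZMod d := fun k => pairing (n + n) (h i) (kernelRows (n + n) h i k)
  refine Spec.seq (R := fun σ' => Mem.Agree [13, 14, 23] σ4 σ' ∧
      (n + n ≠ 0 → σ' 13 0 = pivot α (n + n)) ∧
      (n + n ≠ 0 → σ' 14 0 = (pivotValue α (n + n)).val)) ?_ ?_
  -- Without qudits the pivot search is still executed. Its results are irrelevant and only the
  -- bound on the cells has to be checked.
  · rcases Nat.eq_zero_or_pos (n + n) with h0 | h0
    · refine Spec.assign_seq b4 (p := 0) (x := 0) (by simp) (by simp) (by omega)
        fun σ5 b5 a5 u5 => ?_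
      have E5 := E4.agree a5
      refine Spec.seq (Spec.scalarLoop (N := 0) (fun _ => 0) b5 (by omega)
        (by decide) (fun σ' h => by simp [(E5.agree h).width, h0]) (by simp [u5])
        (fun _ h => by omega) (by simp)) ?_
      rintro σ6 b6 ⟨a6, v6⟩
      have h10 : Expr.eval σ6 (.get 10 (.var 13) + (1 - .get 10 (.var 13))) ≤ V := by
        have h1 := b6 10 (σ6 13 0)
        have h2 := hF.four
        simp
        omega
      exact Spec.assign b6 (p := 0) (by simp) rfl h10 fun σ7 b7 a7 u7 =>
        ⟨((a5.mono (by simp)).trans (a6.mono (by simp))).trans (a7.mono (by simp)), by omega, by omega⟩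
    · exact (spec_findPivot hF b4 E4 h0 h4).mono fun σ' h => ⟨h.1, fun _ => h.2.1, fun _ => h.2.2⟩
  rintro σ5 b5 ⟨a5, p5, v5⟩
  have E5 := E4.agree a5
  refine (spec_updateRows hF b5 E5 (p := pivot α (n + n)) (α := α) ?_
    (by rw [a5.at 10]; exact h4) p5 v5 (B4.congr (a5.at 8))).mono fun σ6 h6 =>
    ⟨(hA.trans (a5.mono (by simp))).trans (h6.1.mono (by simp)), ?_, h6.2⟩
  · rcases Nat.eq_zero_or_pos (n + n) with h0 | h0
    · exact Or.inr h0
    · exact Or.inl (pivot_lt _ h0)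
  · rw [h6.1.at 22, a5.at 22, c4]

end

/-! ### Lists of points and codes of the final readout -/

section
variable {d : ℕ}

/-- The non-zero rows among the first `N` rows of `B`. -/
def nonzeroRows (w : ℕ) (B : ℕ → ℕ → ZMod d) (N : ℕ) : List (ℕ → ZMod d) :=
  ((List.range N).filter fun k => decide (∃ l < w, B k l ≠ 0)).map B

/-- The table of the digits of a list of rows. -/
def rowDigits (w : ℕ) (L : List (ℕ → ZMod d)) : List (Fin w → ℕ) :=
  L.map fun x t => (x t).val

theorem nonzeroRows_length_le (w : ℕ) (B : ℕ → ℕ → ZMod d) (N : ℕ) :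
    (nonzeroRows w B N).length ≤ N := by
  simpa [nonzeroRows] using List.length_filter_le (fun k => decide (∃ l < w, B k l ≠ 0)) (List.range N)

theorem nonzeroRows_succ (w : ℕ) (B : ℕ → ℕ → ZMod d) (N : ℕ) :
    nonzeroRows w B (N + 1) = nonzeroRows w B N ++ if ∃ l < w, B N l ≠ 0 then [B N] else [] := by
  rw [nonzeroRows, List.range_succ, List.filter_append, List.map_append, ← nonzeroRows]
  congr 1
  by_cases h : ∃ l < w, B N l ≠ 0
  · rw [if_pos h, List.filter_cons_of_pos (by simpa using h)]; rfl
  · rw [if_neg h, List.filter_cons_of_neg (by simpa using h)]; rfl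

/-- The last `t` below a bound with `d ∣ a + t b`, or `0`. -/
def searchPhase (d a b : ℕ) : ℕ → ℕ
  | 0 => 0
  | t + 1 => if (a + t * b) % d = 0 then t else searchPhase d a b t

/-- The number of phase gates that turn a multiple of `Z^a X^b` into a multiple of `X^b`. -/
def phaseCount (a b : ZMod d) : ℕ := searchPhase d a.val b.val d

/-- With `N = d` at most `d - 1` phase gates occur, so together with the Fourier gate at most `d`
gates act on a qudit. -/
theorem searchPhase_le (a b N : ℕ) : searchPhase d a b N ≤ N - 1 := by
  induction N with
  | zero => simp [searchPhase]
  | succ t ih => rw [searchPhase]; split_ifs <;> omega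

/-- The codes of the gates on qudit `j` of copy `k` in the final readout. -/
def readoutBlock (k j : ℕ) (a b : ZMod d) : List (Fin 5 → ℕ) :=
  if b = 0 then [] else List.replicate (phaseCount a b) ![1, k, j, 0, 0] ++ [![0, k, j, 0, 0]]

/-- The codes of the gates of the final readout of the points `x 0, …, x (K-1)`. -/
def readoutCode (n : ℕ) (x : ℕ → ℕ → ZMod d) (K : ℕ) : List (Fin 5 → ℕ) :=
  (List.range K).flatMap fun k => (List.range n).flatMap fun j =>
    readoutBlock k j (x k j) (x k (n + j))

theorem readoutBlock_length_le [NeZero d] (k j : ℕ) (a b : ZMod d) :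
    (readoutBlock k j a b).length ≤ d := by
  have hd : 0 < d := Nat.pos_of_ne_zero (NeZero.ne d)
  have := searchPhase_le (d := d) a.val b.val d
  unfold readoutBlock phaseCount
  split_ifs
  · simp
  · simp; omega

theorem length_flatMap_range_le {α : Type*} (f : ℕ → List α) (N b : ℕ) (h : ∀ i, (f i).length ≤ b) :
    ((List.range N).flatMap f).length ≤ N * b := by
  induction N with
  | zero => simp
  | succ N ih =>
    rw [List.range_succ, List.flatMap_append, List.length_append, add_mul, one_mul]
    exact Nat.add_le_add ih (by simpa using h N)

/-- The contribution of a qudit with the outcome `s` to the exponent of the phase of a point. -/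
def phaseTerm (a b : ZMod d) (s : ℕ) : ℕ :=
  -- The first summand undoes the prefactor of the Weyl operator and the phases produced by the
  -- phase gates. In the second, `b + (1 - b) * a` equals `b` if `b ≠ 0` and `a` otherwise, which is
  -- the Z exponent seen by the measurement. As `τ² = ω`, the factor `2 * (d - 1)` inverts the power
  -- of `ω`.
  b.val * (a.val + phaseCount a b * b.val) + 2 * (d - 1) * (b.val + (1 - b.val) * a.val) * s

/-- The exponent of the phase of the point `x`, read off from the outcomes `s`. -/
def phaseExponent (n : ℕ) (x : ℕ → ZMod d) (s : ℕ → ℕ) : ℕ :=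
  (∑ j ∈ Finset.range n, phaseTerm (x j) (x (n + j)) (s j)) % (2 * d)

end

namespace Program
open Qudit.Expr

/-- Append the non-zero rows in array 8 to the list in array 3. -/
def compress : Cmd :=
  .forTo 22 (var 21) <| .seq (.store 12 0 0) <| .seq
    -- The truncated `1 - (1 - x)` is `min x 1`, so the variable records whether a non-zero digit
    -- has been seen.
    (.forTo 23 (var 21) <| .store 12 0 <| 1 - (1 - (var 12 + get 8 (var 22 * var 21 + var 23)))) <|
    .cond (var 12)
      (.seq (.forTo 23 (var 21) <|
          .store 3 (1 + var 21 * get 3 0 + var 23) (get 8 (var 22 * var 21 + var 23)))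
        (.store 3 0 (get 3 0 + 1)))
      .skip

/-- The number of copies for the final readout. -/
def setExtra : Cmd := .cond (get 3 0 - get 0 0) (.store 5 0 0) (.store 5 0 (get 3 0))

/-- Load the digits of qudit `j` of point number `k` and find the number of phase gates. -/
def search : Cmd :=
  .seq (.store 15 0 (get 3 (1 + var 21 * var 22 + var 23))) <|
  .seq (.store 16 0 (get 3 (1 + var 21 * var 22 + (get 0 0 + var 23)))) <|
  .seq (.store 17 0 0) <| .forTo 24 (get 0 1) <| .store 17 0 <|
    (1 - (var 15 + var 24 * var 16) % get 0 1) * var 24 +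
      (1 - (1 - (var 15 + var 24 * var 16) % get 0 1)) * var 17

/-- Writing down the circuit of the final readout. -/
def readout : Cmd :=
  .forTo 22 (get 5 0) <| .forTo 23 (get 0 0) <| .seq search <| .cond (var 16)
    (.seq (.forTo 25 (var 17) <| .push 4 1 (var 22) (var 23) 0 0)
      (.push 4 0 (var 22) (var 23) 0 0))
    .skip

def post : Cmd := .seq nullSpace <| .seq compress <| .seq setExtra readout

/-- The phases of the points. -/
def finish : Cmd :=
  .forTo 22 (get 5 0) <| .seq (.store 12 0 0) <| .seq
    (.forTo 23 (get 0 0) <| .seq search <| .store 12 0 <|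
      (var 12 + (var 16 * (var 15 + var 17 * var 16) +
        2 * (get 0 1 - 1) * (var 16 + (1 - var 16) * var 15) *
          get 6 (var 23 + get 0 0 * var 22))) % (2 * get 0 1))
    (.store 7 (var 22) (var 12))

end Program

/-! ### Correctness of the programs after the measurements -/

section
variable {V n d m : ℕ} [Fact d.Prime]

theorem spec_compress (hF : Fits V n d m) {σ : Mem} (hσ : σ.Bdd V) (hE : Env n d m σ)
    {B : ℕ → ℕ → ZMod d} (hB : σ.HoldsMatrix 8 (n + n) B) (h3 : σ 3 0 = 0) :
    Spec V Program.compress σ fun σ' => Mem.Agree [3, 12, 22, 23] σ σ' ∧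
      σ'.Holds 3 (rowDigits (n + n) (nonzeroRows (n + n) B (n + n))) := by
  have hw := hF.width
  have hdim := hF.dim
  have h4 := hF.four
  refine (Spec.forTo (N := n + n) (A := [3, 12, 22, 23])
    (fun i σ' => σ'.Holds 3 (rowDigits (n + n) (nonzeroRows (n + n) B i))) hσ hw (by simp)
    (fun σ' h => by simp [(hE.agree h).width]) (.nil h3)
    (fun i σ₁ σ₂ h h' => h'.congr (h.at 3)) ?_)
  intro k hk σ1 b1 a1 c1 H1
  have E1 := hE.agree a1
  refine Spec.assign_seq b1 (p := 0) (x := 0) (by simp) (by simp) (by omega) fun σ2 b2 a2 u2 => ?_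
  have E2 := E1.agree a2
  refine Spec.seq (Spec.scalarLoop (N := n + n) (fun i => if ∃ l < i, B k l ≠ 0 then 1 else 0)
    b2 hw (by decide) (fun σ' h => by simp [(E2.agree h).width]) (by simp [u2]) ?_ ?_) ?_
  · intro l hl σ3 a3 c3 v3
    have E3 := E2.agree a3
    have hz : (B k l).val = 0 ↔ B k l = 0 := ZMod.val_eq_zero _
    have hex : (∃ l' < l + 1, B k l' ≠ 0) ↔ (∃ l' < l, B k l' ≠ 0) ∨ B k l ≠ 0 := by
      constructor
      · rintro ⟨l', h, h'⟩
        rcases Nat.lt_succ_iff_lt_or_eq.1 h with h | rfl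
        · exact Or.inl ⟨l', h, h'⟩
        · exact Or.inr h'
      · rintro (⟨l', h, h'⟩ | h')
        · exact ⟨l', by omega, h'⟩
        · exact ⟨l, by omega, h'⟩
    simp only [Expr.eval_sub, Expr.eval_add, Expr.eval_mul, Expr.eval_get, Expr.eval_var, v3,
      E3.width, c3, a3.at 22, a2.at 22, c1, a3.at 8, a2.at 8, a1.at 8, hB k hk l hl, Expr.eval_one,
      hex]
    by_cases hp : ∃ l' < l, B k l' ≠ 0
    · rw [if_pos hp, if_pos (Or.inl hp)]; omega
    · rw [if_neg hp]
      by_cases hq : B k l = 0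
      · rw [if_neg (by simp only [hp, false_or, not_not, hq])]; simp [hq]
      · rw [if_pos (Or.inr hq)]
        have : (B k l).val ≠ 0 := fun h' => hq (hz.1 h')
        omega
  · intro i _; split_ifs <;> omega
  rintro σ3 b3 ⟨a3, v3⟩
  have E3 := E2.agree a3
  have H3 : σ3.Holds 3 (rowDigits (n + n) (nonzeroRows (n + n) B k)) :=
    H1.congr ((a3.at 3).trans (a2.at 3))
  have A3 : Mem.Agree [3, 12, 22, 23] σ σ3 :=
    (a1.trans (a2.mono (by simp))).trans (a3.mono (by simp))
  have c22 : σ3 22 0 = k := by rw [a3.at 22, a2.at 22, c1]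
  set len := (nonzeroRows (n + n) B k).length with hlen
  have hl3 : σ3 3 0 = len := by rw [H3.1]; simp [rowDigits, hlen]
  have hlen' : len ≤ k := nonzeroRows_length_le _ _ _
  rw [nonzeroRows_succ]
  refine Spec.cond b3 (fun he => ?_) fun he => ?_
  · have he' : ∃ l < n + n, B k l ≠ 0 := by
      by_contra h; simp [v3, if_neg h] at he
    rw [if_pos he']
    -- The row is written behind the end of the list, whose length and earlier rows stay untouched
    -- until the row is complete.
    refine Spec.seq (Spec.forTo (N := n + n) (A := [3, 23]) (fun i σ' => σ' 3 0 = len ∧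
      (∀ x, x ≠ 0 → x < 1 + (n + n) * len → σ' 3 x = σ3 3 x) ∧
      ∀ l < i, σ' 3 (1 + (n + n) * len + l) = (B k l).val) b3 hw (by simp)
      (fun σ' h => by simp [(E3.agree h).width]) ⟨hl3, fun _ _ _ => rfl, by simp⟩
      (fun i σ₁ σ₂ h h' => by rw [h.at 3]; exact h') ?_) ?_
    · rintro l hl σ4 b4 a4 c4 ⟨p1, p2, p3⟩
      have E4 := E3.agree a4
      refine Spec.assign b4 (p := 1 + (n + n) * len + l) (x := (B k l).val)
        (by simp [E4.width, p1, c4])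
        (by simp [E4.width, a4.at 22, c22, c4, a4.at 8, a3.at 8, a2.at 8, a1.at 8, hB k hk l hl])
        ((ZMod.val_lt _).le.trans (by omega)) fun σ5 b5 a5 u5 =>
        ⟨a4.trans (a5.mono (by simp)), by rw [a5.at 23, c4], ?_, ?_, ?_⟩
      · rw [u5, Function.update_of_ne (by omega), p1]
      · intro x hx hx'
        rw [u5, Function.update_of_ne (by omega), p2 x hx hx']
      · intro l' hl'
        rw [u5, Function.update_apply]
        split_ifs with h
        · congr 2; omega
        · exact p3 l' (by omega)
    · rintro σ4 b4 ⟨a4, p1, p2, p3⟩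
      refine Spec.assign b4 (p := 0) (x := len + 1) (by simp) (by simp [p1]) (by omega)
        fun σ5 b5 a5 u5 => ⟨(A3.trans (a4.mono (by simp))).trans (a5.mono (by simp)),
          by rw [a5.at 22, a4.at 22, c22], ?_⟩
      rw [rowDigits, List.map_append, ← rowDigits]
      have hL : (rowDigits (n + n) (nonzeroRows (n + n) B k)).length = len := by simp [rowDigits, hlen]
      refine H3.append _ ?_ ?_ ?_
      · simp [u5, hL]
      · intro x hx hx'
        rw [hL] at hx'
        rw [u5, Function.update_of_ne hx, p2 x hx hx']
      · intro t
        rw [hL, u5, Function.update_of_ne (by omega), p3 t t.2]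
  · have he' : ¬ ∃ l < n + n, B k l ≠ 0 := by
      intro h; simp [v3, if_pos h] at he
    rw [if_neg he', List.append_nil]
    exact Spec.skip b3 ⟨A3, c22, H3⟩

theorem spec_search (hF : Fits V n d m) {σ : Mem} (hσ : σ.Bdd V) (hE : Env n d m σ)
    {k j : ℕ} {a b : ZMod d} (hk : σ 22 0 = k) (hj : σ 23 0 = j)
    (ha : σ 3 (1 + (n + n) * k + j) = a.val) (hb : σ 3 (1 + (n + n) * k + (n + j)) = b.val) :
    Spec V Program.search σ fun σ' => Mem.Agree [15, 16, 17, 24] σ σ' ∧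
      σ' 15 0 = a.val ∧ σ' 16 0 = b.val ∧ σ' 17 0 = phaseCount a b := by
  have hdim := hF.dim
  have hVd : ∀ x : ZMod d, x.val ≤ V := fun x => (ZMod.val_lt x).le.trans (by omega)
  refine Spec.assign_seq hσ (p := 0) (x := a.val) (by simp) (by simp [hE.width, hk, hj, ha]) (hVd _)
    fun σ1 b1 a1 u1 => ?_
  have E1 := hE.agree a1
  refine Spec.assign_seq b1 (p := 0) (x := b.val) (by simp)
    (by simp [E1.width, E1.qudits, a1.at 22, a1.at 23, a1.at 3, hk, hj, hb]) (hVd _)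
    fun σ2 b2 a2 u2 => ?_
  have E2 := E1.agree a2
  refine Spec.assign_seq b2 (p := 0) (x := 0) (by simp) (by simp) (by omega) fun σ3 b3 a3 u3 => ?_
  have E3 := E2.agree a3
  have h15 : σ3 15 0 = a.val := by rw [a3.at 15, a2.at 15, u1]; simp
  have h16 : σ3 16 0 = b.val := by rw [a3.at 16, u2]; simp
  refine (Spec.scalarLoop (N := d) (searchPhase d a.val b.val) b3 (by omega) (by decide)
    (fun σ' h => by simp [(E3.agree h).base]) (by simp [u3, searchPhase]) ?_ ?_).mono
    fun σ4 ⟨a4, v4⟩ => ⟨(((a1.mono (by simp)).trans (a2.mono (by simp))).trans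
      (a3.mono (by simp))).trans (a4.mono (by simp)), by rw [a4.at 15, h15], by rw [a4.at 16, h16], v4⟩
  · intro t ht σ4 a4 c4 v4
    have E4 := E3.agree a4
    simp only [Expr.eval_sub, Expr.eval_add, Expr.eval_mul, Expr.eval_mod, Expr.eval_get,
      Expr.eval_var, v4, E4.base, c4, a4.at 15, a4.at 16, h15, h16, Expr.eval_one,
      searchPhase]
    split_ifs with h
    · simp [h]
    · have : 1 - (a.val + t * b.val) % d = 0 := by omega
      simp [this]
  · intro i hi
    have := searchPhase_le (d := d) a.val b.val (i + 1)
    omega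

theorem spec_readout (hF : Fits V n d m) {σ : Mem} (hσ : σ.Bdd V) (hE : Env n d m σ)
    {K : ℕ} (hK : σ 5 0 = K) (hKn : K ≤ n) {x : ℕ → ℕ → ZMod d}
    (hx : ∀ k < K, ∀ l < n + n, σ 3 (1 + (n + n) * k + l) = (x k l).val) (h4 : σ 4 0 = 0) :
    Spec V Program.readout σ fun σ' =>
      Mem.Agree [4, 15, 16, 17, 22, 23, 24, 25] σ σ' ∧ σ'.Holds 4 (readoutCode n x K) := by
  have hw := hF.width
  have hdim := hF.dim
  have hread := hF.readout
  have hfour := hF.four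
  have hdpos : 0 < d := (Fact.out : d.Prime).pos
  refine Spec.forTo (N := K) (A := [4, 15, 16, 17, 22, 23, 24, 25])
    (fun i σ' => σ'.Holds 4 (readoutCode n x i)) hσ (by omega) (by simp)
    (fun σ' h => by simp [h.at 5, hK]) (.nil h4)
    (fun i σ₁ σ₂ h h' => h'.congr (h.at 4)) ?_
  intro k hk σ1 b1 a1 c1 H1
  have E1 := hE.agree a1
  have hcode : readoutCode n x (k + 1) = readoutCode n x k ++
      (List.range n).flatMap fun j => readoutBlock k j (x k j) (x k (n + j)) := by
    simp [readoutCode, List.range_succ]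
  rw [hcode]
  refine (Spec.forTo (N := n) (A := [4, 15, 16, 17, 23, 24, 25])
    (fun i σ' => σ'.Holds 4 (readoutCode n x k ++ (List.range i).flatMap fun j =>
      readoutBlock k j (x k j) (x k (n + j)))) b1 (by omega) (by simp)
    (fun σ' h => by simp [(E1.agree h).qudits]) (by simpa using H1)
    (fun i σ₁ σ₂ h h' => h'.congr (h.at 4)) ?_).mono
    fun σ' h => ⟨a1.trans (h.1.mono (by simp)), by rw [h.1.at 22, c1], h.2⟩
  intro j hj σ2 b2 a2 c2 H2
  have E2 := E1.agree a2
  have c22 : σ2 22 0 = k := by rw [a2.at 22, c1]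
  have hx2 : ∀ l < n + n, σ2 3 (1 + (n + n) * k + l) = (x k l).val := fun l hl => by
    rw [a2.at 3, a1.at 3, hx k hk l hl]
  refine Spec.seq (spec_search hF b2 E2 c22 c2 (hx2 j (by omega)) (hx2 (n + j) (by omega))) ?_
  rintro σ3 b3 ⟨a3, v15, v16, v17⟩
  have E3 := E2.agree a3
  set L := readoutCode n x k ++ (List.range j).flatMap fun j =>
      readoutBlock k j (x k j) (x k (n + j)) with hL
  have H3 : σ3.Holds 4 L := H2.congr (a3.at 4)
  have hlen : L.length + d ≤ V := by
    have h1 : (readoutCode n x k).length ≤ k * (n * d) :=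
      length_flatMap_range_le _ _ _ fun k => length_flatMap_range_le _ _ _ fun j =>
        readoutBlock_length_le _ _ _ _
    have h2 : ((List.range j).flatMap fun j => readoutBlock k j (x k j) (x k (n + j))).length ≤ j * d :=
      length_flatMap_range_le _ _ _ fun j => readoutBlock_length_le _ _ _ _
    have h3 : (j + 1) * d ≤ n * d := Nat.mul_le_mul_right _ hj
    have h4 : (k + 1) * (n * d) ≤ n * (n * d) := Nat.mul_le_mul_right _ (by omega)
    rw [add_mul] at h3 h4
    rw [hL, List.length_append]
    omega
  have hcode' : (readoutCode n x k ++ (List.range (j + 1)).flatMap fun j =>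
      readoutBlock k j (x k j) (x k (n + j))) = L ++ readoutBlock k j (x k j) (x k (n + j)) := by
    simp [hL, List.range_succ]
  rw [hcode']
  have c3 : σ3 22 0 = k := by rw [a3.at 22, c22]
  have c3' : σ3 23 0 = j := by rw [a3.at 23, c2]
  have A3 : Mem.Agree [4, 15, 16, 17, 23, 24, 25] σ1 σ3 := a2.trans (a3.mono (by simp))
  have hz : (x k (n + j)).val = 0 ↔ x k (n + j) = 0 := ZMod.val_eq_zero _
  have hpc : phaseCount (x k j) (x k (n + j)) ≤ d - 1 := searchPhase_le _ _ _
  refine Spec.cond b3 (fun he => ?_) fun he => ?_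
  · have hne : x k (n + j) ≠ 0 := fun h => he (by simp [v16, h])
    rw [readoutBlock, if_neg hne]
    refine Spec.seq (Spec.forTo (N := phaseCount (x k j) (x k (n + j))) (A := [4, 25])
      (fun i σ' => σ'.Holds 4 (L ++ List.replicate i ![1, k, j, 0, 0])) b3 (by omega) (by simp)
      (fun σ' h => by simp [h.at 17, v17]) (by simpa using H3)
      (fun i σ₁ σ₂ h h' => h'.congr (h.at 4)) ?_) ?_
    · intro i hi σ4 b4 a4 c4 H4
      refine (Spec.push (x₀ := 1) (x₁ := k) (x₂ := j) (x₃ := 0) (x₄ := 0) b4 H4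
        (by rw [List.length_append, List.length_replicate]; omega) (fun σ' h => ?_) (by omega)).mono ?_
      · simp [h.at 22, h.at 23, a4.at 22, a4.at 23, c3, c3']
      · rintro σ5 ⟨a5, H5⟩
        refine ⟨a4.trans (a5.mono (by simp)), by rw [a5.at 25, c4], ?_⟩
        rw [List.replicate_succ', ← List.append_assoc]
        exact H5
    · rintro σ4 b4 ⟨a4, H4⟩
      refine (Spec.push (x₀ := 0) (x₁ := k) (x₂ := j) (x₃ := 0) (x₄ := 0) b4 H4
        (by rw [List.length_append, List.length_replicate]; omega) (fun σ' h => ?_) (by omega)).mono ?_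
      · simp [h.at 22, h.at 23, a4.at 22, a4.at 23, c3, c3']
      · rintro σ5 ⟨a5, H5⟩
        refine ⟨(A3.trans (a4.mono (by simp))).trans (a5.mono (by simp)),
          by rw [a5.at 23, a4.at 23, c3'], ?_⟩
        rw [← List.append_assoc]
        exact H5
  · have h0 : x k (n + j) = 0 := hz.1 (by simpa [v16] using he)
    rw [readoutBlock, if_pos h0, List.append_nil]
    exact Spec.skip b3 ⟨A3, c3', H3⟩

/-- The number of copies that are used for the final readout. -/
def extraCopies (n len : ℕ) : ℕ := if len ≤ n then len else 0

theorem spec_post (hF : Fits V n d m) {σ : Mem} (hσ : σ.Bdd V) (hE : Env n d m σ)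
    (h : ℕ → ℕ → ZMod d)
    (hh : ∀ i < m, ∀ l < n + n, ((∑ c ∈ Finset.range (numCopies d), ((1 - c % d + l / n) % 2) *
      σ 2 (i * (numCopies d * n) + (c * n + l % n)) : ℕ) : ZMod d) = h i l)
    (h3 : σ 3 0 = 0) (h4 : σ 4 0 = 0) (L : List (ℕ → ZMod d))
    (hL : L = nonzeroRows (n + n) (kernelRows (n + n) h m) (n + n)) :
    Spec V Program.post σ fun σ' => Env n d m σ' ∧ σ'.Holds 3 (rowDigits (n + n) L) ∧
      σ' 5 0 = extraCopies n L.length ∧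
      σ'.Holds 4 (readoutCode n (fun k => L.getD k 0) (extraCopies n L.length)) := by
  have hw := hF.width
  refine Spec.seq (spec_nullSpace hF hσ hE h hh) ?_
  rintro σ1 b1 ⟨a1, B1⟩
  have E1 := hE.agree a1
  refine Spec.seq (spec_compress hF b1 E1 B1 (by rw [a1.at 3, h3])) ?_
  rintro σ2 b2 ⟨a2, H2⟩
  have E2 := E1.agree a2
  rw [← hL] at H2
  have hlen : σ2 3 0 = L.length := by rw [H2.1]; simp [rowDigits]
  have hex : extraCopies n L.length ≤ n := by unfold extraCopies; split_ifs <;> omega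
  refine Spec.seq (R := fun σ' => Mem.Agree [5] σ2 σ' ∧ σ' 5 0 = extraCopies n L.length) ?_ ?_
  · refine Spec.cond b2 (fun he => ?_) fun he => ?_
    · refine Spec.assign b2 (p := 0) (x := 0) (by simp) (by simp) (by omega) fun σ3 b3 a3 u3 =>
        ⟨a3, ?_⟩
      have : ¬ L.length ≤ n := by simp [hlen, E2.qudits] at he; omega
      simp [u3, extraCopies, this]
    · have : L.length ≤ n := by simp [hlen, E2.qudits] at he; omega
      refine Spec.assign b2 (p := 0) (x := L.length) (by simp) (by simp [hlen]) (by omega)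
        fun σ3 b3 a3 u3 => ⟨a3, ?_⟩
      simp [u3, extraCopies, this]
  rintro σ3 b3 ⟨a3, h5⟩
  have E3 := E2.agree a3
  have H3 : σ3.Holds 3 (rowDigits (n + n) L) := H2.congr (a3.at 3)
  refine (spec_readout hF b3 E3 h5 hex ?_ (by rw [a3.at 4, a2.at 4, a1.at 4, h4])).mono
    fun σ4 h => ⟨E3.agree h.1, H3.congr (h.1.at 3), by rw [h.1.at 5, h5], h.2⟩
  intro k hk l hl
  have hkL : k < L.length := by unfold extraCopies at hk; split_ifs at hk <;> omega
  have := H3.2 ⟨k, by simpa [rowDigits] using hkL⟩ ⟨l, hl⟩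
  simp only [rowDigits, List.get_eq_getElem, List.getElem_map] at this
  rw [this, List.getD_eq_getElem _ _ hkL]

theorem spec_finish (hF : Fits V n d m) {σ : Mem} (hσ : σ.Bdd V) (hE : Env n d m σ)
    {L : List (ℕ → ZMod d)} (hL : σ.Holds 3 (rowDigits (n + n) L))
    (h5 : σ 5 0 = extraCopies n L.length) :
    Spec V Program.finish σ fun σ' => ∀ k < extraCopies n L.length,
      σ' 7 k = phaseExponent n (L.getD k 0) fun j => σ 6 (j + n * k) := by
  have hw := hF.width
  have hdim := hF.dim
  have hdpos : 0 < d := (Fact.out : d.Prime).pos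
  have hex : extraCopies n L.length ≤ n := by unfold extraCopies; split_ifs <;> omega
  refine (Spec.fillLoop (a := 7) (N := extraCopies n L.length) (A := [7, 12, 15, 16, 17, 22, 23, 24])
    (fun k => phaseExponent n (L.getD k 0) fun j => σ 6 (j + n * k)) hσ (by omega)
    (by simp) (by decide) (fun σ' h => by simp [h.at 5, h5]) ?_).mono
    fun σ' h k hk => by rw [h.2, if_pos hk]
  intro k hk σ1 b1 a1 c1 _
  have E1 := hE.agree a1
  have hx : ∀ l < n + n, σ 3 (1 + (n + n) * k + l) = (L.getD k 0 l).val := by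
    intro l hl
    have hkL : k < L.length := by unfold extraCopies at hk; split_ifs at hk <;> omega
    have := hL.2 ⟨k, by simpa [rowDigits] using hkL⟩ ⟨l, hl⟩
    simp only [rowDigits, List.get_eq_getElem, List.getElem_map] at this
    rw [this, List.getD_eq_getElem _ _ hkL]
  set x := L.getD k 0
  refine Spec.assign_seq b1 (p := 0) (x := 0) (by simp) (by simp) (by omega) fun σ2 b2 a2 u2 => ?_
  have E2 := E1.agree a2
  refine Spec.seq (Spec.forTo (N := n) (A := [12, 15, 16, 17, 23, 24])
    (fun i σ' => σ' 12 0 = (∑ j ∈ Finset.range i, phaseTerm (x j) (x (n + j)) (σ 6 (j + n * k))) %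
      (2 * d)) b2 (by omega) (by simp) (fun σ' h => by simp [(E2.agree h).qudits]) (by simp [u2])
    (fun i σ₁ σ₂ h h' => by rw [h.at 12, h']) ?_) ?_
  · intro j hj σ3 b3 a3 c3 v3
    have E3 := E2.agree a3
    have c22 : σ3 22 0 = k := by rw [a3.at 22, a2.at 22, c1]
    have hx3 : ∀ l < n + n, σ3 3 (1 + (n + n) * k + l) = (x l).val := fun l hl => by
      rw [a3.at 3, a2.at 3, a1.at 3, hx l hl]
    refine Spec.seq (spec_search hF b3 E3 c22 c3 (hx3 j (by omega)) (hx3 (n + j) (by omega))) ?_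
    rintro σ4 b4 ⟨a4, v15, v16, v17⟩
    have E4 := E3.agree a4
    refine Spec.assign b4 (p := 0)
      (x := (∑ j ∈ Finset.range (j + 1), phaseTerm (x j) (x (n + j)) (σ 6 (j + n * k))) % (2 * d))
      (by simp) ?_ ((Nat.mod_lt _ (by omega)).le.trans hdim)
      fun σ5 b5 a5 u5 => ⟨(a3.trans (a4.mono (by simp))).trans (a5.mono (by simp)),
        by rw [a5.at 23, a4.at 23, c3], by simp [u5]⟩
    simp only [Expr.eval_sub, Expr.eval_add, Expr.eval_mul, Expr.eval_mod, Expr.eval_get,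
      Expr.eval_zero, Expr.eval_var, Expr.eval_one, Expr.eval_two, v15, v16, v17, E4.base, E4.qudits,
      a4.at 12, v3, a4.at 23, c3, a4.at 22, c22, a4.at 6, a3.at 6, a2.at 6, a1.at 6,
      Finset.sum_range_succ, Nat.mod_add_mod, phaseTerm]
  · rintro σ3 b3 ⟨a3, v3⟩
    refine Spec.assign b3 (p := k) (x := phaseExponent n x fun j => σ 6 (j + n * k))
      (by simp [a3.at 22, a2.at 22, c1]) (by simp [v3, phaseExponent])
      ((Nat.mod_lt _ (by omega)).le.trans hdim) fun σ4 b4 a4 u4 =>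
      ⟨((a1.trans (a2.mono (by simp))).trans (a3.mono (by simp))).trans (a4.mono (by simp)),
        by rw [a4.at 22, a3.at 22, a2.at 22, c1], by rw [u4, a3.at 7, a2.at 7]⟩

end

/-! ## Weyl operators and Clifford gates -/

section
variable {d : ℕ} [NeZero d]

/-- Powers of `ω` become values of an additive character, so exponents can be computed in `ZMod d`.
-/
theorem omega_pow (k : ℕ) : omega d ^ k = ZMod.stdAddChar (k : ZMod d) := by
  have h := ZMod.stdAddChar_coe (N := d) (k : ℤ)
  rw [Int.cast_natCast] at h
  rw [h, omega, ← Complex.exp_nat_mul]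
  congr 1
  push_cast
  ring

theorem stdAddChar_sum {ι : Type*} (s : Finset ι) (f : ι → ZMod d) :
    (ZMod.stdAddChar (∑ i ∈ s, f i) : ℂ) = ∏ i ∈ s, ZMod.stdAddChar (f i) := by
  classical
  induction s using Finset.induction_on with
  | empty => simp
  | insert a s ha ih => rw [Finset.sum_insert ha, Finset.prod_insert ha, AddChar.map_add_eq_mul, ih]

theorem omega_pow_val (z : ZMod d) : omega d ^ z.val = ZMod.stdAddChar z := by
  rw [omega_pow, ZMod.natCast_zmod_val]

theorem omega_inv_pow_val (z : ZMod d) : (omega d)⁻¹ ^ z.val = ZMod.stdAddChar (-z) := by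
  rw [inv_pow, omega_pow_val, AddChar.map_neg_eq_inv]

theorem tau_ne_zero : tau d ≠ 0 := Complex.exp_ne_zero _

theorem tau_sq : tau d ^ 2 = omega d := by
  have hd : (d : ℂ) ≠ 0 := Nat.cast_ne_zero.2 (NeZero.ne d)
  rw [tau, omega, ← Complex.exp_nat_mul]
  have : ((2 : ℕ) : ℂ) * (Real.pi * Complex.I * ((d : ℂ) ^ 2 + 1) / d) =
      2 * Real.pi * Complex.I / d + (d : ℤ) * (2 * Real.pi * Complex.I) := by
    push_cast; field_simp; ring
  rw [this, Complex.exp_add, Complex.exp_int_mul_two_pi_mul_I, mul_one]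

theorem tau_pow_two_mul (k : ℕ) : tau d ^ (2 * k) = ZMod.stdAddChar (k : ZMod d) := by
  rw [pow_mul, tau_sq, omega_pow]

/-- For odd `d` the integer `d² + 1` is even, so already `τ^d = 1`. For even `d` the claim is `ω^d =
1`. This removes the phases from `W_x^{⊗D}`. -/
theorem tau_pow_numCopies : tau d ^ numCopies d = 1 := by
  have hd : (d : ℂ) ≠ 0 := Nat.cast_ne_zero.2 (NeZero.ne d)
  unfold numCopies
  split_ifs with h
  · rw [tau, ← Complex.exp_nat_mul]
    obtain ⟨k, hk⟩ : Even (d ^ 2 + 1) := by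
      have : Odd d := Nat.odd_iff.2 h
      exact (this.pow).add_one
    have hk' : (d : ℂ) ^ 2 + 1 = k + k := by exact_mod_cast congrArg (Nat.cast (R := ℂ)) hk
    rw [hk', Complex.exp_eq_one_iff]
    exact ⟨k, by push_cast; field_simp; ring⟩
  · rw [tau_pow_two_mul, ZMod.natCast_self, AddChar.map_zero_eq_one]

theorem tau_pow_two_mul_self : tau d ^ (2 * d) = 1 := by
  rw [tau_pow_two_mul, ZMod.natCast_self, AddChar.map_zero_eq_one]

theorem tau_pow_mul_self : tau d ^ (d * d) = 1 := by
  have h : numCopies d ∣ d * d := by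
    unfold numCopies
    split_ifs with h
    · exact dvd_mul_right _ _
    · obtain ⟨k, hk⟩ : 2 ∣ d := by omega
      nth_rewrite 2 [hk]
      exact ⟨k, by ring⟩
  obtain ⟨k, hk⟩ := h
  rw [hk, pow_mul, tau_pow_numCopies, one_pow]

theorem norm_tau : ‖tau d‖ = 1 :=
  Complex.norm_eq_one_of_pow_eq_one tau_pow_two_mul_self
    (Nat.mul_ne_zero two_ne_zero (NeZero.ne d))

/-- `τ^{m²}` depends only on `m` modulo `d`. -/
theorem tau_pow_sq_sub (r v : ZMod d) :
    tau d ^ (r.val ^ 2) = (tau d)⁻¹ ^ (v.val ^ 2) * ZMod.stdAddChar (v * r) *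
      tau d ^ ((r - v).val ^ 2) := by
  have hr := ZMod.natCast_zmod_val r
  have h1 : ∀ a b : ℕ, (a : ZMod d) = b → tau d ^ (a ^ 2) = tau d ^ (b ^ 2) := by
    -- The squares differ by a multiple of `2d` plus a multiple of `d²`, and `τ` is trivial on both.
    have key : ∀ a k : ℕ, tau d ^ ((a + d * k) ^ 2) = tau d ^ (a ^ 2) := by
      intro a k
      have : (a + d * k) ^ 2 = a ^ 2 + ((2 * d) * (a * k) + (d * d) * k ^ 2) := by ring
      rw [this, pow_add, pow_add, pow_mul _ (2 * d), tau_pow_two_mul_self, pow_mul _ (d * d),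
        tau_pow_mul_self, one_pow, one_pow, one_mul, mul_one]
    intro a b hab
    rw [ZMod.natCast_eq_natCast_iff'] at hab
    rw [← Nat.mod_add_div a d, ← Nat.mod_add_div b d, key, key, hab]
  have h2 := h1 r.val ((r - v).val + v.val) (by simp)
  rw [h2, add_sq, pow_add, pow_add]
  have h3 : tau d ^ (2 * (r - v).val * v.val) = ZMod.stdAddChar ((r - v) * v) := by
    rw [mul_assoc, tau_pow_two_mul]; simp
  rw [h3]
  have h4 : (ZMod.stdAddChar (v * r) : ℂ) = ZMod.stdAddChar ((r - v) * v) *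
      (tau d ^ (v.val ^ 2) * tau d ^ (v.val ^ 2)) := by
    rw [← pow_add, ← two_mul, tau_pow_two_mul, ← AddChar.map_add_eq_mul]
    congr 1; simp; ring
  rw [h4, inv_pow]
  have := pow_ne_zero (v.val ^ 2) (tau_ne_zero (d := d))
  field_simp

end

/-! ### Pauli operators under Clifford gates -/

section
variable {d : ℕ} [NeZero d] {Q : Type} [Fintype Q] [DecidableEq Q]

/-- The operator `|s⟩ ↦ ω^{u·(s+v)}|s+v⟩`, that is `⨂_j Z^{u_j} X^{v_j}`. -/
def pauliOp (u v : Q → ZMod d) : Op d Q :=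
  Matrix.of fun r s => if r = s + v then ZMod.stdAddChar (∑ q, u q * r q) else 0

/-- The phase arises from moving the clock operators of the right factor past the shifts of the left
one. -/
theorem pauliOp_mul (u v u' v' : Q → ZMod d) :
    pauliOp u v * pauliOp u' v' =
      (ZMod.stdAddChar (-∑ q, u' q * v q) : ℂ) • pauliOp (u + u') (v + v') := by
  ext r s
  simp only [pauliOp, Matrix.mul_apply, Matrix.of_apply, Matrix.smul_apply, mul_ite, mul_zero,
    Finset.sum_ite_eq', Finset.mem_univ, if_true, smul_eq_mul]
  by_cases h : r = s + v' + v
  · rw [if_pos h, if_pos (by rw [h]; abel), ← AddChar.map_add_eq_mul, ← AddChar.map_add_eq_mul]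
    congr 1
    rw [← Finset.sum_neg_distrib, ← Finset.sum_add_distrib, ← Finset.sum_add_distrib]
    refine Finset.sum_congr rfl fun q _ => ?_
    simp [h]; ring
  · rw [if_neg h, if_neg (by intro h'; apply h; rw [h']; abel)]; simp

theorem pauliOp_zero : (pauliOp 0 0 : Op d Q) = 1 := by
  ext r s
  simp [pauliOp, Matrix.one_apply]

theorem pauliOp_mulVec (u v : Q → ZMod d) (φ : Vec d Q) (r : Q → ZMod d) :
    (pauliOp u v *ᵥ φ) r = ZMod.stdAddChar (∑ q, u q * r q) * φ (r - v) := by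
  simp only [pauliOp, Matrix.mulVec, dotProduct, Matrix.of_apply, ite_mul, zero_mul]
  simp_rw [← sub_eq_iff_eq_add (a := r)]
  simp

theorem pauliOp_eq_diagonal (u : Q → ZMod d) :
    pauliOp u 0 = Matrix.diagonal fun r => (ZMod.stdAddChar (∑ q, u q * r q) : ℂ) := by
  ext r s
  by_cases h : r = s <;> simp [pauliOp, h]

theorem tensor_mul (A B : Q → Matrix (ZMod d) (ZMod d) ℂ) :
    tensor A * tensor B = tensor fun j => A j * B j := by
  ext r s
  simp only [tensor, Matrix.mul_apply, Matrix.of_apply, ← Finset.prod_mul_distrib]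
  rw [Finset.prod_univ_sum, Fintype.piFinset_univ]

theorem tensor_one : tensor (fun _ : Q => (1 : Matrix (ZMod d) (ZMod d) ℂ)) = 1 := by
  ext r s
  simp only [tensor, Matrix.of_apply, Matrix.one_apply]
  rw [Finset.prod_ite_zero]
  simp [funext_iff]

theorem tensor_conjTranspose (A : Q → Matrix (ZMod d) (ZMod d) ℂ) :
    (tensor A)ᴴ = tensor fun j => (A j)ᴴ := by
  ext r s
  simp [tensor, Matrix.conjTranspose_apply, star_prod]

theorem localOp_apply (j : Q) (A : Matrix (ZMod d) (ZMod d) ℂ) (r s : Q → ZMod d) :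
    localOp j A r s = if ∀ i, i ≠ j → r i = s i then A (r j) (s j) else 0 := by
  simp only [localOp, tensor, Matrix.of_apply]
  rw [← Finset.mul_prod_erase _ _ (Finset.mem_univ j), Function.update_self]
  have h : ∏ x ∈ Finset.univ.erase j, Function.update (fun _ => (1 : Matrix (ZMod d) (ZMod d) ℂ)) j A
      x (r x) (s x) = ∏ x ∈ Finset.univ.erase j, if r x = s x then 1 else 0 := by
    refine Finset.prod_congr rfl fun x hx => ?_
    rw [Function.update_of_ne (Finset.ne_of_mem_erase hx), Matrix.one_apply]
  rw [h, Finset.prod_ite_zero]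
  simp

theorem localOp_conjTranspose_mul_self {A : Matrix (ZMod d) (ZMod d) ℂ} (hA : Aᴴ * A = 1) (j : Q) :
    (localOp j A)ᴴ * localOp j A = 1 := by
  rw [localOp, tensor_conjTranspose, tensor_mul, ← tensor_one]
  congr 1
  funext i
  by_cases h : i = j
  · subst h; simpa using hA
  · simp [h]

theorem clock_pow (a : ℕ) : clock d ^ a = Matrix.diagonal fun q => omega d ^ (q.val * a) := by
  rw [clock, Matrix.diagonal_pow]
  congr 1; funext q; simp [pow_mul]

theorem shift_pow_apply (b : ℕ) (r q : ZMod d) :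
    (shift d ^ b) r q = if r = q + b then 1 else 0 := by
  induction b generalizing q with
  | zero => simp [Matrix.one_apply]
  | succ b ih =>
    rw [pow_succ, Matrix.mul_apply]
    have hs : ∀ j, shift d j q = if j = q + 1 then 1 else 0 := fun j => rfl
    simp only [ih, hs, mul_ite, mul_one, mul_zero, Finset.sum_ite_eq',
      Finset.mem_univ, if_true]
    push_cast
    rw [add_assoc, add_comm (1 : ZMod d)]

theorem tensor_clock_shift (u v : Q → ZMod d) :
    tensor (fun j => clock d ^ (u j).val * shift d ^ (v j).val) = pauliOp u v := by
  ext r s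
  simp only [tensor, pauliOp, Matrix.of_apply, clock_pow, Matrix.diagonal_mul, shift_pow_apply,
    ZMod.natCast_zmod_val, mul_ite, mul_one, mul_zero]
  rw [Finset.prod_ite_zero]
  have : (∀ i ∈ Finset.univ, r i = s i + v i) ↔ r = s + v := by simp [funext_iff]
  simp only [this]
  split_ifs
  · rw [stdAddChar_sum]
    refine Finset.prod_congr rfl fun q _ => ?_
    rw [omega_pow]; simp [mul_comm]
  · rfl

/-- `a · b`, formed with the representatives in `{0, …, d-1}`. -/
def valDot (u v : Q → ZMod d) : ℕ := ∑ j, (u j).val * (v j).val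

theorem weyl_eq {n : ℕ} (x : PhaseSpace d n) :
    weyl x = (tau d)⁻¹ ^ valDot x.1 x.2 • pauliOp x.1 x.2 := by
  rw [weyl, tensor_clock_shift, valDot]

theorem opPow_weyl {n : ℕ} (k : ℕ) (x : PhaseSpace d n) :
    opPow k (weyl x) = ((tau d)⁻¹ ^ valDot x.1 x.2) ^ k •
      pauliOp (fun q : Fin k × Fin n => x.1 q.2) (fun q => x.2 q.2) := by
  ext r s
  simp only [opPow, weyl_eq, Matrix.of_apply, Matrix.smul_apply, smul_eq_mul, pauliOp,
    Finset.prod_mul_distrib, Finset.prod_const, Finset.card_univ, Fintype.card_fin]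
  congr 1
  rw [Finset.prod_ite_zero]
  have : (∀ c ∈ (Finset.univ : Finset (Fin k)), (fun j => r (c, j)) = (fun j => s (c, j)) + x.2) ↔
      r = s + fun q => x.2 q.2 := by
    simp [funext_iff]
  simp only [this]
  split_ifs
  · rw [← stdAddChar_sum, Fintype.sum_prod_type]
  · rfl

/-- The prefactor `τ^{-a·b}` enters with the power `D` and disappears. -/
theorem opPow_numCopies_weyl {n : ℕ} (x : PhaseSpace d n) :
    opPow (numCopies d) (weyl x) =
      pauliOp (fun q : Fin (numCopies d) × Fin n => x.1 q.2) (fun q => x.2 q.2) := by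
  rw [opPow_weyl, ← pow_mul, mul_comm, pow_mul, inv_pow, tau_pow_numCopies, inv_one, one_pow,
    one_smul]

theorem fourierGate_unitary : (fourierGate d)ᴴ * fourierGate d = 1 := by
  have hd : (d : ℝ) ≠ 0 := Nat.cast_ne_zero.2 (NeZero.ne d)
  have hs : ((Real.sqrt d : ℝ) : ℂ) * (Real.sqrt d : ℝ) = d := by
    rw [← Complex.ofReal_mul, Real.mul_self_sqrt (Nat.cast_nonneg d)]; simp
  have hs0 : ((Real.sqrt d : ℝ) : ℂ) ≠ 0 := by
    intro h; rw [h, zero_mul] at hs; exact hd (by exact_mod_cast hs.symm)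
  ext p q
  simp only [Matrix.mul_apply, Matrix.conjTranspose_apply, fourierGate, Matrix.of_apply, omega_pow]
  have : ∀ r : ZMod d, star ((ZMod.stdAddChar ((r.val * p.val : ℕ) : ZMod d) : ℂ) / (Real.sqrt d : ℝ)) *
      ((ZMod.stdAddChar ((r.val * q.val : ℕ) : ZMod d) : ℂ) / (Real.sqrt d : ℝ)) =
      (d : ℂ)⁻¹ * ZMod.stdAddChar (r * (q - p)) := by
    intro r
    rw [star_div₀, Complex.star_def, Complex.conj_ofReal, ← AddChar.map_neg_eq_conj]
    rw [div_mul_div_comm, hs, ← AddChar.map_add_eq_mul, div_eq_inv_mul]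
    congr 2
    push_cast
    simp; ring
  simp_rw [this]
  rw [← Finset.mul_sum, AddChar.sum_mulShift _ (ZMod.isPrimitive_stdAddChar d), ZMod.card,
    Matrix.one_apply]
  by_cases h : p = q
  · subst h
    have : (d : ℂ) ≠ 0 := by exact_mod_cast hd
    simp [this]
  · have : q - p ≠ 0 := sub_ne_zero.2 (Ne.symm h)
    simp [h, this]

theorem norm_omega_pow (k : ℕ) : ‖omega d ^ k‖ = 1 := by
  rw [← tau_sq, ← pow_mul, norm_pow, norm_tau, one_pow]

theorem star_mul_self_of_norm {z : ℂ} (h : ‖z‖ = 1) : star z * z = 1 := by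
  rw [Complex.star_def, ← Complex.normSq_eq_conj_mul_self, Complex.normSq_eq_norm_sq, h]; simp

theorem diagonal_unitary {ι : Type} [Fintype ι] [DecidableEq ι] {f : ι → ℂ} (h : ∀ i, ‖f i‖ = 1) :
    (Matrix.diagonal f)ᴴ * Matrix.diagonal f = 1 := by
  rw [Matrix.diagonal_conjTranspose, Matrix.diagonal_mul_diagonal, ← Matrix.diagonal_one]
  congr 1; funext i
  exact star_mul_self_of_norm (h i)

theorem phaseGate_unitary : (phaseGate d)ᴴ * phaseGate d = 1 :=
  diagonal_unitary fun i => by rw [norm_pow, norm_tau, one_pow]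

theorem clock_unitary : (clock d)ᴴ * clock d = 1 := diagonal_unitary fun _ => norm_omega_pow _

theorem shift_unitary : (shift d)ᴴ * shift d = 1 := by
  ext p q
  simp [shift, Matrix.mul_apply, Matrix.conjTranspose_apply, Matrix.one_apply, eq_comm]

theorem update_add_injective {q q' : Q} (h : q ≠ q') :
    Function.Injective fun s : Q → ZMod d => Function.update s q' (s q' + s q) := by
  intro s t hst
  funext i
  have hq : s q = t q := by simpa [h] using congrFun hst q
  have hi := congrFun hst i
  by_cases hiq : i = q'
  · subst hiq; simpa [hq] using hi
  · simpa [hiq] using hi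

theorem sumGate_unitary {q q' : Q} (h : q ≠ q') : (sumGate q q' : Op d Q)ᴴ * sumGate q q' = 1 := by
  ext p s
  simp only [sumGate, Matrix.mul_apply, Matrix.conjTranspose_apply, Matrix.of_apply, mul_ite, mul_one,
    mul_zero, Finset.sum_ite_eq', Finset.mem_univ, if_true, Matrix.one_apply]
  have : Function.update s q' (s q' + s q) = Function.update p q' (p q' + p q) ↔ p = s :=
    (update_add_injective h).eq_iff.trans eq_comm
  simp only [this]
  split_ifs <;> simp

/-- The Fourier gate turns shifts into clocks. Both circuits apply it only after the Z exponent at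
`q` has been cleared, and under this hypothesis no phase appears. -/
theorem fourier_mul_pauliOp (q : Q) (u v : Q → ZMod d) (hu : u q = 0) :
    localOp q (fourierGate d) * pauliOp u v =
      pauliOp (Function.update u q (v q)) (Function.update v q 0) * localOp q (fourierGate d) := by
  ext r s
  simp only [Matrix.mul_apply, pauliOp, Matrix.of_apply, mul_ite, mul_zero, Finset.sum_ite_eq',
    Finset.mem_univ, if_true, ite_mul, zero_mul]
  simp_rw [← sub_eq_iff_eq_add (a := r)]
  simp only [Finset.sum_ite_eq, Finset.mem_univ, if_true, localOp_apply]
  have hcond : (∀ i, i ≠ q → (r - Function.update v q 0) i = s i) ↔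
      ∀ i, i ≠ q → r i = (s + v) i := by
    refine forall_congr' fun i => forall_congr' fun hi => ?_
    simp [hi, sub_eq_iff_eq_add]
  simp only [hcond]
  split_ifs with h
  · simp only [fourierGate, Matrix.of_apply, omega_pow, Pi.sub_apply, Function.update_self, sub_zero,
      div_mul_eq_mul_div, mul_div_assoc']
    congr 1
    rw [← AddChar.map_add_eq_mul, ← AddChar.map_add_eq_mul]
    congr 1
    rw [← Finset.add_sum_erase _ _ (Finset.mem_univ q), ← Finset.add_sum_erase _ (fun i =>
      Function.update u q (v q) i * r i) (Finset.mem_univ q)]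
    have : ∑ x ∈ Finset.univ.erase q, Function.update u q (v q) x * r x =
        ∑ x ∈ Finset.univ.erase q, u x * (s + v) x :=
      Finset.sum_congr rfl fun x hx => by
        have hx := Finset.ne_of_mem_erase hx
        rw [Function.update_of_ne hx, h x hx]
    rw [this, hu]
    simp
    ring
  · simp

/-- The gate multiplies `X^v` by `Z^v`, because `τ^{r²}` and `τ^{(r-v)²}` differ by the character
`ω^{vr}` and a constant (`tau_pow_sq_sub`). -/
theorem phase_mul_pauliOp (q : Q) (u v : Q → ZMod d) :
    localOp q (phaseGate d) * pauliOp u v = (tau d)⁻¹ ^ ((v q).val ^ 2) •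
      (pauliOp (Function.update u q (u q + v q)) v * localOp q (phaseGate d)) := by
  ext r s
  simp only [Matrix.mul_apply, pauliOp, Matrix.of_apply, mul_ite, mul_zero, Finset.sum_ite_eq',
    Finset.mem_univ, if_true, ite_mul, zero_mul, Matrix.smul_apply, smul_eq_mul]
  simp_rw [← sub_eq_iff_eq_add (a := r)]
  simp only [Finset.sum_ite_eq, Finset.mem_univ, if_true, localOp_apply, phaseGate,
    Matrix.diagonal_apply]
  by_cases h : r = s + v
  · subst h
    have h1 : ∀ i, s i + v i - v i = s i := fun i => by ring
    simp only [Pi.sub_apply, Pi.add_apply, h1, implies_true, if_true]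
    have h2 := tau_pow_sq_sub (s q + v q) (v q)
    rw [h1] at h2
    rw [h2]
    have h3 : (ZMod.stdAddChar (∑ x, Function.update u q (u q + v q) x * (s x + v x)) : ℂ) =
        ZMod.stdAddChar (v q * (s q + v q)) * ZMod.stdAddChar (∑ x, u x * (s x + v x)) := by
      rw [← AddChar.map_add_eq_mul]
      congr 1
      rw [← Finset.add_sum_erase _ _ (Finset.mem_univ q), ← Finset.add_sum_erase _ (fun i =>
        u i * (s i + v i)) (Finset.mem_univ q)]
      have : ∑ x ∈ Finset.univ.erase q, Function.update u q (u q + v q) x * (s x + v x) =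
          ∑ x ∈ Finset.univ.erase q, u x * (s x + v x) :=
        Finset.sum_congr rfl fun x hx => by
          rw [Function.update_of_ne (Finset.ne_of_mem_erase hx)]
      rw [this, Function.update_self]
      ring
    rw [h3]
    ring
  · have h1 : ¬ ((∀ i, i ≠ q → r i = (s + v) i) ∧ r q = (s + v) q) := fun h' => h (by
      funext i; by_cases hi : i = q
      · subst hi; exact h'.2
      · exact h'.1 i hi)
    have h2 : ¬ ((∀ i, i ≠ q → (r - v) i = s i) ∧ (r - v) q = s q) := fun h' => h1 (by
      simpa [sub_eq_iff_eq_add] using h')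
    rw [← ite_and, ← ite_and, if_neg h1, if_neg h2]
    simp

/-- Shifts propagate from the control to the target, clocks from the target to the control with the
opposite sign. -/
theorem sum_mul_pauliOp {q q' : Q} (hq : q ≠ q') (u v : Q → ZMod d) :
    sumGate q q' * pauliOp u v = pauliOp (Function.update u q (u q - u q'))
      (Function.update v q' (v q' + v q)) * sumGate q q' := by
  ext r s
  simp only [Matrix.mul_apply, pauliOp, Matrix.of_apply, mul_ite, mul_zero, Finset.sum_ite_eq',
    Finset.mem_univ, if_true, sumGate, mul_one, ite_mul, zero_mul, one_mul]
  have hcond : Function.update (s + v) q' ((s + v) q' + (s + v) q) =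
      Function.update s q' (s q' + s q) + Function.update v q' (v q' + v q) := by
    funext i
    by_cases hi : i = q'
    · subst hi; simp; ring
    · simp [hi]
  rw [hcond]
  split_ifs with h
  · congr 1
    rw [h]
    have key : ∀ f : Q → ZMod d, ∑ i, f i = f q + (f q' + ∑ i ∈ (Finset.univ.erase q).erase q', f i) := by
      intro f
      rw [← Finset.add_sum_erase _ f (Finset.mem_univ q),
        ← Finset.add_sum_erase _ f (Finset.mem_erase.2 ⟨hq.symm, Finset.mem_univ q'⟩)]
    rw [key, key (fun i => _ * _)]
    have : ∀ x ∈ (Finset.univ.erase q).erase q', Function.update u q (u q - u q') x *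
        (Function.update s q' (s q' + s q) + Function.update v q' (v q' + v q)) x =
        u x * (s + v) x := fun x hx => by
      have h1 := Finset.ne_of_mem_erase hx
      have h2 := Finset.ne_of_mem_erase (Finset.mem_of_mem_erase hx)
      simp [h1, h2]
    rw [Finset.sum_congr rfl this]
    simp [hq, hq.symm]
    ring
  · rfl

end

/-! ## The circuit of the non-adaptive stage -/

theorem Circuit.toOp_append {k n d : ℕ} [NeZero d] (c c' : Circuit k n) :
    Circuit.toOp d (c ++ c') = Circuit.toOp d c' * Circuit.toOp d c := by
  induction c with
  | nil => simp [Circuit.toOp]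
  | cons g c ih => simp [Circuit.toOp, ih, mul_assoc]

theorem Gate.toOp_unitary {k n d : ℕ} [NeZero d] (g : Gate k n) : (g.toOp d)ᴴ * g.toOp d = 1 := by
  cases g with
  | fourier q => exact localOp_conjTranspose_mul_self fourierGate_unitary q
  | phase q => exact localOp_conjTranspose_mul_self phaseGate_unitary q
  | pauliX q => exact localOp_conjTranspose_mul_self shift_unitary q
  | pauliZ q => exact localOp_conjTranspose_mul_self clock_unitary q
  | sum q q' h => exact sumGate_unitary h

theorem Circuit.toOp_unitary {k n d : ℕ} [NeZero d] (c : Circuit k n) :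
    (c.toOp d)ᴴ * c.toOp d = 1 := by
  induction c with
  | nil => simp [Circuit.toOp]
  | cons g c ih =>
    rw [Circuit.toOp, Matrix.conjTranspose_mul, mul_assoc, ← mul_assoc _ (Circuit.toOp d c), ih,
      one_mul, g.toOp_unitary]

/-- A schedule given by a list of gates labelled with time steps. -/
theorem Circuit.depthLE_of_labels {k n t : ℕ} (L : List (Gate k n × ℕ)) (h1 : ∀ p ∈ L, p.2 < t)
    (h2 : L.Pairwise fun p p' => ¬ Disjoint p.1.support p'.1.support → p.2 < p'.2) :
    Circuit.DepthLE (L.map Prod.fst) t := by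
  refine ⟨fun i => ⟨(L.get (i.cast (by simp))).2, h1 _ (List.get_mem _ _)⟩, fun i j hij h => ?_⟩
  rw [List.pairwise_iff_get] at h2
  refine h2 (i.cast (by simp)) (j.cast (by simp)) hij ?_
  simpa using h

theorem Circuit.DepthLE.mono {k n t t' : ℕ} {c : Circuit k n} (h : c.DepthLE t) (ht : t ≤ t') :
    c.DepthLE t' := by
  obtain ⟨time, h⟩ := h
  exact ⟨fun i => (time i).castLE ht, fun i j hij h' => h i j hij h'⟩

/-- The labels of the qudits in lexicographic order. -/
def allQudits (k n : ℕ) : List (Fin k × Fin n) := List.finRange k ×ˢ List.finRange n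

theorem mem_allQudits {k n : ℕ} (q : Fin k × Fin n) : q ∈ allQudits k n :=
  List.mem_product.2 ⟨List.mem_finRange _, List.mem_finRange _⟩

theorem nodup_allQudits (k n : ℕ) : (allQudits k n).Nodup :=
  (List.nodup_finRange k).product (List.nodup_finRange n)

theorem pairwise_allQudits (k n : ℕ) :
    (allQudits k n).Pairwise fun q q' => q.1 ≤ q'.1 ∧ q ≠ q' := by
  refine List.Pairwise.and ?_ (nodup_allQudits k n)
  show List.Pairwise _ ((List.finRange k).flatMap fun a => (List.finRange n).map (Prod.mk a))
  rw [List.pairwise_flatMap]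
  refine ⟨fun a _ => ?_, ?_⟩
  · rw [List.pairwise_map]
    exact List.pairwise_of_forall fun _ _ => le_rfl
  · refine (List.pairwise_lt_finRange k).imp fun {a b} hab x hx y hy => ?_
    simp only [List.mem_map] at hx hy
    obtain ⟨_, _, rfl⟩ := hx
    obtain ⟨_, _, rfl⟩ := hy
    exact le_of_lt hab

theorem flatMap_finRange {α : Type*} (n : ℕ) (f : ℕ → List α) :
    ((List.finRange n).flatMap fun i : Fin n => f i) = (List.range n).flatMap f := by
  rw [← List.map_coe_finRange_eq_range, List.flatMap_map]

theorem flatMap_allQudits {α : Type*} (k n : ℕ) (f : ℕ → ℕ → List α) :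
    ((allQudits k n).flatMap fun q => f q.1 q.2) =
      (List.range k).flatMap fun i => (List.range n).flatMap (f i) := by
  show (((List.finRange k).flatMap fun a => (List.finRange n).map (Prod.mk a)).flatMap _) = _
  rw [List.flatMap_assoc, ← flatMap_finRange]
  congr 1
  funext i
  rw [List.flatMap_map, ← flatMap_finRange]

section
variable {d k n : ℕ} [NeZero d]

variable (d) in
/-- The first copy in the group of the copy of `q`. -/
def groupHead (q : Fin k × Fin n) : Fin k × Fin n :=
  (⟨q.1 / d * d, (Nat.div_mul_le_self _ _).trans_lt q.1.2⟩, q.2)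

theorem groupHead_ne {q : Fin k × Fin n} (h : (q.1 : ℕ) % d ≠ 0) : q ≠ groupHead d q := by
  intro h'
  have : (q.1 : ℕ) = q.1 / d * d := congrArg (fun q => ((Prod.fst q : Fin k) : ℕ)) h'
  rw [this] at h
  simp at h

theorem groupHead_mod (q : Fin k × Fin n) : ((groupHead d q).1 : ℕ) % d = 0 := by
  simp [groupHead]

variable (d) in
/-- The gates with the control `q`. -/
def prepGates (q : Fin k × Fin n) : Circuit k n :=
  if h : (q.1 : ℕ) % d = 0 then [] else [.sum q (groupHead d q) (groupHead_ne h), .fourier q]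

variable (d k n) in
/-- The circuit that diagonalizes `W_x^{⊗k}` when `d` divides `k`. -/
def prepCircuit : Circuit k n := (allQudits k n).flatMap (prepGates d)

theorem prepCircuit_code : (prepCircuit d k n).map Gate.code = prepCode d n k := by
  have h : ∀ q : Fin k × Fin n, (prepGates d q).map Gate.code =
      if (q.1 : ℕ) % d = 0 then [] else
        [![4, (q.1 : ℕ), (q.2 : ℕ), q.1 / d * d, (q.2 : ℕ)], ![0, (q.1 : ℕ), (q.2 : ℕ), 0, 0]] := by
    intro q
    unfold prepGates
    split_ifs <;> simp [Gate.code, groupHead]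
  rw [prepCircuit, List.map_flatMap]
  simp only [h]
  rw [flatMap_allQudits k n fun c j => if c % d = 0 then [] else
    [![4, c, j, c / d * d, j], ![0, c, j, 0, 0]]]
  unfold prepCode
  congr 1
  funext c
  split_ifs <;> simp

theorem prepCircuit_coherentOn : (prepCircuit d k n).CoherentOn d := by
  intro g hg
  obtain ⟨q, -, hq⟩ := List.mem_flatMap.1 hg
  have hd : 0 < d := Nat.pos_of_ne_zero (NeZero.ne d)
  unfold prepGates at hq
  split_ifs at hq with h
  · simp at hq
  · simp only [List.mem_cons, List.not_mem_nil, or_false] at hq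
    rcases hq with rfl | rfl
    · intro p hp p' hp'
      simp only [Gate.support, Finset.mem_insert, Finset.mem_singleton] at hp hp'
      have : ((groupHead d q).1 : ℕ) / d = q.1 / d := Nat.mul_div_cancel _ hd
      rcases hp with rfl | rfl <;> rcases hp' with rfl | rfl <;> simp [this]
    · intro p hp p' hp'
      simp only [Gate.support, Finset.mem_singleton] at hp hp'
      rw [hp, hp']

/-- A copy at distance `t` from the first copy of its group executes its SUM gates at time `t - 1`
and its Fourier gates at time `t`. Gates with different controls meet only in SUM gates with the
same target, and these have different distances, increasing along the list. -/
theorem prepCircuit_depthLE : (prepCircuit d k n).DepthLE d := by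
  have hd : 0 < d := Nat.pos_of_ne_zero (NeZero.ne d)
  let f : Fin k × Fin n → List (Gate k n × ℕ) := fun q =>
    if h : (q.1 : ℕ) % d = 0 then [] else
      [(.sum q (groupHead d q) (groupHead_ne h), q.1 % d - 1), (.fourier q, q.1 % d)]
  have hf : prepCircuit d k n = ((allQudits k n).flatMap f).map Prod.fst := by
    rw [prepCircuit, List.map_flatMap]
    congr 1
    funext q
    simp only [f, prepGates]
    split_ifs <;> simp
  have hmem : ∀ q, ∀ p ∈ f q, ∃ h : (q.1 : ℕ) % d ≠ 0,
      p = (.sum q (groupHead d q) (groupHead_ne h), q.1 % d - 1) ∨ p = (.fourier q, q.1 % d) := by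
    intro q p hp
    by_cases h : (q.1 : ℕ) % d = 0
    · simp [f, h] at hp
    · exact ⟨h, by simpa [f, h] using hp⟩
  rw [hf]
  refine Circuit.depthLE_of_labels _ ?_ ?_
  · intro p hp
    obtain ⟨q, -, hq⟩ := List.mem_flatMap.1 hp
    have := Nat.mod_lt (q.1 : ℕ) hd
    obtain ⟨h, rfl | rfl⟩ := hmem q p hq <;> simp <;> omega
  · rw [List.pairwise_flatMap]
    refine ⟨fun q _ => ?_, (pairwise_allQudits k n).imp ?_⟩
    · by_cases h : (q.1 : ℕ) % d = 0
      · simp [f, h]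
      · simp [f, h]; omega
    · rintro q q' ⟨hle, hne⟩ p hp p' hp' hdis
      obtain ⟨h, hp⟩ := hmem q p hp
      obtain ⟨h', hp'⟩ := hmem q' p' hp'
      have e1 : q ≠ groupHead d q' := fun e => h (by rw [e]; exact groupHead_mod q')
      have e2 : groupHead d q ≠ q' := fun e => h' (by rw [← e]; exact groupHead_mod q)
      rcases hp with rfl | rfl <;> rcases hp' with rfl | rfl
      · have e3 : groupHead d q = groupHead d q' := by
          by_contra e3
          apply hdis
          simp [Gate.support, hne.symm, e1.symm, e2.symm, Ne.symm e3]
        have e4 : (q.1 : ℕ) / d = q'.1 / d := by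
          have : (q.1 : ℕ) / d * d = q'.1 / d * d :=
            congrArg (fun q => ((Prod.fst q : Fin k) : ℕ)) e3
          exact Nat.eq_of_mul_eq_mul_right hd this
        have e5 : (groupHead d q).2 = (groupHead d q').2 := congrArg Prod.snd e3
        have e6 : (q.1 : ℕ) ≠ q'.1 := fun e =>
          hne (Prod.ext (Fin.ext e) e5)
        have e7 := Nat.div_add_mod (q.1 : ℕ) d
        have e8 := Nat.div_add_mod (q'.1 : ℕ) d
        have hle' : (q.1 : ℕ) ≤ q'.1 := hle
        rw [e4] at e7
        simp only
        omega
      -- In the other pairs one gate is a Fourier gate. It acts on a qudit that is not the target of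
      -- any SUM gate, so the supports are disjoint.
      all_goals
        exfalso; apply hdis
        simp [Gate.support, hne, hne.symm, e1, e2.symm]

/-- The SUM gate passes the shift exponent of `q` on to the first copy of its group and reduces the
clock exponent of `q` to `u q - u (groupHead d q) = 0`. The Fourier gate then turns the shift at `q`
into a clock. The clock exponents of the group heads never change, so the hypothesis persists along
the list. -/
theorem prepGates_conj (l : List (Fin k × Fin n)) (hl : l.Nodup) (u v : Fin k × Fin n → ZMod d)
    (h : ∀ q ∈ l, (q.1 : ℕ) % d ≠ 0 → u q = u (groupHead d q)) :
    Circuit.toOp d (l.flatMap (prepGates d)) * pauliOp u v =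
      pauliOp (fun q => if q ∈ l ∧ (q.1 : ℕ) % d ≠ 0 then v q else u q)
        (fun q => if (q.1 : ℕ) % d ≠ 0 then (if q ∈ l then 0 else v q) else
          v q + ((l.filter fun q' => (q'.1 : ℕ) % d ≠ 0 ∧ groupHead d q' = q).map v).sum) *
        Circuit.toOp d (l.flatMap (prepGates d)) := by
  induction l generalizing u v with
  | nil => simp [Circuit.toOp]
  | cons q l ih =>
    rw [List.flatMap_cons, Circuit.toOp_append]
    obtain ⟨hq, hl⟩ := List.nodup_cons.1 hl
    by_cases hd : (q.1 : ℕ) % d = 0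
    · have : prepGates d q = [] := by simp [prepGates, hd]
      rw [this]
      simp only [Circuit.toOp, mul_one]
      rw [ih hl u v fun p hp => h p (List.mem_cons_of_mem _ hp)]
      congr 2
      · funext p
        by_cases hp : p = q
        · subst hp; simp [hd]
        · simp [hp]
      · funext p
        by_cases hp : p = q
        · subst hp; simp [hd]
        · simp [hp, hd]
    · have : prepGates d q = [.sum q (groupHead d q) (groupHead_ne hd), .fourier q] := by
        simp [prepGates, hd]
      have hqt := groupHead_ne hd
      have hu : u q = u (groupHead d q) := h q (by simp) hd
      have hmod : ((groupHead d q).1 : ℕ) % d = 0 := groupHead_mod q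
      have hconj : Circuit.toOp d (prepGates d q) * pauliOp u v =
          pauliOp (Function.update u q (v q)) (Function.update (Function.update v (groupHead d q)
            (v (groupHead d q) + v q)) q 0) * Circuit.toOp d (prepGates d q) := by
        rw [this]
        simp only [Circuit.toOp, Gate.toOp, one_mul]
        rw [mul_assoc, sum_mul_pauliOp hqt, ← mul_assoc, fourier_mul_pauliOp _ _ _ (by simp [hu]),
          mul_assoc]
        congr 2
        simp [hqt]
      rw [mul_assoc, hconj, ← mul_assoc, ih hl, mul_assoc]
      · congr 2
        · funext p
          by_cases hp : p = q
          · subst hp; simp [hd, hq]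
          · simp only [hp, List.mem_cons, false_or, Function.update_of_ne, ne_eq, not_false_eq_true]
            by_cases hpd : (p.1 : ℕ) % d = 0
            · simp [hpd]
            · have : p ≠ groupHead d q := by rintro rfl; exact hpd hmod
              simp [this]
        · have hmap : ∀ l' : List (Fin k × Fin n), q ∉ l' → (∀ p ∈ l', (p.1 : ℕ) % d ≠ 0) →
              l'.map (Function.update (Function.update v (groupHead d q)
                (v (groupHead d q) + v q)) q 0) = l'.map v := by
            intro l' h1 h2
            refine List.map_congr_left fun p hp => ?_
            have e1 : p ≠ q := by rintro rfl; exact h1 hp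
            have e2 : p ≠ groupHead d q := by rintro rfl; exact h2 _ hp hmod
            simp [e1, e2]
          funext p
          rw [hmap _ (fun h => hq (List.mem_filter.1 h).1)
            (fun p hp => by have := (List.mem_filter.1 hp).2; simp at this; exact this.1)]
          by_cases hpd : (p.1 : ℕ) % d = 0
          · have e1 : p ≠ q := by rintro rfl; exact hd hpd
            by_cases e2 : p = groupHead d q
            · subst e2
              simp [hpd, e1, hd, add_assoc]
            · simp [hpd, e1, e2, hd, Ne.symm e2]
          · have e2 : p ≠ groupHead d q := by rintro rfl; exact hpd hmod
            by_cases e1 : p = q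
            · subst e1; simp [hpd]
            · simp [hpd, e1, e2]
      · intro p hp hpd
        have e1 : p ≠ q := by rintro rfl; exact hq hp
        have e2 : groupHead d p ≠ q := by rintro rfl; exact hd (groupHead_mod p)
        rw [Function.update_of_ne e1, Function.update_of_ne e2]
        exact h p (List.mem_cons_of_mem _ hp) hpd

/-- As `d` divides `k`, all groups are complete. The first copy receives `d - 1` equal summands in
addition to its own, in total `d` times the same residue. -/
theorem sum_group_eq_zero (hk : d ∣ k) (b : Fin n → ZMod d) {q : Fin k × Fin n}
    (hq : (q.1 : ℕ) % d = 0) :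
    b q.2 + (((allQudits k n).filter fun q' => (q'.1 : ℕ) % d ≠ 0 ∧ groupHead d q' = q).map
      fun q' => b q'.2).sum = 0 := by
  have hd : 0 < d := Nat.pos_of_ne_zero (NeZero.ne d)
  have h1 : ((allQudits k n).filter fun q' => (q'.1 : ℕ) % d ≠ 0 ∧ groupHead d q' = q).map
      (fun q' => b q'.2) = ((allQudits k n).filter fun q' => (q'.1 : ℕ) % d ≠ 0 ∧
        groupHead d q' = q).map fun _ => b q.2 := by
    refine List.map_congr_left fun p hp => ?_
    have := (List.mem_filter.1 hp).2
    simp only [decide_eq_true_eq] at this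
    rw [← this.2]; rfl
  have h2 : ((allQudits k n).filter fun q' => (q'.1 : ℕ) % d ≠ 0 ∧ groupHead d q' = q).length =
      d - 1 := by
    rw [← List.toFinset_card_of_nodup ((nodup_allQudits k n).filter _)]
    rw [← Nat.card_Ioo 0 d |>.trans (by omega : d - 0 - 1 = d - 1)]
    -- A member of the group corresponds to its distance from the first copy, a number strictly
    -- between `0` and `d`.
    refine Finset.card_bij (fun p _ => (p.1 : ℕ) - q.1) ?_ ?_ ?_
    · intro p hp
      simp only [List.mem_toFinset, List.mem_filter, mem_allQudits, true_and, decide_eq_true_eq] at hp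
      obtain ⟨h1, rfl⟩ := hp
      simp only [groupHead, Finset.mem_Ioo]
      have h2 := Nat.div_add_mod' (p.1 : ℕ) d
      have := Nat.mod_lt (p.1 : ℕ) hd
      omega
    · intro p hp p' hp' hpp
      simp only [List.mem_toFinset, List.mem_filter, mem_allQudits, true_and, decide_eq_true_eq] at hp hp'
      obtain ⟨h1, e1⟩ := hp
      obtain ⟨h1', e1'⟩ := hp'
      have a1 : (p.1 : ℕ) / d * d = q.1 := congrArg (fun q => ((Prod.fst q : Fin k) : ℕ)) e1
      have a1' : (p'.1 : ℕ) / d * d = q.1 := congrArg (fun q => ((Prod.fst q : Fin k) : ℕ)) e1'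
      have a2 : p.2 = p'.2 := (congrArg Prod.snd e1).trans (congrArg Prod.snd e1').symm
      have := Nat.div_add_mod' (p.1 : ℕ) d
      have := Nat.div_add_mod' (p'.1 : ℕ) d
      exact Prod.ext (Fin.ext (by omega)) a2
    · intro j hj
      obtain ⟨hj0, hjd⟩ := Finset.mem_Ioo.1 hj
      obtain ⟨t, ht⟩ := Nat.dvd_of_mod_eq_zero hq
      obtain ⟨s, hs⟩ := hk
      have hts : t < s := by
        have := q.1.2
        rw [ht] at this
        exact Nat.lt_of_mul_lt_mul_left (this.trans_le hs.le)
      have hlt : (q.1 : ℕ) + j < k := by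
        calc (q.1 : ℕ) + j < d * t + d := by omega
          _ = d * (t + 1) := by ring
          _ ≤ d * s := Nat.mul_le_mul_left _ hts
          _ = k := hs.symm
      refine ⟨(⟨q.1 + j, hlt⟩, q.2), ?_, by simp⟩
      simp only [List.mem_toFinset, List.mem_filter, mem_allQudits, true_and, decide_eq_true_eq]
      refine ⟨?_, Prod.ext (Fin.ext ?_) rfl⟩
      · rw [ht, Nat.mul_add_mod, Nat.mod_eq_of_lt hjd]; omega
      · simp only [groupHead]
        rw [ht, Nat.mul_add_div hd, Nat.div_eq_of_lt hjd, add_zero, mul_comm]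
  rw [h1, List.map_const', h2, List.sum_replicate, nsmul_eq_mul, Nat.cast_sub (by omega)]
  simp

/-- The point that is read off from the outcomes of the measurement of all qudits. -/
def outcomePoint (r : Fin k × Fin n → ZMod d) : PhaseSpace d n :=
  (fun j => ∑ c : Fin k, if (c : ℕ) % d = 0 then 0 else r (c, j),
    fun j => -∑ c : Fin k, if (c : ℕ) % d = 0 then r (c, j) else 0)

/-- All shifts are gone. The clock exponents are `a` on the first copies of the groups and `b` on
the others, and the minus sign in `outcomePoint` makes their pairing with the outcome the symplectic
form. -/
theorem prepCircuit_conj (hk : d ∣ k) (x : PhaseSpace d n) :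
    (prepCircuit d k n).toOp d * pauliOp (fun q : Fin k × Fin n => x.1 q.2) (fun q => x.2 q.2) =
      Matrix.diagonal (fun r => (ZMod.stdAddChar (symp (outcomePoint r) x) : ℂ)) *
        (prepCircuit d k n).toOp d := by
  rw [prepCircuit, prepGates_conj _ (nodup_allQudits k n) _ _ fun _ _ _ => rfl]
  have hv : (fun q : Fin k × Fin n => if (q.1 : ℕ) % d ≠ 0 then
      (if q ∈ allQudits k n then 0 else x.2 q.2) else x.2 q.2 +
        (((allQudits k n).filter fun q' => (q'.1 : ℕ) % d ≠ 0 ∧ groupHead d q' = q).map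
          fun q' => x.2 q'.2).sum) = 0 := by
    funext q
    by_cases h : (q.1 : ℕ) % d = 0
    · simpa [h] using sum_group_eq_zero hk x.2 h
    · simp [h, mem_allQudits]
  rw [hv, pauliOp_eq_diagonal]
  congr 3
  funext r
  congr 1
  simp only [mem_allQudits, true_and, Fintype.sum_prod_type, symp, outcomePoint]
  rw [Finset.sum_comm]
  refine Finset.sum_congr rfl fun j _ => ?_
  rw [mul_neg, sub_neg_eq_add, Finset.sum_mul, Finset.mul_sum, ← Finset.sum_add_distrib]
  refine Finset.sum_congr rfl fun c _ => ?_
  by_cases h : (c : ℕ) % d = 0 <;> simp [h, mul_comm]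

theorem dvd_numCopies : d ∣ numCopies d := by
  unfold numCopies; split_ifs
  · exact dvd_rfl
  · exact dvd_mul_left _ _

theorem symp_sub_left (y z x : PhaseSpace d n) : symp (y - z) x = symp y x - symp z x := by
  simp only [symp, ← Finset.sum_sub_distrib]
  exact Finset.sum_congr rfl fun j _ => by simp; ring

theorem symp_add_right (z x y : PhaseSpace d n) : symp z (x + y) = symp z x + symp z y := by
  simp only [symp, ← Finset.sum_add_distrib]
  exact Finset.sum_congr rfl fun j _ => by simp; ring

/-- Orthogonality of characters, with nondegeneracy of the form tested on unit vectors. -/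
theorem sum_stdAddChar_symp (z : PhaseSpace d n) :
    ∑ x : PhaseSpace d n, (ZMod.stdAddChar (symp z x) : ℂ) = if z = 0 then (d : ℂ) ^ (2 * n) else 0 := by
  have hinj := ZMod.injective_stdAddChar (N := d)
  let ψ : AddChar (PhaseSpace d n) ℂ :=
    { toFun := fun x => ZMod.stdAddChar (symp z x)
      map_zero_eq_one' := by simp [symp]
      map_add_eq_mul' := fun x y => by rw [symp_add_right, AddChar.map_add_eq_mul] }
  have h := AddChar.sum_eq_ite ψ
  have hψ : ψ = 0 ↔ z = 0 := by
    constructor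
    · intro h0
      have h1 : ∀ x, symp z x = 0 := fun x => hinj (by
        rw [AddChar.map_zero_eq_one]; exact DFunLike.congr_fun h0 x)
      refine Prod.ext (funext fun j => ?_) (funext fun j => ?_)
      · simpa [symp, Pi.single_apply] using h1 (0, Pi.single j 1)
      · simpa [symp, Pi.single_apply] using h1 (Pi.single j 1, 0)
    · rintro rfl
      ext x
      show ZMod.stdAddChar (symp 0 x) = 1
      simp [symp]
  change ∑ x, ψ x = _
  rw [h]
  simp only [hψ]
  split_ifs
  · simp [ZMod.card, two_mul, pow_add]
  · rfl

/-- After conjugation with the circuit both sides are diagonal, and Fourier inversion on the phase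
space identifies the entries with the indicator of `outcomePoint r = y`. -/
theorem prepCircuit_implements :
    (prepCircuit d (numCopies d) n).ImplementsCharacterPOVM (d := d) outcomePoint := by
  intro y
  set C := (prepCircuit d (numCopies d) n).toOp d with hC
  have hd : (d : ℂ) ≠ 0 := Nat.cast_ne_zero.2 (NeZero.ne d)
  have h1 : ∀ x : PhaseSpace d n, opPow (numCopies d) (weyl x) =
      Cᴴ * Matrix.diagonal (fun r => (ZMod.stdAddChar (symp (outcomePoint r) x) : ℂ)) * C := by
    intro x
    rw [mul_assoc, ← prepCircuit_conj dvd_numCopies, ← mul_assoc, Circuit.toOp_unitary, one_mul,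
      opPow_numCopies_weyl]
  have h2 : ∑ r with outcomePoint r = y, Cᴴ * Matrix.single r r (1 : ℂ) * C =
      Cᴴ * (∑ r with outcomePoint r = y, Matrix.single r r (1 : ℂ)) * C := by
    rw [Finset.mul_sum, Finset.sum_mul]
  have h3 : characterPOVM y = Cᴴ * (((d : ℂ) ^ (2 * n))⁻¹ • ∑ x : PhaseSpace d n,
      (ZMod.stdAddChar (-symp y x) : ℂ) • Matrix.diagonal
        (fun r => (ZMod.stdAddChar (symp (outcomePoint r) x) : ℂ))) * C := by
    rw [characterPOVM, Matrix.mul_smul, Matrix.smul_mul, Finset.mul_sum, Finset.sum_mul]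
    congr 1
    refine Finset.sum_congr rfl fun x _ => ?_
    rw [h1, omega_inv_pow_val, Matrix.mul_smul, Matrix.smul_mul]
  rw [h2, h3]
  congr 2
  ext r s
  rw [Matrix.sum_apply, Matrix.smul_apply, Matrix.sum_apply]
  simp only [Matrix.smul_apply, Matrix.diagonal_apply, smul_eq_mul, Matrix.single_apply]
  by_cases hrs : r = s
  · subst hrs
    simp only [if_true, ← AddChar.map_add_eq_mul, and_self]
    have h4 : ∀ x, -symp y x + symp (outcomePoint r) x = symp (outcomePoint r - y) x := fun x => by
      rw [symp_sub_left]; ring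
    simp only [h4, sum_stdAddChar_symp, sub_eq_zero]
    rw [Finset.sum_ite_eq']
    by_cases hy : outcomePoint r = y
    · simp [hy, hd]
    · simp [hy]
  · have : ∀ t, ¬ (t = r ∧ t = s) := fun t h => hrs (h.1.symm.trans h.2)
    simp [hrs, this]

end

/-! ## The circuit of the final readout -/

theorem searchPhase_spec {d a b N : ℕ} (h : ∃ t < N, (a + t * b) % d = 0) :
    (a + searchPhase d a b N * b) % d = 0 := by
  induction N with
  | zero => obtain ⟨t, ht, -⟩ := h; omega
  | succ N ih =>
    rw [searchPhase]
    split_ifs with h'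
    · exact h'
    · refine ih ?_
      obtain ⟨t, ht, h⟩ := h
      rcases Nat.lt_succ_iff_lt_or_eq.1 ht with ht | rfl
      · exact ⟨t, ht, h⟩
      · exact absurd h h'

/-- The exhaustive search succeeds because `-a / b` exists modulo the prime `d`. -/
theorem phaseCount_spec {d : ℕ} [Fact d.Prime] (a : ZMod d) {b : ZMod d} (hb : b ≠ 0) :
    a + phaseCount a b * b = 0 := by
  have key : ∀ t : ℕ, (a.val + t * b.val) % d = 0 ↔ a + t * b = 0 := by
    intro t
    rw [← Nat.dvd_iff_mod_eq_zero, ← ZMod.natCast_eq_zero_iff]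
    simp
  rw [← key]
  refine searchPhase_spec ⟨(-a / b).val, ZMod.val_lt _, ?_⟩
  rw [key]
  simp [hb]

section
variable {d k n : ℕ} [Fact d.Prime]

/-- The gates on the qudit `q`, where copy `k` belongs to the point `x k`. -/
def readoutGates (x : ℕ → ℕ → ZMod d) (q : Fin k × Fin n) : Circuit k n :=
  if x q.1 (n + q.2) = 0 then [] else
    List.replicate (phaseCount (x q.1 q.2) (x q.1 (n + q.2))) (.phase q) ++ [.fourier q]

variable (k n) in
/-- The circuit that measures the Weyl operators of the points `x 0, …, x (k-1)` on one copy each. -/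
def readoutCircuit (x : ℕ → ℕ → ZMod d) : Circuit k n := (allQudits k n).flatMap (readoutGates x)

theorem readoutCircuit_code (x : ℕ → ℕ → ZMod d) :
    (readoutCircuit k n x).map Gate.code = readoutCode n x k := by
  have h : ∀ q : Fin k × Fin n, (readoutGates x q).map Gate.code =
      readoutBlock q.1 q.2 (x q.1 q.2) (x q.1 (n + q.2)) := by
    intro q
    unfold readoutGates readoutBlock
    split_ifs <;> simp [Gate.code]
  rw [readoutCircuit, List.map_flatMap]
  simp only [h]
  exact flatMap_allQudits k n fun i j => readoutBlock i j (x i j) (x i (n + j))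

theorem readoutCircuit_length_le (x : ℕ → ℕ → ZMod d) :
    (readoutCircuit k n x).length ≤ k * (n * d) := by
  rw [← List.length_map (f := Gate.code), readoutCircuit_code]
  exact length_flatMap_range_le _ _ _ fun k => length_flatMap_range_le _ _ _ fun j =>
    readoutBlock_length_le _ _ _ _

theorem readoutGates_support {x : ℕ → ℕ → ZMod d} {q : Fin k × Fin n} {g : Gate k n}
    (hg : g ∈ readoutGates x q) : g.support = {q} := by
  unfold readoutGates at hg
  split_ifs at hg
  · simp at hg
  · simp only [List.mem_append, List.mem_replicate, List.mem_singleton] at hg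
    rcases hg with ⟨-, rfl⟩ | rfl <;> rfl

theorem readoutCircuit_coherentOn (x : ℕ → ℕ → ZMod d) : (readoutCircuit k n x).CoherentOn 1 := by
  intro g hg
  obtain ⟨q, -, hq⟩ := List.mem_flatMap.1 hg
  intro p hp p' hp'
  rw [readoutGates_support hq, Finset.mem_singleton] at hp hp'
  rw [hp, hp']

/-- Only gates on the same qudit share support, so a gate can be executed at its position within the
block of its qudit. -/
theorem readoutCircuit_depthLE (x : ℕ → ℕ → ZMod d) : (readoutCircuit k n x).DepthLE d := by
  have hd : 0 < d := (Fact.out : d.Prime).pos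
  let f : Fin k × Fin n → List (Gate k n × ℕ) := fun q =>
    (readoutGates x q).zip (List.range (readoutGates x q).length)
  have hf1 : ∀ q, (f q).map Prod.fst = readoutGates x q := fun q => by
    simp [f, List.map_fst_zip]
  have hf : readoutCircuit k n x = ((allQudits k n).flatMap f).map Prod.fst := by
    rw [readoutCircuit, List.map_flatMap]
    simp only [hf1]
  have hsup : ∀ q, ∀ p ∈ f q, p.1.support = {q} := fun q p hp =>
    readoutGates_support (x := x) (hf1 q ▸ List.mem_map_of_mem hp)
  rw [hf]
  refine Circuit.depthLE_of_labels _ ?_ ?_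
  · intro p hp
    obtain ⟨q, -, hq⟩ := List.mem_flatMap.1 hp
    have h1 := List.mem_range.1 (List.of_mem_zip hq).2
    refine h1.trans_le ?_
    rw [readoutGates]
    have := searchPhase_le (d := d) (x q.1 q.2).val (x q.1 (n + q.2)).val d
    split_ifs
    · simp
    · simp only [List.length_append, List.length_replicate, List.length_singleton, phaseCount]; omega
  · rw [List.pairwise_flatMap]
    refine ⟨fun q _ => ?_, (nodup_allQudits k n).imp ?_⟩
    · have h1 : (f q).map Prod.snd = List.range (readoutGates x q).length := by
        simp [f, List.map_snd_zip]
      have h2 : ((f q).map Prod.snd).Pairwise (· < ·) := by rw [h1]; exact List.pairwise_lt_range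
      exact (List.pairwise_map.1 h2).imp fun {a b} h (_ : ¬ Disjoint a.1.support b.1.support) => h
    · intro q q' hne p hp p' hp' h
      exfalso; apply h
      rw [hsup q p hp, hsup q' p' hp']
      simpa using hne

/-- Phase gates leave the shift exponent alone, so each of them contributes the same factor. -/
theorem replicate_phase_conj (q : Fin k × Fin n) (t : ℕ) (u v : Fin k × Fin n → ZMod d) :
    Circuit.toOp d (List.replicate t (.phase q)) * pauliOp u v = (tau d)⁻¹ ^ (t * (v q).val ^ 2) •
      (pauliOp (Function.update u q (u q + t * v q)) v *
        Circuit.toOp d (List.replicate t (.phase q))) := by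
  induction t generalizing u with
  | zero => simp [Circuit.toOp]
  | succ t ih =>
    rw [List.replicate_succ]
    simp only [Circuit.toOp, Gate.toOp]
    rw [mul_assoc, phase_mul_pauliOp, Matrix.mul_smul, ← mul_assoc, ih, Matrix.smul_mul, smul_smul,
      ← pow_add, mul_assoc]
    congr 2
    · ring
    · congr 1
      rw [Function.update_self, Function.update_idem,
        show u q + v q + t * v q = u q + (t + 1 : ℕ) * v q by push_cast; ring]

/-- On the qudit `q`, the Pauli operator with exponents `u`, `v` is trivial or that of the point
that is measured on its copy. -/
def Matches (x : ℕ → ℕ → ZMod d) (u v : Fin k × Fin n → ZMod d) (q : Fin k × Fin n) : Prop :=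
  (u q = 0 ∧ v q = 0) ∨ (u q = x q.1 q.2 ∧ v q = x q.1 (n + q.2))

/-- For `b = 0` the operator is already diagonal and no gate is needed. For `b ≠ 0` the phase gates
cancel the clock exponent and the Fourier gate turns the remaining shift into a clock. An operator
that is trivial at `q` stays trivial. -/
theorem readoutGates_conj_single (x : ℕ → ℕ → ZMod d) (q : Fin k × Fin n)
    (u v : Fin k × Fin n → ZMod d) (h : Matches x u v q) :
    Circuit.toOp d (readoutGates x q) * pauliOp u v =
      (tau d)⁻¹ ^ (phaseCount (x q.1 q.2) (x q.1 (n + q.2)) * (v q).val ^ 2) •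
      (pauliOp (Function.update u q (if x q.1 (n + q.2) = 0 then u q else v q))
        (Function.update v q 0) * Circuit.toOp d (readoutGates x q)) := by
  unfold readoutGates
  by_cases hb : x q.1 (n + q.2) = 0
  · have hv : v q = 0 := by rcases h with h | h <;> simp [h.2, hb]
    have hv' : Function.update v q 0 = v := by rw [← hv]; exact Function.update_eq_self q v
    simp [hb, hv, hv', Circuit.toOp]
  · have hu : u q + phaseCount (x q.1 q.2) (x q.1 (n + q.2)) * v q = 0 := by
      rcases h with h | h
      · simp [h.1, h.2]
      · rw [h.1, h.2]; exact phaseCount_spec _ hb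
    rw [if_neg hb, if_neg hb, Circuit.toOp_append, mul_assoc, replicate_phase_conj, Matrix.mul_smul,
      ← mul_assoc]
    simp only [Circuit.toOp, Gate.toOp, one_mul]
    rw [hu, fourier_mul_pauliOp _ _ _ (by simp), mul_assoc, Function.update_idem]

theorem readoutGates_conj (x : ℕ → ℕ → ZMod d) (l : List (Fin k × Fin n)) (hl : l.Nodup)
    (u v : Fin k × Fin n → ZMod d) (h : ∀ q ∈ l, Matches x u v q) :
    Circuit.toOp d (l.flatMap (readoutGates x)) * pauliOp u v =
      (tau d)⁻¹ ^ (l.map fun q => phaseCount (x q.1 q.2) (x q.1 (n + q.2)) * (v q).val ^ 2).sum •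
      (pauliOp (fun q => if q ∈ l ∧ x q.1 (n + q.2) ≠ 0 then v q else u q)
        (fun q => if q ∈ l then 0 else v q) * Circuit.toOp d (l.flatMap (readoutGates x))) := by
  induction l generalizing u v with
  | nil => simp [Circuit.toOp]
  | cons q l ih =>
    obtain ⟨hq, hl⟩ := List.nodup_cons.1 hl
    rw [List.flatMap_cons, Circuit.toOp_append, mul_assoc,
      readoutGates_conj_single x q u v (h q (by simp)), Matrix.mul_smul, ← mul_assoc, ih hl,
      Matrix.smul_mul, smul_smul, ← pow_add, mul_assoc]
    · congr 2
      · rw [List.map_cons, List.sum_cons]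
        congr 2
        refine List.map_congr_left fun p hp => ?_
        have : p ≠ q := by rintro rfl; exact hq hp
        rw [Function.update_of_ne this]
      · congr 1
        · funext p
          by_cases hp : p = q
          · subst hp
            by_cases hb : x p.1 (n + p.2) = 0 <;> simp [hq, hb]
          · simp [hp]
        · funext p
          by_cases hp : p = q
          · subst hp; simp
          · simp [hp]
    · intro p hp
      have : p ≠ q := by rintro rfl; exact hq hp
      have h' := h p (by simp [hp])
      unfold Matches at h' ⊢
      rwa [Function.update_of_ne this, Function.update_of_ne this]

/-- The point of the phase space with the digits `x`. -/
def toPoint (x : ℕ → ZMod d) : PhaseSpace d n := (fun j => x j, fun j => x (n + j))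

/-- A Weyl operator acting on one of the copies. -/
theorem pauliOp_mulVec_vecPow (i : Fin k) (a b : Fin n → ZMod d) (ψ : Vec d (Fin n)) (μ : ℂ)
    (h : pauliOp a b *ᵥ ψ = μ • ψ) :
    pauliOp (fun q : Fin k × Fin n => if q.1 = i then a q.2 else 0)
      (fun q => if q.1 = i then b q.2 else 0) *ᵥ vecPow k ψ = μ • vecPow k ψ := by
  funext r
  rw [pauliOp_mulVec]
  simp only [vecPow, Pi.smul_apply, smul_eq_mul]
  rw [← Finset.mul_prod_erase _ _ (Finset.mem_univ i),
    ← Finset.mul_prod_erase _ (fun c => ψ fun j => r (c, j)) (Finset.mem_univ i)]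
  have h1 : ∏ c ∈ Finset.univ.erase i, ψ (fun j => (r - fun q : Fin k × Fin n =>
      if q.1 = i then b q.2 else 0) (c, j)) = ∏ c ∈ Finset.univ.erase i, ψ fun j => r (c, j) := by
    refine Finset.prod_congr rfl fun c hc => ?_
    have := Finset.ne_of_mem_erase hc
    simp [this]
  have h2 := congrFun h fun j => r (i, j)
  rw [pauliOp_mulVec] at h2
  simp only [Pi.smul_apply, smul_eq_mul] at h2
  rw [h1, ← mul_assoc, ← mul_assoc]
  congr 1
  rw [← h2]
  congr 1
  · congr 1
    rw [Fintype.sum_prod_type, Finset.sum_eq_single i]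
    · simp
    · intro c _ hc; simp [hc]
    · simp
  · congr 1
    funext j
    simp

/-- An outcome of positive probability determines the phase of every point that is measured. -/
theorem tau_pow_phaseExponent (x : ℕ → ℕ → ZMod d) (ψ : Vec d (Fin n)) (s : Fin k × Fin n → ZMod d)
    (hs : (readoutCircuit k n x).prob ψ s ≠ 0) (i : Fin k) (μ : ℂ)
    (hμ : weyl (toPoint (n := n) (x i)) *ᵥ ψ = μ • ψ) :
    tau d ^ phaseExponent n (x i) (fun j => if h : j < n then (s (i, ⟨j, h⟩)).val else 0) * μ = 1 := by
  have hd : 0 < d := (Fact.out : d.Prime).pos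
  have ht := tau_ne_zero (d := d)
  set C := (readoutCircuit k n x).toOp d with hC
  set a : Fin n → ZMod d := fun j => x i j with ha
  set b : Fin n → ZMod d := fun j => x i (n + j) with hb
  -- A non-zero amplitude at `s` allows the two forms of the eigenvalue equation to be compared in
  -- this entry.
  have hφ : (C *ᵥ vecPow k ψ) s ≠ 0 := by
    intro h; apply hs; simp [Circuit.prob, ← hC, h]
  have h1 : pauliOp a b *ᵥ ψ = (tau d ^ valDot a b * μ) • ψ := by
    have h := hμ
    rw [weyl_eq, Matrix.smul_mulVec] at h
    have h' := congrArg (fun v => tau d ^ valDot a b • v) h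
    simp only [smul_smul] at h'
    rw [← h']
    have : tau d ^ valDot a b * (tau d)⁻¹ ^ valDot a b = 1 := by
      rw [← mul_pow, mul_inv_cancel₀ ht, one_pow]
    change _ = (tau d ^ valDot a b * (tau d)⁻¹ ^ valDot a b) • _
    rw [this, one_smul]; rfl
  have h2 := pauliOp_mulVec_vecPow (k := k) i a b ψ _ h1
  have h3 := readoutGates_conj x (allQudits k n) (nodup_allQudits k n)
    (fun q => if q.1 = i then a q.2 else 0) (fun q => if q.1 = i then b q.2 else 0) (by
      intro q _
      by_cases hq : q.1 = i
      · exact Or.inr ⟨by simp [hq, ha], by simp [hq, hb]⟩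
      · exact Or.inl ⟨by simp [hq], by simp [hq]⟩)
  rw [← readoutCircuit, ← hC] at h3
  have h4 := congrArg (fun M => (M *ᵥ vecPow k ψ) s) h3
  simp only [← Matrix.mulVec_mulVec, h2, Matrix.mulVec_smul, Matrix.smul_mulVec, Pi.smul_apply,
    smul_eq_mul, mem_allQudits, true_and, if_true] at h4
  have h0 : (fun _ : Fin k × Fin n => (0 : ZMod d)) = 0 := rfl
  rw [h0, pauliOp_mulVec, sub_zero, ← mul_assoc] at h4
  have h5 := mul_right_cancel₀ hφ h4
  have h6 : ((allQudits k n).map fun q => phaseCount (x q.1 q.2) (x q.1 (n + q.2)) *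
      (if q.1 = i then b q.2 else 0).val ^ 2).sum = ∑ j, phaseCount (a j) (b j) * (b j).val ^ 2 := by
    have : (allQudits k n).toFinset = Finset.univ := by ext q; simp [mem_allQudits]
    rw [← List.sum_toFinset _ (nodup_allQudits k n), this, Fintype.sum_prod_type,
      Finset.sum_eq_single i]
    · simp [ha, hb]
    · intro c _ hc; simp [hc]
    · simp
  have h7 : ∑ q : Fin k × Fin n, (if x q.1 (n + q.2) ≠ 0 then (if q.1 = i then b q.2 else 0) else
      if q.1 = i then a q.2 else 0) * s q = ∑ j, (if b j ≠ 0 then b j else a j) * s (i, j) := by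
    rw [Fintype.sum_prod_type, Finset.sum_eq_single i]
    · simp [hb]
    · intro c _ hc; simp [hc]
    · simp
  rw [h6, h7] at h5
  have h8 : ∀ v, tau d ^ (v % (2 * d)) = tau d ^ v := fun v => by
    conv_rhs => rw [← Nat.mod_add_div v (2 * d), pow_add, pow_mul, tau_pow_two_mul_self, one_pow,
      mul_one]
  rw [phaseExponent, h8, Finset.sum_range]
  have h9 : ∑ j : Fin n, phaseTerm (x i j) (x i (n + j))
      (if h : (j : ℕ) < n then (s (i, ⟨j, h⟩)).val else 0) = (valDot a b +
        ∑ j, phaseCount (a j) (b j) * (b j).val ^ 2) +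
        2 * ((d - 1) * ∑ j, ((b j).val + (1 - (b j).val) * (a j).val) * (s (i, j)).val) := by
    rw [valDot, Finset.mul_sum, Finset.mul_sum, ← Finset.sum_add_distrib, ← Finset.sum_add_distrib]
    refine Finset.sum_congr rfl fun j _ => ?_
    simp only [phaseTerm, j.2, dif_pos]
    ring
  rw [h9, pow_add, pow_add, tau_pow_two_mul]
  have h10 : (((d - 1) * ∑ j, ((b j).val + (1 - (b j).val) * (a j).val) * (s (i, j)).val : ℕ) : ZMod d)
      = -∑ j, (if b j ≠ 0 then b j else a j) * s (i, j) := by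
    push_cast
    rw [Nat.cast_sub hd, ZMod.natCast_self, zero_sub, Nat.cast_one, neg_one_mul]
    congr 1
    refine Finset.sum_congr rfl fun j _ => ?_
    rw [ZMod.natCast_zmod_val (s (i, j))]
    congr 1
    by_cases hbj : b j = 0
    · simp [hbj]
    · have : (b j).val ≠ 0 := fun h => hbj ((ZMod.val_eq_zero _).1 h)
      rw [Nat.sub_eq_zero_of_le (by omega), if_pos hbj]
      simp
  rw [h10]
  calc _ = (tau d ^ valDot a b * μ) * tau d ^ (∑ j, phaseCount (a j) (b j) * (b j).val ^ 2) *
        ZMod.stdAddChar (-∑ j, (if b j ≠ 0 then b j else a j) * s (i, j)) := by ring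
    _ = ((tau d)⁻¹ ^ (∑ j, phaseCount (a j) (b j) * (b j).val ^ 2) *
        tau d ^ (∑ j, phaseCount (a j) (b j) * (b j).val ^ 2)) *
        (ZMod.stdAddChar (∑ j, (if b j ≠ 0 then b j else a j) * s (i, j)) *
        ZMod.stdAddChar (-∑ j, (if b j ≠ 0 then b j else a j) * s (i, j))) := by rw [h5]; ring
    _ = 1 := by
      rw [← mul_pow, inv_mul_cancel₀ ht, one_pow, ← AddChar.map_add_eq_mul, add_neg_cancel,
        AddChar.map_zero_eq_one, one_mul]

end

/-! ## Null spaces and isotropic subspaces -/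

section
variable {K V : Type*} [Field K] [AddCommGroup V] [Module K V]

/-- The map `v ↦ c v - φ(v) b_p` sends the span into the kernel, and on vectors of the kernel it is
multiplication by `c ≠ 0`. -/
theorem span_eliminate {w p : ℕ} (hp : p < w) (b b' : ℕ → V) (φ : V →ₗ[K] K) {c : K} (hc : c ≠ 0)
    (h : (∀ k < w, φ (b k) = 0) ∨ c = φ (b p)) (hb : ∀ k < w, b' k = c • b k - φ (b k) • b p) :
    Submodule.span K (b' '' Set.Iio w) = Submodule.span K (b '' Set.Iio w) ⊓ LinearMap.ker φ := by
  have hmem : ∀ k < w, b k ∈ Submodule.span K (b '' Set.Iio w) := fun k hk =>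
    Submodule.subset_span ⟨k, hk, rfl⟩
  apply le_antisymm
  · rw [Submodule.span_le]
    rintro _ ⟨k, hk, rfl⟩
    rw [hb k hk]
    refine ⟨sub_mem (Submodule.smul_mem _ _ (hmem k hk)) (Submodule.smul_mem _ _ (hmem p hp)), ?_⟩
    simp only [SetLike.mem_coe, LinearMap.mem_ker, map_sub, map_smul, smul_eq_mul]
    rcases h with h | h
    · simp [h k hk]
    · rw [h]; ring
  · rintro v ⟨hv, hφ⟩
    have key : ∀ v ∈ Submodule.span K (b '' Set.Iio w), c • v - φ v • b p ∈
        Submodule.span K (b' '' Set.Iio w) := by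
      intro v hv
      induction hv using Submodule.span_induction with
      | mem x hx =>
        obtain ⟨k, hk, rfl⟩ := hx
        rw [← hb k hk]; exact Submodule.subset_span ⟨k, hk, rfl⟩
      | zero => simp
      | add x y _ _ hx hy =>
        convert add_mem hx hy using 1
        rw [map_add, smul_add, add_smul]; abel
      | smul a x _ hx =>
        convert Submodule.smul_mem _ a hx using 1
        rw [map_smul, smul_sub, smul_smul, smul_smul, smul_smul, smul_eq_mul, mul_comm c]
    have := key v hv
    rw [LinearMap.mem_ker.1 hφ, zero_smul, sub_zero] at this
    simpa [smul_smul, hc] using Submodule.smul_mem _ c⁻¹ this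

/-- If `φ` vanishes on all rows, neither the span nor the count grows or shrinks the wrong way.
Otherwise the pivot row becomes zero while zero rows stay zero, so the count drops, and intersecting
with a hyperplane costs at most one dimension. Non-zero rows thus remain as few as the dimension
permits, without any proof of independence. -/
theorem card_eliminate [FiniteDimensional K V] {w p : ℕ} (hp : p < w) (b b' : ℕ → V) (φ : V →ₗ[K] K)
    {c : K} (hc : c ≠ 0) (h : (∀ k < w, φ (b k) = 0) ∨ c = φ (b p))
    (hb : ∀ k < w, b' k = c • b k - φ (b k) • b p) {s s' : Finset ℕ}
    (hs : ∀ k, k ∈ s ↔ k < w ∧ b k ≠ 0) (hs' : ∀ k, k ∈ s' ↔ k < w ∧ b' k ≠ 0)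
    (hcard : s.card ≤ Module.finrank K (Submodule.span K (b '' Set.Iio w))) :
    s'.card ≤ Module.finrank K (Submodule.span K (b' '' Set.Iio w)) := by
  rw [span_eliminate hp b b' φ hc h hb]
  have hss : s' ⊆ s := fun k hk => by
    rw [hs'] at hk
    rw [hs]
    refine ⟨hk.1, fun h0 => hk.2 ?_⟩
    rw [hb k hk.1, h0]; simp
  by_cases h0 : ∀ k < w, φ (b k) = 0
  · have : Submodule.span K (b '' Set.Iio w) ⊓ LinearMap.ker φ = Submodule.span K (b '' Set.Iio w) := by
      rw [inf_eq_left, Submodule.span_le]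
      rintro _ ⟨k, hk, rfl⟩
      exact h0 k hk
    rw [this]
    exact (Finset.card_le_card hss).trans hcard
  · have hcp : c = φ (b p) := h.resolve_left h0
    have hps : p ∈ s := (hs p).2 ⟨hp, fun h => hc (by rw [hcp, h, map_zero])⟩
    have hps' : p ∉ s' := fun h => ((hs' p).1 h).2 (by rw [hb p hp, ← hcp, sub_self])
    have hlt : s'.card < s.card := Finset.card_lt_card ⟨hss, fun h => hps' (h hps)⟩
    have h1 := Submodule.finrank_sup_add_finrank_inf_eq (Submodule.span K (b '' Set.Iio w))
      (LinearMap.ker φ)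
    have h2 := LinearMap.finrank_range_add_finrank_ker φ
    have h3 : Module.finrank K (LinearMap.range φ) ≤ 1 := by
      simpa using Submodule.finrank_le (LinearMap.range φ)
    have h4 := Submodule.finrank_le (Submodule.span K (b '' Set.Iio w) ⊔ LinearMap.ker φ)
    omega

end

/-! ### Linear algebra on the phase space -/

section
variable {d n : ℕ} [Fact d.Prime]

/-- The linear form on the phase space with the coefficients `h`. -/
def linearForm (h : ℕ → ZMod d) : PhaseSpace d n →ₗ[ZMod d] ZMod d where
  toFun x := ∑ j : Fin n, h j * x.1 j + ∑ j : Fin n, h (n + j) * x.2 j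
  map_add' x y := by
    simp only [Prod.fst_add, Prod.snd_add, Pi.add_apply, mul_add, Finset.sum_add_distrib]
    ring
  map_smul' a x := by
    simp only [Prod.smul_fst, Prod.smul_snd, Pi.smul_apply, smul_eq_mul, Finset.mul_sum, mul_add,
      RingHom.id_apply]
    congr 1 <;> exact Finset.sum_congr rfl fun _ _ => by ring

theorem pairing_eq (h x : ℕ → ZMod d) : pairing (n + n) h x = linearForm h (toPoint (n := n) x) := by
  rw [pairing, Finset.sum_range_add, Finset.sum_range, Finset.sum_range]
  rfl

theorem toPoint_eq_zero (x : ℕ → ZMod d) : toPoint (n := n) x = 0 ↔ ∀ l < n + n, x l = 0 := by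
  constructor
  · intro h l hl
    by_cases hn : l < n
    · exact congrFun (congrArg Prod.fst h) ⟨l, hn⟩
    · have := congrFun (congrArg Prod.snd h) ⟨l - n, by omega⟩
      simpa [toPoint, Nat.add_sub_cancel' (not_lt.1 hn)] using this
  · intro h
    exact Prod.ext (funext fun j => h j (by omega)) (funext fun j => h (n + j) (by omega))

/-- The default index `0` is harmless: a vanishing value at the pivot means that the search found
nothing. -/
theorem pivot_spec (α : ℕ → ZMod d) (w : ℕ) (h : α (pivot α w) = 0) : ∀ k < w, α k = 0 := by
  induction w with
  | zero => intro k hk; omega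
  | succ w ih =>
    rw [pivot] at h
    split_ifs at h with h'
    · intro k hk
      rcases Nat.lt_succ_iff_lt_or_eq.1 hk with hk | rfl
      · exact ih h k hk
      · exact h'
    · exact absurd h h'

/-- The unit rows span the whole space with the right count, and each further form is one
elimination step. A pivot index needs at least one row. -/
theorem kernelRows_spec (hn : 0 < n + n) (h : ℕ → ℕ → ZMod d) (i : ℕ) :
    (∀ x : PhaseSpace d n, x ∈ Submodule.span (ZMod d)
      ((fun k => toPoint (n := n) (kernelRows (n + n) h i k)) '' Set.Iio (n + n)) ↔
      ∀ i' < i, linearForm (h i') x = 0) ∧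
    (nonzeroRows (n + n) (kernelRows (n + n) h i) (n + n)).length ≤
      Module.finrank (ZMod d) (Submodule.span (ZMod d)
        ((fun k => toPoint (n := n) (kernelRows (n + n) h i k)) '' Set.Iio (n + n))) := by
  have hlen : ∀ B : ℕ → ℕ → ZMod d, (nonzeroRows (n + n) B (n + n)).length =
      ((Finset.range (n + n)).filter fun k => ∃ l < n + n, B k l ≠ 0).card := fun B => by
    rw [nonzeroRows, List.length_map]; rfl
  have hmem : ∀ (B : ℕ → ℕ → ZMod d) k,
      k ∈ ((Finset.range (n + n)).filter fun k => ∃ l < n + n, B k l ≠ 0) ↔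
        k < n + n ∧ toPoint (n := n) (B k) ≠ 0 := fun B k => by
    simp [toPoint_eq_zero]
  induction i with
  | zero =>
    have htop : Submodule.span (ZMod d) ((fun k => toPoint (n := n) (kernelRows (n + n) h 0 k)) ''
        Set.Iio (n + n)) = ⊤ := by
      rw [eq_top_iff]
      intro x _
      have hx : x = ∑ j : Fin n, x.1 j • toPoint (n := n) (kernelRows (n + n) h 0 j) +
          ∑ j : Fin n, x.2 j • toPoint (n := n) (kernelRows (n + n) h 0 (n + j)) := by
        have hne : ∀ i j : Fin n, ¬ (i : ℕ) = n + j := fun i j => by omega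
        have hne' : ∀ i j : Fin n, ¬ n + (i : ℕ) = j := fun i j => by omega
        refine Prod.ext (funext fun j => ?_) (funext fun j => ?_)
        · simp [toPoint, kernelRows, Prod.fst_sum, Fin.val_inj, hne']
        · simp [toPoint, kernelRows, Prod.snd_sum, Fin.val_inj, hne]
      rw [hx]
      refine add_mem (sum_mem fun j _ => Submodule.smul_mem _ _ (Submodule.subset_span ⟨j, ?_, rfl⟩))
        (sum_mem fun j _ => Submodule.smul_mem _ _ (Submodule.subset_span ⟨n + j, ?_, rfl⟩))
      · show (j : ℕ) < n + n; omega
      · show n + (j : ℕ) < n + n; omega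
    rw [htop]
    refine ⟨by simp, (nonzeroRows_length_le _ _ _).trans ?_⟩
    simp
  | succ i ih =>
    set B := kernelRows (n + n) h i with hB
    set α : ℕ → ZMod d := fun k => pairing (n + n) (h i) (B k) with hα
    have hp : pivot α (n + n) < n + n := pivot_lt α hn
    have hc : pivotValue α (n + n) ≠ 0 := by
      unfold pivotValue; split_ifs with h0
      · exact one_ne_zero
      · exact h0
    have hor : (∀ k < n + n, linearForm (h i) (toPoint (n := n) (B k)) = 0) ∨
        pivotValue α (n + n) = linearForm (h i) (toPoint (n := n) (B (pivot α (n + n)))) := by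
      by_cases h0 : α (pivot α (n + n)) = 0
      · left; intro k hk; rw [← pairing_eq]; exact pivot_spec α _ h0 k hk
      · right; rw [pivotValue, if_neg h0, ← pairing_eq]
    have hb : ∀ k < n + n, toPoint (n := n) (kernelRows (n + n) h (i + 1) k) =
        pivotValue α (n + n) • toPoint (n := n) (B k) -
          linearForm (h i) (toPoint (n := n) (B k)) • toPoint (n := n) (B (pivot α (n + n))) := by
      intro k _
      rw [← pairing_eq]
      rfl
    refine ⟨fun x => ?_, ?_⟩
    · rw [span_eliminate hp (fun k => toPoint (n := n) (B k)) _ (linearForm (h i)) hc hor hb,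
        Submodule.mem_inf, ih.1, LinearMap.mem_ker]
      constructor
      · rintro ⟨h1, h2⟩ i' hi'
        rcases Nat.lt_succ_iff_lt_or_eq.1 hi' with hi' | rfl
        · exact h1 i' hi'
        · exact h2
      · intro h'
        exact ⟨fun i' hi' => h' i' (by omega), h' i (by omega)⟩
    · rw [hlen]
      have h2 := ih.2
      rw [hlen] at h2
      exact card_eliminate hp (fun k => toPoint (n := n) (B k)) _ (linearForm (h i)) hc hor hb
        (hmem B) (hmem _) h2

/-- Multiplication by a scalar in `ZMod d` is repeated addition. -/
theorem coe_closure_eq_span (s : Set (PhaseSpace d n)) :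
    (AddSubgroup.closure s : Set (PhaseSpace d n)) = Submodule.span (ZMod d) s := by
  apply le_antisymm
  · show AddSubgroup.closure s ≤ (Submodule.span (ZMod d) s).toAddSubgroup
    rw [AddSubgroup.closure_le]
    exact Submodule.subset_span
  · intro x hx
    induction hx using Submodule.span_induction with
    | mem x hx => exact AddSubgroup.subset_closure hx
    | zero => exact zero_mem _
    | add x y _ _ hx hy => exact add_mem hx hy
    | smul a x _ hx =>
      rw [← ZMod.natCast_zmod_val a, Nat.cast_smul_eq_nsmul]
      exact AddSubgroup.nsmul_mem (AddSubgroup.closure s) hx _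

/-- The points computed by the non-adaptive stage from the coefficients of linear forms. -/
def kernelPoints (n : ℕ) (h : ℕ → ℕ → ZMod d) (m : ℕ) : List (PhaseSpace d n) :=
  (nonzeroRows (n + n) (kernelRows (n + n) h m) (n + n)).map toPoint

theorem span_kernelPoints (h : ℕ → ℕ → ZMod d) (m : ℕ) :
    Submodule.span (ZMod d) {x | x ∈ kernelPoints n h m} = Submodule.span (ZMod d)
      ((fun k => toPoint (n := n) (kernelRows (n + n) h m k)) '' Set.Iio (n + n)) := by
  apply le_antisymm
  · rw [Submodule.span_le]
    intro x hx
    simp only [kernelPoints, nonzeroRows, Set.mem_ofPred_eq, List.mem_map, List.mem_filter,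
      List.mem_range] at hx
    obtain ⟨_, ⟨k, ⟨hk, -⟩, rfl⟩, rfl⟩ := hx
    exact Submodule.subset_span ⟨k, hk, rfl⟩
  · rw [Submodule.span_le]
    rintro _ ⟨k, hk, rfl⟩
    by_cases h0 : toPoint (n := n) (kernelRows (n + n) h m k) = 0
    · simp only [h0]; exact zero_mem _
    · refine Submodule.subset_span ?_
      rw [toPoint_eq_zero] at h0
      push Not at h0
      simp only [kernelPoints, nonzeroRows, Set.mem_ofPred_eq, List.mem_map, List.mem_filter,
        List.mem_range]
      exact ⟨_, ⟨k, ⟨hk, by simpa using h0⟩, rfl⟩, rfl⟩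

theorem mem_closure_kernelPoints (h : ℕ → ℕ → ZMod d) (m : ℕ) (x : PhaseSpace d n) :
    x ∈ AddSubgroup.closure {x | x ∈ kernelPoints n h m} ↔ ∀ i < m, linearForm (h i) x = 0 := by
  rw [← SetLike.mem_coe, coe_closure_eq_span, SetLike.mem_coe, span_kernelPoints]
  rcases Nat.eq_zero_or_pos (n + n) with h0 | h0
  · obtain rfl : n = 0 := by omega
    have : x = 0 := Subsingleton.elim _ _
    simp [this]
  · exact (kernelRows_spec h0 h m).1 x

theorem symp_comm (x y : PhaseSpace d n) : symp x y = -symp y x := by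
  simp only [symp, ← Finset.sum_neg_distrib]
  exact Finset.sum_congr rfl fun j _ => by ring

theorem symp_smul_right (a : ZMod d) (x y : PhaseSpace d n) : symp x (a • y) = a * symp x y := by
  simp only [symp, Finset.mul_sum]
  exact Finset.sum_congr rfl fun j _ => by simp; ring

variable (d n) in
/-- The symplectic form as a bilinear form. -/
def sympForm : LinearMap.BilinForm (ZMod d) (PhaseSpace d n) :=
  LinearMap.mk₂ (ZMod d) symp
    (fun x y z => by rw [symp_comm, symp_add_right, symp_comm z, symp_comm z]; ring)
    (fun a x y => by rw [symp_comm, symp_smul_right, symp_comm y, smul_eq_mul]; ring)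
    symp_add_right symp_smul_right

/-- An isotropic subspace lies in its orthogonal complement, and by nondegeneracy the two dimensions
add up to `2n`. -/
theorem finrank_le_of_isotropic (M : Submodule (ZMod d) (PhaseSpace d n))
    (hM : ∀ x ∈ M, ∀ y ∈ M, symp x y = 0) : Module.finrank (ZMod d) M ≤ n := by
  have hzero : ∀ x : PhaseSpace d n, (∀ y, symp x y = 0) → x = 0 := by
    intro x h
    refine Prod.ext (funext fun j => ?_) (funext fun j => ?_)
    · simpa [symp, Pi.single_apply] using h (0, Pi.single j 1)
    · simpa [symp, Pi.single_apply] using h (Pi.single j 1, 0)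
  have hnd : (sympForm d n).Nondegenerate :=
    ⟨fun x h => hzero x h, fun x h => hzero x fun y => by
      rw [symp_comm, show symp y x = 0 from h y, neg_zero]⟩
  have h1 := LinearMap.BilinForm.finrank_orthogonal hnd M
  have h2 : M ≤ (sympForm d n).orthogonal M := fun x hx y hy => hM y hy x hx
  have h3 := Submodule.finrank_mono h2
  have h4 : Module.finrank (ZMod d) (PhaseSpace d n) = n + n := by simp
  have h5 := Submodule.finrank_le M
  omega

theorem kernelPoints_length_le (h : ℕ → ℕ → ZMod d) (m : ℕ)
    (hM : ∀ x y : PhaseSpace d n, (∀ i < m, linearForm (h i) x = 0) →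
      (∀ i < m, linearForm (h i) y = 0) → symp x y = 0) : (kernelPoints n h m).length ≤ n := by
  rcases Nat.eq_zero_or_pos (n + n) with h0 | h0
  · obtain rfl : n = 0 := by omega
    simp [kernelPoints, nonzeroRows]
  · obtain ⟨h1, h2⟩ := kernelRows_spec h0 h m
    rw [kernelPoints, List.length_map]
    refine h2.trans (finrank_le_of_isotropic _ fun x hx y hy => ?_)
    exact hM x y ((h1 x).1 hx) ((h1 y).1 hy)

/-- The coefficients of the linear form `x ↦ [y, x]`. -/
def sympCoeff (y : PhaseSpace d n) : ℕ → ZMod d := fun l =>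
  if h : l < n then -y.2 ⟨l, h⟩ else if h : l - n < n then y.1 ⟨l - n, h⟩ else 0

theorem linearForm_sympCoeff (y x : PhaseSpace d n) : linearForm (sympCoeff y) x = symp y x := by
  simp only [linearForm, LinearMap.coe_mk, AddHom.coe_mk, symp, ← Finset.sum_add_distrib, sympCoeff]
  refine Finset.sum_congr rfl fun j _ => ?_
  simp [j.2]
  ring

end

/-! ## Pauli operators and stabilizer groups -/

section
variable {d n : ℕ} [Fact d.Prime]

/-- The Pauli operator of the point `x` without the phase of the Weyl operator. -/
def pauliPoint (x : PhaseSpace d n) : Op d (Fin n) := pauliOp x.1 x.2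

theorem pauliPoint_zero : pauliPoint (0 : PhaseSpace d n) = 1 := pauliOp_zero

theorem pauliPoint_mul (x y : PhaseSpace d n) :
    pauliPoint x * pauliPoint y =
      (ZMod.stdAddChar (-∑ j, y.1 j * x.2 j) : ℂ) • pauliPoint (x + y) := pauliOp_mul _ _ _ _

theorem pauliPoint_eq_weyl (x : PhaseSpace d n) :
    pauliPoint x = tau d ^ valDot x.1 x.2 • weyl x := by
  rw [weyl_eq, smul_smul, ← mul_pow, mul_inv_cancel₀ tau_ne_zero, one_pow, one_smul]; rfl

/-- Inverse phases are written as natural powers of `τ`, which keeps all elements of the Pauli group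
in one normal form. -/
theorem tau_pow_inv (k : ℕ) : (tau d ^ k)⁻¹ = tau d ^ ((2 * d - 1) * k) := by
  have hd : 0 < d := (Fact.out : d.Prime).pos
  refine inv_eq_of_mul_eq_one_right ?_
  rw [← pow_add, show k + (2 * d - 1) * k = 2 * d * k by
      rw [Nat.sub_mul, one_mul]; exact Nat.add_sub_cancel' (Nat.le_mul_of_pos_left k (by omega)),
    pow_mul, tau_pow_two_mul_self, one_pow]

theorem stdAddChar_eq_tau_pow (z : ZMod d) : (ZMod.stdAddChar z : ℂ) = tau d ^ (2 * z.val) := by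
  rw [tau_pow_two_mul, ZMod.natCast_zmod_val]

theorem inv_eq_smul_pauliPoint {u : (Op d (Fin n))ˣ} {c : ℂ} (hc : c ≠ 0) {x : PhaseSpace d n}
    (hu : (u : Op d (Fin n)) = c • pauliPoint x) :
    ((u⁻¹ : (Op d (Fin n))ˣ) : Op d (Fin n)) =
      (c⁻¹ * ZMod.stdAddChar (-∑ j, x.1 j * x.2 j)) • pauliPoint (-x) := by
  refine Units.inv_eq_of_mul_eq_one_right ?_
  rw [hu, Matrix.smul_mul, Matrix.mul_smul, pauliPoint_mul, add_neg_cancel, pauliPoint_zero,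
    smul_smul, smul_smul]
  have : (-∑ j, (-x).1 j * x.2 j) = ∑ j, x.1 j * x.2 j := by simp
  rw [this]
  have h2 : c * (c⁻¹ * (ZMod.stdAddChar (-∑ j, x.1 j * x.2 j) : ℂ)) *
      ZMod.stdAddChar (∑ j, x.1 j * x.2 j) = 1 := by
    rw [← mul_assoc, mul_inv_cancel₀ hc, one_mul, ← AddChar.map_add_eq_mul, neg_add_cancel,
      AddChar.map_zero_eq_one]
  rw [mul_assoc] at h2 ⊢
  rw [h2, one_smul]

theorem localOp_shift (j : Fin n) :
    localOp j (shift d) = pauliPoint ((0, Pi.single j 1) : PhaseSpace d n) := by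
  have : Fact (1 < d) := ⟨(Fact.out : d.Prime).one_lt⟩
  rw [pauliPoint, ← tensor_clock_shift, localOp]
  congr 1
  funext i
  by_cases h : i = j
  · subst h; simp [ZMod.val_one]
  · simp [h]

theorem localOp_clock (j : Fin n) :
    localOp j (clock d) = pauliPoint ((Pi.single j 1, 0) : PhaseSpace d n) := by
  have : Fact (1 < d) := ⟨(Fact.out : d.Prime).one_lt⟩
  rw [pauliPoint, ← tensor_clock_shift, localOp]
  congr 1
  funext i
  by_cases h : i = j
  · subst h; simp [ZMod.val_one]
  · simp [h]

theorem exists_of_mem_pauliGroup {u : (Op d (Fin n))ˣ} (hu : u ∈ pauliGroup d n) :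
    ∃ k x, (u : Op d (Fin n)) = tau d ^ k • pauliPoint x := by
  induction hu using Subgroup.closure_induction with
  | mem u hu =>
    rcases hu with hu | ⟨j, hu | hu⟩
    · exact ⟨1, 0, by rw [hu, pauliPoint_zero, pow_one]⟩
    · exact ⟨0, _, by rw [hu, localOp_shift, pow_zero, one_smul]⟩
    · exact ⟨0, _, by rw [hu, localOp_clock, pow_zero, one_smul]⟩
  | one => exact ⟨0, 0, by rw [pauliPoint_zero, pow_zero, one_smul]; rfl⟩
  | mul u v _ _ hu hv =>
    obtain ⟨k, x, hu⟩ := hu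
    obtain ⟨l, y, hv⟩ := hv
    refine ⟨l + k + 2 * (-∑ j, y.1 j * x.2 j).val, x + y, ?_⟩
    rw [Units.val_mul, hu, hv, Matrix.smul_mul, Matrix.mul_smul, pauliPoint_mul, smul_smul, smul_smul,
      stdAddChar_eq_tau_pow, ← pow_add, ← pow_add]
    congr 2; ring
  | inv u _ hu =>
    obtain ⟨k, x, hu⟩ := hu
    refine ⟨(2 * d - 1) * k + 2 * (-∑ j, x.1 j * x.2 j).val, -x, ?_⟩
    rw [inv_eq_smul_pauliPoint (pow_ne_zero k tau_ne_zero) hu, tau_pow_inv, stdAddChar_eq_tau_pow,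
      pow_add]

variable (d n) in
/-- The scalar `τ` as an element of the Pauli group. -/
def tauUnit : (Op d (Fin n))ˣ where
  val := tau d • 1
  inv := (tau d)⁻¹ • 1
  val_inv := by rw [smul_mul_smul_comm, mul_inv_cancel₀ tau_ne_zero]; simp
  inv_val := by rw [smul_mul_smul_comm, inv_mul_cancel₀ tau_ne_zero]; simp

theorem tauUnit_mem : tauUnit d n ∈ pauliGroup d n := Subgroup.subset_closure (Or.inl rfl)

theorem tauUnit_pow (k : ℕ) : ((tauUnit d n ^ k : (Op d (Fin n))ˣ) : Op d (Fin n)) = tau d ^ k • 1 := by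
  rw [Units.val_pow_eq_pow_val]
  show (tau d • (1 : Op d (Fin n))) ^ k = _
  rw [smul_pow, one_pow]

theorem exists_unit_of_unitary {A : Op d (Fin n)} (h : Aᴴ * A = 1) :
    ∃ u : (Op d (Fin n))ˣ, (u : Op d (Fin n)) = A :=
  ⟨⟨A, Aᴴ, mul_eq_one_comm.1 h, h⟩, rfl⟩

/-- The points realised up to a power of `τ` form an additive subgroup, and it contains the unit
vectors. -/
theorem exists_mem_pauliGroup_pauliPoint (x : PhaseSpace d n) :
    ∃ u ∈ pauliGroup d n, ∃ k, (u : Op d (Fin n)) = tau d ^ k • pauliPoint x := by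
  let H : AddSubgroup (PhaseSpace d n) :=
    { carrier := {x | ∃ u ∈ pauliGroup d n, ∃ k, (u : Op d (Fin n)) = tau d ^ k • pauliPoint x}
      zero_mem' := ⟨1, one_mem _, 0, by rw [pauliPoint_zero, pow_zero, one_smul]; rfl⟩
      add_mem' := by
        rintro x y ⟨u, hu, k, hk⟩ ⟨v, hv, l, hl⟩
        refine ⟨u * v, mul_mem hu hv, l + k + 2 * (-∑ j, y.1 j * x.2 j).val, ?_⟩
        rw [Units.val_mul, hk, hl, Matrix.smul_mul, Matrix.mul_smul, pauliPoint_mul, smul_smul,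
          smul_smul, stdAddChar_eq_tau_pow, ← pow_add, ← pow_add]
        congr 2; ring
      neg_mem' := by
        rintro x ⟨u, hu, k, hk⟩
        refine ⟨u⁻¹, inv_mem hu, (2 * d - 1) * k + 2 * (-∑ j, x.1 j * x.2 j).val, ?_⟩
        rw [inv_eq_smul_pauliPoint (pow_ne_zero k tau_ne_zero) hk, tau_pow_inv,
          stdAddChar_eq_tau_pow, pow_add] }
  have hz : ∀ j, ((Pi.single j 1, 0) : PhaseSpace d n) ∈ H := fun j => by
    obtain ⟨u, hu⟩ := exists_unit_of_unitary
      (localOp_conjTranspose_mul_self (Q := Fin n) (clock_unitary (d := d)) j)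
    exact ⟨u, Subgroup.subset_closure (Or.inr ⟨j, Or.inr hu⟩), 0, by
      rw [hu, localOp_clock, pow_zero, one_smul]⟩
  have hx : ∀ j, ((0, Pi.single j 1) : PhaseSpace d n) ∈ H := fun j => by
    obtain ⟨u, hu⟩ := exists_unit_of_unitary
      (localOp_conjTranspose_mul_self (Q := Fin n) (shift_unitary (d := d)) j)
    exact ⟨u, Subgroup.subset_closure (Or.inr ⟨j, Or.inl hu⟩), 0, by
      rw [hu, localOp_shift, pow_zero, one_smul]⟩
  have : x = ∑ j, (x.1 j).val • ((Pi.single j 1, 0) : PhaseSpace d n) +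
      ∑ j, (x.2 j).val • ((0, Pi.single j 1) : PhaseSpace d n) := by
    have h : ∀ (v : Fin n → ZMod d) (i j : Fin n), ((v j).val • (Pi.single j 1 : Fin n → ZMod d)) i =
        if i = j then v j else 0 := fun v i j => by
      rw [Pi.smul_apply, Pi.single_apply, nsmul_eq_mul, ZMod.natCast_zmod_val]; simp
    refine Prod.ext (funext fun i => ?_) (funext fun i => ?_)
    · simp only [Prod.fst_add, Prod.fst_sum, Prod.smul_fst, Pi.add_apply, Finset.sum_apply, h, smul_zero,
        Pi.zero_apply]
      simp
    · simp only [Prod.snd_add, Prod.snd_sum, Prod.smul_snd, Pi.add_apply, Finset.sum_apply, h, smul_zero,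
        Pi.zero_apply]
      simp
  rw [this]
  exact H.add_mem (sum_mem fun j _ => H.nsmul_mem (hz j) _) (sum_mem fun j _ => H.nsmul_mem (hx j) _)

theorem exists_mem_pauliGroup_weyl (k : ℕ) (x : PhaseSpace d n) :
    ∃ u ∈ pauliGroup d n, (u : Op d (Fin n)) = tau d ^ k • weyl x := by
  obtain ⟨u, hu, l, hl⟩ := exists_mem_pauliGroup_pauliPoint x
  refine ⟨tauUnit d n ^ ((2 * d - 1) * (l + valDot x.1 x.2) + k) * u,
    mul_mem (pow_mem tauUnit_mem _) hu, ?_⟩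
  rw [Units.val_mul, tauUnit_pow, hl, pauliPoint_eq_weyl, smul_mul_smul_comm, one_mul, smul_smul,
    pow_add _ (_ * _), ← tau_pow_inv, mul_assoc, mul_assoc, ← pow_add]
  have h := inv_mul_cancel₀ (pow_ne_zero (l + valDot x.1 x.2) (tau_ne_zero (d := d)))
  rw [mul_comm (tau d ^ k), ← mul_assoc, h, one_mul]

/-- The `j`-th multiplication contributes an even power of `τ⁻¹` growing linearly in `j`, whence the
factor `k (k - 1)`. -/
theorem pauliPoint_pow (x : PhaseSpace d n) (k : ℕ) :
    pauliPoint x ^ k = (tau d)⁻¹ ^ (k * (k - 1) * valDot x.1 x.2) • pauliPoint (k • x) := by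
  induction k with
  | zero => simp [pauliPoint_zero]
  | succ k ih =>
    have h1 : (ZMod.stdAddChar (-∑ j, x.1 j * (k • x).2 j) : ℂ) =
        (tau d)⁻¹ ^ (2 * (k * valDot x.1 x.2)) := by
      rw [inv_pow, tau_pow_two_mul, ← AddChar.map_neg_eq_inv]
      congr 2
      simp [valDot, Finset.mul_sum]
      exact Finset.sum_congr rfl fun j _ => by ring
    rw [pow_succ, ih, Matrix.smul_mul, pauliPoint_mul, smul_smul, h1, ← pow_add, succ_nsmul]
    congr 2
    rcases k with _ | k
    · simp
    · simp only [Nat.add_sub_cancel]; ring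

/-- Prefactor and commutation phases combine to the exponent `d² (a·b)`, and `τ^{d²} = 1`. -/
theorem weyl_pow_self (x : PhaseSpace d n) : weyl x ^ d = 1 := by
  have hd : 0 < d := (Fact.out : d.Prime).pos
  have h1 : d • x = 0 := by
    refine Prod.ext (funext fun j => ?_) (funext fun j => ?_) <;> simp
  rw [weyl_eq, smul_pow]
  change _ • pauliPoint x ^ d = 1
  rw [pauliPoint_pow, h1, pauliPoint_zero, smul_smul, ← pow_mul, ← pow_add]
  have h2 : valDot x.1 x.2 * d + d * (d - 1) * valDot x.1 x.2 = d * d * valDot x.1 x.2 := by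
    obtain ⟨e, rfl⟩ : ∃ e, d = e + 1 := ⟨d - 1, by omega⟩
    simp only [Nat.add_sub_cancel]; ring
  rw [h2, inv_pow, pow_mul, tau_pow_mul_self, one_pow, inv_one, one_smul]

variable {ψ : Vec d (Fin n)}

theorem smul_left_injective_of_ne (hψ : ψ ≠ 0) {c c' : ℂ} (h : c • ψ = c' • ψ) : c = c' := by
  obtain ⟨r, hr⟩ := Function.ne_iff.1 hψ
  have := congrFun h r
  exact mul_right_cancel₀ hr this

/-- Every eigenvalue of `W_x` is a `d`-th root of unity because `W_x^d = 1`, so it is a power of `ω`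
automatically. -/
theorem mem_weylSet_iff (hψ : ψ ≠ 0) (x : PhaseSpace d n) :
    x ∈ weylSet ψ ↔ ∃ μ : ℂ, weyl x *ᵥ ψ = μ • ψ := by
  constructor
  · rintro ⟨s, hs⟩; exact ⟨_, hs⟩
  · rintro ⟨μ, hμ⟩
    have h1 : ∀ k, (weyl x ^ k) *ᵥ ψ = μ ^ k • ψ := by
      intro k
      induction k with
      | zero => simp
      | succ k ih =>
        rw [pow_succ', ← Matrix.mulVec_mulVec, ih, Matrix.mulVec_smul, hμ, smul_smul, pow_succ]
    have h2 : μ ^ d = 1 := by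
      refine smul_left_injective_of_ne hψ ?_
      rw [← h1, weyl_pow_self, Matrix.one_mulVec, one_smul]
    have hprim : IsPrimitiveRoot (omega d) d :=
      Complex.isPrimitiveRoot_exp d (Fact.out : d.Prime).ne_zero
    obtain ⟨i, hi, hi'⟩ := hprim.eq_pow_of_pow_eq_one h2
    exact ⟨i, by rw [ZMod.val_natCast, Nat.mod_eq_of_lt hi, hi', hμ]⟩

theorem mem_weylSet_iff_pauliPoint (hψ : ψ ≠ 0) (x : PhaseSpace d n) :
    x ∈ weylSet ψ ↔ ∃ μ : ℂ, pauliPoint x *ᵥ ψ = μ • ψ := by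
  rw [mem_weylSet_iff hψ]
  constructor
  · rintro ⟨μ, h⟩
    exact ⟨_, by rw [pauliPoint_eq_weyl, Matrix.smul_mulVec, h, smul_smul]⟩
  · rintro ⟨μ, h⟩
    refine ⟨(tau d)⁻¹ ^ valDot x.1 x.2 * μ, ?_⟩
    rw [weyl_eq, Matrix.smul_mulVec, ← smul_smul, ← h]
    rfl

/-- `Weyl(ψ)` as a subspace. -/
def weylSubmodule (hψ : ψ ≠ 0) : Submodule (ZMod d) (PhaseSpace d n) :=
  have hadd : ∀ {x y : PhaseSpace d n}, x ∈ weylSet ψ → y ∈ weylSet ψ → x + y ∈ weylSet ψ := by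
    intro x y hx hy
    rw [mem_weylSet_iff_pauliPoint hψ] at *
    obtain ⟨μ, hx⟩ := hx
    obtain ⟨ν, hy⟩ := hy
    have h := congrArg (· *ᵥ ψ) (pauliPoint_mul x y)
    simp only [← Matrix.mulVec_mulVec, hy, Matrix.mulVec_smul, hx, smul_smul,
      Matrix.smul_mulVec] at h
    refine ⟨(ZMod.stdAddChar (∑ j, y.1 j * x.2 j)) * (ν * μ), ?_⟩
    rw [← smul_smul, h, smul_smul, ← AddChar.map_add_eq_mul, add_neg_cancel,
      AddChar.map_zero_eq_one, one_smul]
  have hzero : (0 : PhaseSpace d n) ∈ weylSet ψ :=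
    (mem_weylSet_iff_pauliPoint hψ _).2 ⟨1, by rw [pauliPoint_zero, Matrix.one_mulVec, one_smul]⟩
  { carrier := weylSet ψ
    zero_mem' := hzero
    add_mem' := hadd
    smul_mem' := by
      intro a x hx
      rw [← ZMod.natCast_zmod_val a, Nat.cast_smul_eq_nsmul]
      induction a.val with
      | zero => simpa using hzero
      | succ k ih => rw [succ_nsmul]; exact hadd ih hx }

theorem mem_weylSubmodule (hψ : ψ ≠ 0) (x : PhaseSpace d n) :
    x ∈ weylSubmodule hψ ↔ x ∈ weylSet ψ := Iff.rfl

/-- On a common eigenvector the two orders of multiplication agree. The invertible operator of `x +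
y` does not annihilate `ψ`, so the two commutation phases coincide. -/
theorem symp_eq_zero_of_mem_weylSet (hψ : ψ ≠ 0) {x y : PhaseSpace d n} (hx : x ∈ weylSet ψ)
    (hy : y ∈ weylSet ψ) : symp x y = 0 := by
  rw [mem_weylSet_iff_pauliPoint hψ] at hx hy
  obtain ⟨μ, hx⟩ := hx
  obtain ⟨ν, hy⟩ := hy
  have h1 := congrArg (· *ᵥ ψ) (pauliPoint_mul x y)
  have h2 := congrArg (· *ᵥ ψ) (pauliPoint_mul y x)
  simp only [← Matrix.mulVec_mulVec, hy, Matrix.mulVec_smul, hx, smul_smul,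
      Matrix.smul_mulVec] at h1 h2
  rw [add_comm y x, mul_comm μ, h1] at h2
  have h3 : pauliPoint (x + y) *ᵥ ψ ≠ 0 := by
    intro h0
    obtain ⟨u, -, k, hk⟩ := exists_mem_pauliGroup_pauliPoint (x + y)
    have : (u : Op d (Fin n)) *ᵥ ψ = 0 := by rw [hk, Matrix.smul_mulVec, h0, smul_zero]
    have h4 := congrArg (fun v => ((u⁻¹ : (Op d (Fin n))ˣ) : Op d (Fin n)) *ᵥ v) this
    simp only [Matrix.mulVec_mulVec, Units.inv_mul, Matrix.one_mulVec, Matrix.mulVec_zero] at h4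
    exact hψ h4
  obtain ⟨r, hr⟩ := Function.ne_iff.1 h3
  have h4 := mul_right_cancel₀ hr (congrFun h2 r)
  have h5 := neg_injective (ZMod.injective_stdAddChar h4)
  rw [symp, Finset.sum_sub_distrib, h5, sub_self]

variable {S : Subgroup (Op d (Fin n))ˣ} {ε : ℝ}

theorem ne_zero_of_unit (h1 : star ψ ⬝ᵥ ψ = 1) : ψ ≠ 0 := by
  rintro rfl; simp at h1

/-- If `W_x` were a multiple of an element of `S`, then `ψ` would be an eigenvector. Hence the gap
applies. -/
theorem norm_le_of_not_mem_weylSet (h1 : star ψ ⬝ᵥ ψ = 1) (hS : IsHiddenStabilizerGroup ψ S ε)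
    {x : PhaseSpace d n} (hx : x ∉ weylSet ψ) : ‖star ψ ⬝ᵥ (weyl x *ᵥ ψ)‖ ≤ 1 - ε := by
  obtain ⟨u, hu, hux⟩ := exists_mem_pauliGroup_weyl 0 x
  rw [pow_zero, one_smul] at hux
  rw [← hux]
  refine hS.gap u hu fun P hP c h => hx ((mem_weylSet_iff (ne_zero_of_unit h1) x).2 ⟨c, ?_⟩)
  rw [← hux, h, Matrix.smul_mulVec, hS.fixes P hP]

/-- The expectation value `1` violates the gap, so the operator is a multiple of an element of `S`.
Both fix `ψ`, which makes the scalar `1`. -/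
theorem mem_of_fixes (h1 : star ψ ⬝ᵥ ψ = 1) (hε : 0 < ε) (hS : IsHiddenStabilizerGroup ψ S ε)
    {u : (Op d (Fin n))ˣ} (hu : u ∈ pauliGroup d n) (hfix : (u : Op d (Fin n)) *ᵥ ψ = ψ) : u ∈ S := by
  by_contra hn
  have hψ := ne_zero_of_unit h1
  have h := hS.gap u hu fun P hP c hc => by
    have h2 : c = 1 := by
      refine smul_left_injective_of_ne hψ ?_
      rw [one_smul]
      conv_rhs => rw [← hfix, hc, Matrix.smul_mulVec, hS.fixes P hP]
    rw [h2, one_smul] at hc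
    exact hn (Units.ext hc ▸ hP)
  rw [hfix, h1, norm_one] at h
  linarith

/-- The Weyl operators of generators of `Weyl(ψ)` with the phases that fix `ψ` generate `S`. -/
theorem closure_eq_of_phases (h1 : star ψ ⬝ᵥ ψ = 1) (hε : 0 < ε)
    (hS : IsHiddenStabilizerGroup ψ S ε) {ι : Type} (x : ι → PhaseSpace d n) (κ : ι → ℕ)
    (hx : (AddSubgroup.closure (Set.range x) : Set (PhaseSpace d n)) = weylSet ψ)
    (hκ : ∀ i, (tau d ^ κ i • weyl (x i)) *ᵥ ψ = ψ) :
    Subgroup.closure {u : (Op d (Fin n))ˣ | ∃ i, (u : Op d (Fin n)) = tau d ^ κ i • weyl (x i)} = S := by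
  have hψ := ne_zero_of_unit h1
  set T := Subgroup.closure {u : (Op d (Fin n))ˣ | ∃ i, (u : Op d (Fin n)) = tau d ^ κ i • weyl (x i)}
    with hT
  have hTS : T ≤ S := by
    rw [hT, Subgroup.closure_le]
    rintro u ⟨i, hu⟩
    obtain ⟨v, hv, hvx⟩ := exists_mem_pauliGroup_weyl (κ i) (x i)
    obtain rfl : u = v := Units.ext (hu.trans hvx.symm)
    exact mem_of_fixes h1 hε hS hv (by rw [hu, hκ])
  refine le_antisymm hTS fun P hP => ?_
  -- It is enough to reach every point up to a scalar: when an element of `S` is compared with one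
  -- of `T`, both fix `ψ` and the scalar must be `1`.
  have hgen : ∀ y ∈ AddSubgroup.closure (Set.range x), ∃ u ∈ T, ∃ c : ℂ, c ≠ 0 ∧
      (u : Op d (Fin n)) = c • pauliPoint y := by
    intro y hy
    induction hy using AddSubgroup.closure_induction with
    | mem y hy =>
      obtain ⟨i, rfl⟩ := hy
      obtain ⟨v, hv, hvx⟩ := exists_mem_pauliGroup_weyl (κ i) (x i)
      refine ⟨v, Subgroup.subset_closure ⟨i, hvx⟩, _, ?_, by rw [hvx, weyl_eq, smul_smul]; rfl⟩
      exact mul_ne_zero (pow_ne_zero _ tau_ne_zero) (pow_ne_zero _ (inv_ne_zero tau_ne_zero))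
    | zero => exact ⟨1, one_mem _, 1, one_ne_zero, by rw [pauliPoint_zero, one_smul]; rfl⟩
    | add y z _ _ hy hz =>
      obtain ⟨u, hu, c, hc, hu'⟩ := hy
      obtain ⟨v, hv, e, he, hv'⟩ := hz
      refine ⟨u * v, mul_mem hu hv, _, mul_ne_zero (mul_ne_zero he hc) ?_, by
        rw [Units.val_mul, hu', hv', Matrix.smul_mul, Matrix.mul_smul, pauliPoint_mul, smul_smul,
          smul_smul, mul_comm e c, mul_comm c e]⟩
      rw [stdAddChar_eq_tau_pow]; exact pow_ne_zero _ tau_ne_zero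
    | neg y _ hy =>
      obtain ⟨u, hu, c, hc, hu'⟩ := hy
      refine ⟨u⁻¹, inv_mem hu, _, mul_ne_zero (inv_ne_zero hc) ?_, inv_eq_smul_pauliPoint hc hu'⟩
      rw [stdAddChar_eq_tau_pow]; exact pow_ne_zero _ tau_ne_zero
  obtain ⟨k, y, hP'⟩ := exists_of_mem_pauliGroup (hS.isStabilizerGroup.le_pauli hP)
  have hfix := hS.fixes P hP
  have hy : y ∈ weylSet ψ := by
    rw [mem_weylSet_iff_pauliPoint hψ]
    refine ⟨(tau d ^ k)⁻¹, ?_⟩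
    conv_rhs => rw [← hfix, hP', Matrix.smul_mulVec, smul_smul,
      inv_mul_cancel₀ (pow_ne_zero k tau_ne_zero), one_smul]
  rw [← hx] at hy
  obtain ⟨u, hu, c, hc, hu'⟩ := hgen y hy
  have hPu : (P : Op d (Fin n)) = (tau d ^ k * c⁻¹) • (u : Op d (Fin n)) := by
    rw [hu', hP', smul_smul, mul_assoc, inv_mul_cancel₀ hc, mul_one]
  have h2 : tau d ^ k * c⁻¹ = 1 := by
    refine smul_left_injective_of_ne hψ ?_
    rw [one_smul]
    conv_rhs => rw [← hfix, hPu, Matrix.smul_mulVec, hS.fixes u (hTS hu)]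
  rw [h2, one_smul] at hPu
  rwa [Units.ext hPu]

end

/-! ## Outcome probabilities -/

section
variable {d n k : ℕ} [NeZero d]

theorem star_vecPow_dotProduct (k : ℕ) (ψ φ : Vec d (Fin n)) :
    star (vecPow k ψ) ⬝ᵥ vecPow k φ = (star ψ ⬝ᵥ φ) ^ k := by
  simp only [dotProduct, Pi.star_apply]
  rw [Fintype.sum_pow, ← (Equiv.curry (Fin k) (Fin n) (ZMod d)).sum_comp]
  refine Finset.sum_congr rfl fun q _ => ?_
  rw [Finset.prod_mul_distrib]
  simp only [vecPow, star_prod]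
  rfl

theorem opPow_mulVec_vecPow (k : ℕ) (M : Op d (Fin n)) (ψ : Vec d (Fin n)) :
    opPow k M *ᵥ vecPow k ψ = vecPow k (M *ᵥ ψ) := by
  ext r
  simp only [Matrix.mulVec, dotProduct, vecPow, opPow, Matrix.of_apply]
  rw [Finset.prod_univ_sum, Fintype.piFinset_univ,
    ← (Equiv.curry (Fin k) (Fin n) (ZMod d)).sum_comp]
  refine Finset.sum_congr rfl fun q _ => ?_
  rw [← Finset.prod_mul_distrib]
  rfl

theorem vecPow_smul (k : ℕ) (c : ℂ) (ψ : Vec d (Fin n)) :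
    vecPow k (c • ψ) = c ^ k • vecPow k ψ := by
  ext r
  simp [vecPow, Finset.prod_mul_distrib]

theorem Circuit.prob_nonneg (c : Circuit k n) (ψ : Vec d (Fin n)) (r : Fin k × Fin n → ZMod d) :
    0 ≤ c.prob ψ r := by unfold Circuit.prob; positivity

theorem Circuit.sum_mul_prob (c : Circuit k n) (ψ : Vec d (Fin n))
    (g : (Fin k × Fin n → ZMod d) → ℂ) :
    ∑ r, g r * (c.prob ψ r : ℂ) = star (c.toOp d *ᵥ vecPow k ψ) ⬝ᵥ
      (Matrix.diagonal g *ᵥ (c.toOp d *ᵥ vecPow k ψ)) := by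
  rw [dotProduct]
  refine Finset.sum_congr rfl fun r _ => ?_
  rw [Matrix.mulVec_diagonal, Circuit.prob, Pi.star_apply, Complex.ofReal_pow, ← Complex.conj_mul',
    starRingEnd_apply]
  ring

theorem Circuit.dotProduct_toOp (c : Circuit k n) (v w : Vec d (Fin k × Fin n)) :
    star (c.toOp d *ᵥ v) ⬝ᵥ (c.toOp d *ᵥ w) = star v ⬝ᵥ w := by
  rw [Matrix.star_mulVec, Matrix.dotProduct_mulVec, Matrix.vecMul_vecMul, c.toOp_unitary,
    Matrix.vecMul_one]

theorem Circuit.sum_prob (c : Circuit k n) {ψ : Vec d (Fin n)} (h1 : star ψ ⬝ᵥ ψ = 1) :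
    ∑ r, c.prob ψ r = 1 := by
  have h := c.sum_mul_prob ψ fun _ => 1
  simp only [one_mul, Matrix.diagonal_one, Matrix.one_mulVec] at h
  rw [c.dotProduct_toOp, star_vecPow_dotProduct, h1, one_pow] at h
  exact_mod_cast h

/-- Weighting the outcomes by a character after the circuit amounts to applying `W_x` to every copy
before it. -/
theorem prepCircuit_mulVec (ψ : Vec d (Fin n)) (x : PhaseSpace d n) :
    Matrix.diagonal (fun r => (ZMod.stdAddChar (symp (outcomePoint r) x) : ℂ)) *ᵥ
      ((prepCircuit d (numCopies d) n).toOp d *ᵥ vecPow (numCopies d) ψ) =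
    (prepCircuit d (numCopies d) n).toOp d *ᵥ vecPow (numCopies d) (weyl x *ᵥ ψ) := by
  rw [Matrix.mulVec_mulVec, ← prepCircuit_conj dvd_numCopies, ← opPow_numCopies_weyl,
    ← Matrix.mulVec_mulVec, opPow_mulVec_vecPow]

/-- The characteristic function of the outcome distribution of one round. -/
theorem sum_stdAddChar_mul_prob (ψ : Vec d (Fin n)) (x : PhaseSpace d n) :
    ∑ r, (ZMod.stdAddChar (symp (outcomePoint r) x) : ℂ) *
      ((prepCircuit d (numCopies d) n).prob ψ r : ℂ) =
    (star ψ ⬝ᵥ (weyl x *ᵥ ψ)) ^ numCopies d := by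
  rw [Circuit.sum_mul_prob, prepCircuit_mulVec, Circuit.dotProduct_toOp, star_vecPow_dotProduct]

end

/-! ### Separation of points by the outcomes -/

section
variable {d n : ℕ} [Fact d.Prime] {ψ : Vec d (Fin n)}

/-- The eigenvalue is a power of `ω`, so `W_x^{⊗D}` fixes the state on `D` copies. Wherever the
amplitude is non-zero, the character must then be `1`. -/
theorem symp_eq_zero_of_prob_ne_zero {x : PhaseSpace d n} (hx : x ∈ weylSet ψ)
    {r : Fin (numCopies d) × Fin n → ZMod d}
    (hr : (prepCircuit d (numCopies d) n).prob ψ r ≠ 0) : symp (outcomePoint r) x = 0 := by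
  obtain ⟨s, hs⟩ := hx
  have h := congrFun (prepCircuit_mulVec ψ x) r
  have hD : (omega d ^ s.val) ^ numCopies d = 1 := by
    obtain ⟨e, he⟩ := dvd_numCopies (d := d)
    rw [← pow_mul, omega_pow, he]
    simp
  rw [hs, vecPow_smul, hD, one_smul, Matrix.mulVec_diagonal] at h
  have hne : ((prepCircuit d (numCopies d) n).toOp d *ᵥ vecPow (numCopies d) ψ) r ≠ 0 := fun h0 =>
    hr (by rw [Circuit.prob, h0, norm_zero, zero_pow two_ne_zero])
  have h2 := mul_right_cancel₀ hne (h.trans (one_mul _).symm)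
  exact ZMod.injective_stdAddChar (h2.trans (AddChar.map_zero_eq_one _).symm)

variable {S : Subgroup (Op d (Fin n))ˣ} {ε : ℝ}

/-- From `e^{-y} ≤ 1/(1+y)`, which is at most `1 - y/2` for `y ≤ 1` and at most `1/2` beyond. -/
theorem exp_neg_le {y : ℝ} (hy : 0 ≤ y) : Real.exp (-y) ≤ 1 - min 1 y / 2 := by
  have h1 : Real.exp (-y) ≤ (1 + y)⁻¹ := by
    rw [Real.exp_neg]
    exact inv_anti₀ (by linarith) (by linarith [Real.add_one_le_exp y])
  refine h1.trans ?_
  rw [inv_le_iff_one_le_mul₀ (by linarith)]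
  rcases le_total y 1 with h | h
  · rw [min_eq_right h]; nlinarith
  · rw [min_eq_left h]; linarith

/-- Taking at least `d` copies amplifies the gap from `ε` to the order of `min(1, dε)`. This is the
source of the factor `d` saved in the number of rounds. -/
theorem pow_numCopies_le (hε : 0 < ε) {t : ℝ} (ht : 0 ≤ t) (htε : t ≤ 1 - ε) :
    t ^ numCopies d ≤ 1 - min 1 (d * ε) / 2 := by
  have hdD : d ≤ numCopies d :=
    Nat.le_of_dvd (by unfold numCopies; have := NeZero.pos d; split_ifs <;> omega) dvd_numCopies
  calc t ^ numCopies d ≤ t ^ d := pow_le_pow_of_le_one ht (by linarith) hdD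
    _ ≤ Real.exp (-ε) ^ d := by
      gcongr
      linarith [Real.add_one_le_exp (-ε)]
    _ = Real.exp (-(d * ε)) := by rw [← Real.exp_nat_mul]; ring_nf
    _ ≤ _ := exp_neg_le (by positivity)

theorem weyl_zero : weyl (0 : PhaseSpace d n) = 1 := by
  rw [weyl_eq, ← pauliPoint, pauliPoint_zero]
  simp [valDot]

/-- A point outside `Weyl(ψ)` is orthogonal to the outcome with bounded probability. -/
theorem sum_prob_symp_eq_zero_le (h1 : star ψ ⬝ᵥ ψ = 1) (hε : 0 < ε)
    (hS : IsHiddenStabilizerGroup ψ S ε) {x : PhaseSpace d n} (hx : x ∉ weylSet ψ) :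
    ∑ r, (if symp (outcomePoint r) x = 0 then (prepCircuit d (numCopies d) n).prob ψ r else 0) ≤
      1 - min 1 (d * ε) / 4 := by
  have hψ := ne_zero_of_unit h1
  set P := ∑ r, (if symp (outcomePoint r) x = 0 then (prepCircuit d (numCopies d) n).prob ψ r else 0)
    with hP
  set η := min 1 (d * ε)
  have hη : 0 < η := lt_min one_pos (mul_pos (Nat.cast_pos.2 (NeZero.pos d)) hε)
  -- The indicator of `[y,x] = 0` is the average of the characters `ω^{k[y,x]} = ω^{[y,kx]}` over
  -- `k`.
  have hmain : (d : ℂ) * (P : ℂ) =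
      ∑ k : ZMod d, (star ψ ⬝ᵥ (weyl (k • x) *ᵥ ψ)) ^ numCopies d := by
    simp_rw [← sum_stdAddChar_mul_prob]
    rw [Finset.sum_comm, hP, Complex.ofReal_sum, Finset.mul_sum]
    refine Finset.sum_congr rfl fun r _ => ?_
    rw [← Finset.sum_mul]
    simp_rw [symp_smul_right]
    rw [AddChar.sum_mulShift _ (ZMod.isPrimitive_stdAddChar d), ZMod.card]
    split_ifs <;> simp
  have hbound : ∀ k : ZMod d, ‖(star ψ ⬝ᵥ (weyl (k • x) *ᵥ ψ)) ^ numCopies d‖ ≤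
      if k = 0 then 1 else 1 - η / 2 := by
    intro k
    split_ifs with hk
    · rw [hk, zero_smul, weyl_zero, Matrix.one_mulVec, h1, one_pow, norm_one]
    · have hkx : k • x ∉ weylSet ψ := fun h => hx <| by
        rw [← mem_weylSubmodule hψ] at h ⊢
        exact ((weylSubmodule hψ).smul_mem_iff hk).1 h
      rw [norm_pow]
      exact pow_numCopies_le hε (norm_nonneg _) (norm_le_of_not_mem_weylSet h1 hS hkx)
  have hle : (d : ℝ) * P ≤ 1 + (d - 1) * (1 - η / 2) := by
    have hP0 : 0 ≤ P := Finset.sum_nonneg fun r _ => by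
      split_ifs
      · exact Circuit.prob_nonneg _ _ _
      · exact le_rfl
    calc (d : ℝ) * P = ‖(d : ℂ) * (P : ℂ)‖ := by
          rw [norm_mul, Complex.norm_natCast, Complex.norm_real, Real.norm_of_nonneg hP0]
      _ ≤ ∑ k : ZMod d, if k = 0 then 1 else 1 - η / 2 := by
          rw [hmain]; exact norm_sum_le_of_le _ fun k _ => hbound k
      _ = ∑ k : ZMod d, ((1 - η / 2) + if k = 0 then η / 2 else 0) := by
          refine Finset.sum_congr rfl fun k _ => ?_
          split_ifs <;> ring
      _ = _ := by
          rw [Finset.sum_add_distrib, Finset.sum_ite_eq' Finset.univ (0 : ZMod d)]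
          simp only [Finset.sum_const, Finset.card_univ, ZMod.card, nsmul_eq_mul, Finset.mem_univ,
            if_true]
          ring
  -- The term `k = 0` contributes no decay. Since `d - 1 ≥ d/2`, half of `η/2` is left.
  have hd : (2 : ℝ) ≤ d := by exact_mod_cast (Fact.out : d.Prime).two_le
  have : (d : ℝ) * P ≤ d * (1 - η / 4) := by nlinarith
  exact le_of_mul_le_mul_left this (by linarith)

/-- The outcomes of the rounds determine `Weyl(ψ)` as their orthogonal complement. -/
def Determines (ψ : Vec d (Fin n)) {m : ℕ} (r : Fin m → Fin (numCopies d) × Fin n → ZMod d) : Prop :=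
  ∀ x, (∀ i, symp (outcomePoint (r i)) x = 0) ↔ x ∈ weylSet ψ

-- A union bound over all points outside `Weyl(ψ)`: each is orthogonal to all `m` independent
-- outcomes with probability at most `(1 - η/4)^m`, and there are at most `d^{2n}` of them.
open Classical in
theorem sum_determines_ge (h1 : star ψ ⬝ᵥ ψ = 1) (hε : 0 < ε)
    (hS : IsHiddenStabilizerGroup ψ S ε) (m : ℕ) :
    1 - (d : ℝ) ^ (2 * n) * (1 - min 1 (d * ε) / 4) ^ m ≤
      ∑ r : Fin m → Fin (numCopies d) × Fin n → ZMod d,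
        if Determines ψ r then ∏ i, (prepCircuit d (numCopies d) n).prob ψ (r i) else 0 := by
  set p := (prepCircuit d (numCopies d) n).prob ψ with hp
  have hp0 : ∀ r, 0 ≤ p r := Circuit.prob_nonneg _ _
  have htot : ∑ r : Fin m → Fin (numCopies d) × Fin n → ZMod d, ∏ i, p (r i) = 1 := by
    rw [← Fintype.sum_pow, Circuit.sum_prob _ h1, one_pow]
  have hone : ∀ x : PhaseSpace d n, x ∉ weylSet ψ →
      ∑ r : Fin m → Fin (numCopies d) × Fin n → ZMod d,
        (if ∀ i, symp (outcomePoint (r i)) x = 0 then ∏ i, p (r i) else 0) ≤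
      (1 - min 1 (d * ε) / 4) ^ m := by
    intro x hx
    have : ∀ r : Fin m → Fin (numCopies d) × Fin n → ZMod d,
        (if ∀ i, symp (outcomePoint (r i)) x = 0 then ∏ i, p (r i) else 0) =
        ∏ i, if symp (outcomePoint (r i)) x = 0 then p (r i) else 0 := by
      intro r
      rw [Finset.prod_ite_zero]
      simp
    simp_rw [this]
    rw [← Fintype.sum_pow fun r => if symp (outcomePoint r) x = 0 then p r else 0]
    refine pow_le_pow_left₀ (Finset.sum_nonneg fun r _ => ?_) (sum_prob_symp_eq_zero_le h1 hε hS hx) _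
    split_ifs
    · exact hp0 r
    · exact le_rfl
  have hη : 0 ≤ 1 - min 1 (d * ε) / 4 := by have := min_le_left 1 (d * ε); linarith
  -- An outcome sequence of non-zero probability is orthogonal to `Weyl(ψ)`, so it can fail only
  -- through some point outside.
  have hpt : ∀ r : Fin m → Fin (numCopies d) × Fin n → ZMod d,
      ∏ i, p (r i) ≤ (if Determines ψ r then ∏ i, p (r i) else 0) +
        ∑ x : PhaseSpace d n, if x ∉ weylSet ψ then
          (if ∀ i, symp (outcomePoint (r i)) x = 0 then ∏ i, p (r i) else 0) else 0 := by
    intro r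
    have hr : 0 ≤ ∏ i, p (r i) := Finset.prod_nonneg fun i _ => hp0 _
    have hterm : ∀ x : PhaseSpace d n, 0 ≤ (if x ∉ weylSet ψ then
        (if ∀ i, symp (outcomePoint (r i)) x = 0 then ∏ i, p (r i) else 0) else 0) := by
      intro x; split_ifs <;> first | exact hr | exact le_rfl
    by_cases hg : Determines ψ r
    · rw [if_pos hg]
      exact le_add_of_nonneg_right (Finset.sum_nonneg fun x _ => hterm x)
    · rw [if_neg hg, zero_add]
      by_cases h0 : ∏ i, p (r i) = 0
      · refine h0.le.trans ?_
        exact Finset.sum_nonneg fun x _ => hterm x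
      · replace h0 := Finset.prod_ne_zero_iff.1 h0
        simp only [Determines, not_forall] at hg
        obtain ⟨x, hx⟩ := hg
        have hx2 : x ∉ weylSet ψ ∧ ∀ i, symp (outcomePoint (r i)) x = 0 := by
          by_cases hxM : x ∈ weylSet ψ
          · exact absurd (iff_of_true
              (fun i => symp_eq_zero_of_prob_ne_zero hxM (h0 i (Finset.mem_univ i))) hxM) hx
          · exact ⟨hxM, by_contra fun h => hx (iff_of_false h hxM)⟩
        refine le_trans ?_ (Finset.single_le_sum (fun x _ => hterm x) (Finset.mem_univ x))
        rw [if_pos hx2.1, if_pos hx2.2]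
  have hsum := Finset.sum_le_sum fun r (_ : r ∈ Finset.univ) => hpt r
  rw [htot, Finset.sum_add_distrib, Finset.sum_comm] at hsum
  have hbad : ∑ x : PhaseSpace d n, ∑ r : Fin m → Fin (numCopies d) × Fin n → ZMod d,
      (if x ∉ weylSet ψ then
        (if ∀ i, symp (outcomePoint (r i)) x = 0 then ∏ i, p (r i) else 0) else 0) ≤
      (d : ℝ) ^ (2 * n) * (1 - min 1 (d * ε) / 4) ^ m := by
    refine (Finset.sum_le_card_nsmul _ _ ((1 - min 1 (d * ε) / 4) ^ m) fun x _ => ?_).trans ?_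
    · by_cases hx : x ∈ weylSet ψ
      · simp only [hx, not_true, if_false, Finset.sum_const_zero]
        positivity
      · simp only [hx, not_false_eq_true, if_true]
        exact hone x hx
    · rw [nsmul_eq_mul]
      refine le_of_eq ?_
      congr 1
      simp [Finset.card_univ, two_mul, pow_add]
  linarith

/-- The constant `8` gives `mη/4 ≥ 2 n log d + 2 log(1/δ)`, which cancels the number of points and
leaves at most `δ²`. -/
theorem pow_mul_pow_le {m : ℕ} {δ : ℝ} (hε : 0 < ε) (hδ : 0 < δ) (hδ1 : δ < 1)
    (hm : 8 * (n * Real.log d + Real.log (1 / δ)) / min 1 (d * ε) ≤ m) :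
    (d : ℝ) ^ (2 * n) * (1 - min 1 (d * ε) / 4) ^ m ≤ δ := by
  set η := min 1 (d * ε) with hη'
  have hd : (0 : ℝ) < d := Nat.cast_pos.2 (NeZero.pos d)
  have hη : 0 < η := lt_min one_pos (mul_pos hd hε)
  have hη1 : η ≤ 1 := min_le_left _ _
  rw [div_le_iff₀ hη] at hm
  have hlog : 0 ≤ Real.log (1 / δ) := Real.log_nonneg (by rw [le_div_iff₀ hδ]; linarith)
  have hlogδ : Real.log (1 / δ) = -Real.log δ := by rw [one_div, Real.log_inv]
  calc (d : ℝ) ^ (2 * n) * (1 - η / 4) ^ m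
      ≤ Real.exp (Real.log d) ^ (2 * n) * Real.exp (-(η / 4)) ^ m := by
        rw [Real.exp_log hd]
        gcongr
        · linarith
        · linarith [Real.add_one_le_exp (-(η / 4))]
    _ = Real.exp (2 * n * Real.log d - m * η / 4) := by
        rw [← Real.exp_nat_mul, ← Real.exp_nat_mul, ← Real.exp_add]
        push_cast; ring_nf
    _ ≤ Real.exp (Real.log δ) := Real.exp_le_exp.2 (by linarith)
    _ = δ := Real.exp_log hδ

end

/-! ## The algorithm -/

/-- This holds for every outcome, since a list with more than `n` points is not measured at all. -/
theorem extraCopies_le (n len : ℕ) : extraCopies n len ≤ n := by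
  unfold extraCopies; split_ifs <;> omega

theorem phaseExponent_congr {d n : ℕ} (x : ℕ → ZMod d) {s s' : ℕ → ℕ} (h : ∀ j < n, s j = s' j) :
    phaseExponent n x s = phaseExponent n x s' := by
  unfold phaseExponent
  congr 1
  exact Finset.sum_congr rfl fun j hj => by rw [h j (Finset.mem_range.1 hj)]

theorem tabulate_le {N V : ℕ} {f : Fin N → ℕ} (h : ∀ i, f i ≤ V) (i : ℕ) : tabulate f i ≤ V := by
  unfold tabulate
  split_ifs
  · exact h _
  · exact Nat.zero_le _

/-! ### Memory layout of outcomes and points -/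

section
variable {d n m k : ℕ}

theorem digits_le [NeZero d] (s : Fin k × Fin n → ZMod d) (i : Fin (k * n)) : digits s i ≤ d :=
  (ZMod.val_lt _).le

theorem tabulate_apply {N : ℕ} (f : Fin N → ℕ) (i : Fin N) : tabulate f i = f i := by
  simp [tabulate]

theorem tabulate_digits (s : Fin k × Fin n → ZMod d) (c : Fin k) (j : Fin n) :
    tabulate (digits s) (j + n * c) = (s (c, j)).val := by
  have h : (j + n * c : ℕ) = (finProdFinEquiv (c, j) : ℕ) := rfl
  rw [h, tabulate_apply, digits, Equiv.symm_apply_apply]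

theorem tabulate_digitsRounds (r : Fin m → Fin k × Fin n → ZMod d) (i : Fin m) (c : Fin k)
    (j : Fin n) : tabulate (digitsRounds r) (i * (k * n) + (c * n + j)) = (r i (c, j)).val := by
  have h : (i * (k * n) + (c * n + j) : ℕ) = (finProdFinEquiv (i, finProdFinEquiv (c, j)) : ℕ) := by
    simp only [finProdFinEquiv_apply_val]
    ring
  rw [h, tabulate_apply, digitsRounds, Equiv.symm_apply_apply, digits, Equiv.symm_apply_apply]

theorem pointDigits_toPoint (x : ℕ → ZMod d) :
    pointDigits (toPoint (n := n) x) = fun t : Fin (n + n) => (x t).val := by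
  funext t
  refine Fin.addCases (fun j => ?_) (fun j => ?_) t
  · rw [pointDigits, Fin.append_left]; rfl
  · rw [pointDigits, Fin.append_right]; rfl

/-- A bound for all numbers that occur in the computation. -/
def valueLimit (d n m : ℕ) : ℕ := (n + d + m) ^ 4

theorem Mem.Bdd.update_array {V : ℕ} {σ : Mem} (h : σ.Bdd V) (a : ℕ) {f : ℕ → ℕ} (hf : ∀ i, f i ≤ V) :
    Mem.Bdd V (Function.update σ a f) := by
  intro b j
  by_cases hb : b = a
  · subst hb; simpa using hf j
  · simpa [Function.update_of_ne hb] using h b j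

end

section
variable (d n m : ℕ) [Fact d.Prime]

/-- All quantities are at most four times a square or at most a cube of `n + d + m ≥ 2`, so the
fourth power covers them. -/
theorem fits_valueLimit : Fits (valueLimit d n m) n d m := by
  have h2 : 2 ≤ d := (Fact.out : d.Prime).two_le
  set N := n + d + m with hN
  have hN2 : 2 ≤ N := by omega
  have e1 : N ^ 4 = N * N * (N * N) := by ring
  have h4 : 4 ≤ N * N := Nat.mul_le_mul hN2 hN2
  have h1 : N * N ≤ N ^ 4 := e1 ▸ Nat.le_mul_of_pos_right _ (by omega)
  have h3 : 4 * (N * N) ≤ N ^ 4 := e1 ▸ Nat.mul_le_mul_right _ h4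
  have h5 : 2 * N ≤ N * N := Nat.mul_le_mul_right _ hN2
  have hn : n ≤ N := by omega
  have hd : d ≤ N := by omega
  have hD := numCopies_le d
  have hnn := Nat.mul_le_mul hn hn
  have hdn := Nat.mul_le_mul hd hn
  unfold valueLimit
  rw [← hN]
  refine ⟨by omega, by omega, by omega, by omega, by nlinarith, ?_, ?_⟩
  · calc numCopies d * (n * 2) ≤ 2 * d * (n * 2) := Nat.mul_le_mul_right _ hD
      _ = 4 * (d * n) := by ring
      _ ≤ _ := by omega
  · calc n * (n * d) ≤ N * (N * N) := Nat.mul_le_mul hn (Nat.mul_le_mul hn hd)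
      _ ≤ N * (N * N) * N := Nat.le_mul_of_pos_right _ (by omega)
      _ = N ^ 4 := by ring

theorem le_valueLimit : d ≤ valueLimit d n m := by have := (fits_valueLimit d n m).dim; omega

theorem inputMem_bdd : Mem.Bdd (valueLimit d n m) (inputMem d n m) := by
  have hF := fits_valueLimit d n m
  have h1 := hF.width
  have h2 := hF.dim
  refine Mem.Bdd.update_array (fun _ _ => Nat.zero_le _) 0 (tabulate_le fun i => ?_)
  fin_cases i
  · simp; omega
  · simp; omega
  · exact hF.rounds

/-- Memory and cost are paired so that both can be chosen from one existence statement as data of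
the execution. -/
theorem exists_prep : ∃ p : Mem × ℕ, Exec Program.prep (inputMem d n m) p.1 p.2 ∧
    p.2 ≤ Program.prep.timeBound (valueLimit d n m) ∧ Mem.Bdd (valueLimit d n m) p.1 ∧
    Mem.Agree [1, 20, 21, 22, 23] (inputMem d n m) p.1 ∧ Env n d m p.1 ∧
    p.1.Holds 1 (prepCode d n (numCopies d)) := by
  obtain ⟨σ, t, h⟩ := spec_prep (fits_valueLimit d n m) (inputMem_bdd d n m)
    (by simp [inputMem, tabulate]) (by simp [inputMem, tabulate]) (by simp [inputMem, tabulate])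
    (by simp [inputMem])
  exact ⟨(σ, t), h⟩

/-- The memory after the preparation, and its cost. -/
def prepResult : Mem × ℕ := (exists_prep d n m).choose

variable {d n m}

/-- The rows of the linear system for `Weyl(ψ)` that is given by the outcomes. -/
def outcomeRows (r : Fin m → Fin (numCopies d) × Fin n → ZMod d) : ℕ → ℕ → ZMod d := fun i =>
  if h : i < m then sympCoeff (outcomePoint (r ⟨i, h⟩)) else 0

/-- The non-zero rows of the solution of this system. -/
def solutionRows (r : Fin m → Fin (numCopies d) × Fin n → ZMod d) : List (ℕ → ZMod d) :=
  nonzeroRows (n + n) (kernelRows (n + n) (outcomeRows r) m) (n + n)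

/-- Identifies the arithmetic of `sampleForm` with the form `x ↦ [y,x]`: the first copies of the
groups give the coefficients `-y.2`, the other copies `y.1`. -/
theorem outcomeRows_eq_sum (r : Fin m → Fin (numCopies d) × Fin n → ZMod d) {i l : ℕ} (hi : i < m)
    (hl : l < n + n) :
    ((∑ c ∈ Finset.range (numCopies d), ((1 - c % d + l / n) % 2) *
      tabulate (digitsRounds r) (i * (numCopies d * n) + (c * n + l % n)) : ℕ) : ZMod d) =
    outcomeRows r i l := by
  have hn : 0 < n := by omega
  have hmod : l % n < n := Nat.mod_lt _ hn
  rw [Finset.sum_range]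
  have hterm : ∀ c : Fin (numCopies d),
      tabulate (digitsRounds r) (i * (numCopies d * n) + (c * n + l % n)) =
        (r ⟨i, hi⟩ (c, ⟨l % n, hmod⟩)).val := fun c =>
    tabulate_digitsRounds r ⟨i, hi⟩ c ⟨l % n, hmod⟩
  simp only [hterm, Nat.cast_sum, Nat.cast_mul, ZMod.natCast_zmod_val]
  rw [outcomeRows, dif_pos hi, sympCoeff]
  by_cases h : l < n
  · simp only [dif_pos h, outcomePoint, neg_neg, Nat.mod_eq_of_lt h, Nat.div_eq_of_lt h, add_zero]
    refine Finset.sum_congr rfl fun c _ => ?_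
    split_ifs with hc
    · simp [hc]
    · rw [Nat.sub_eq_zero_of_le (by omega)]; simp
  · have h1 : l / n = 1 := Nat.div_eq_of_lt_le (by omega) (by omega)
    have h2 : l % n = l - n := by rw [Nat.mod_eq_sub_mod (by omega), Nat.mod_eq_of_lt (by omega)]
    simp only [dif_neg h, dif_pos (show l - n < n by omega), outcomePoint, h1, h2]
    refine Finset.sum_congr rfl fun c _ => ?_
    split_ifs with hc
    · simp [hc]
    · rw [Nat.sub_eq_zero_of_le (by omega)]; simp

theorem exists_post (r : Fin m → Fin (numCopies d) × Fin n → ZMod d) : ∃ p : Mem × ℕ,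
    Exec Program.post (Function.update (prepResult d n m).1 2 (tabulate (digitsRounds r))) p.1 p.2 ∧
    p.2 ≤ Program.post.timeBound (valueLimit d n m) ∧ Mem.Bdd (valueLimit d n m) p.1 ∧
    Env n d m p.1 ∧ p.1.Holds 3 (rowDigits (n + n) (solutionRows r)) ∧
    p.1 5 0 = extraCopies n (solutionRows r).length ∧
    p.1.Holds 4 (readoutCode n (fun k => (solutionRows r).getD k 0)
      (extraCopies n (solutionRows r).length)) := by
  obtain ⟨-, -, hb, ha, hE, -⟩ := (exists_prep d n m).choose_spec
  rw [← prepResult] at hb ha hE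
  have hE' : Env n d m (Function.update (prepResult d n m).1 2 (tabulate (digitsRounds r))) := by
    obtain ⟨h1, h2, h3, h4, h5⟩ := hE
    exact ⟨by simpa, by simpa, by simpa, by simpa, by simpa⟩
  obtain ⟨σ, t, h⟩ := spec_post (fits_valueLimit d n m)
    (hb.update_array 2 (tabulate_le fun i => (digits_le _ _).trans (le_valueLimit d n m))) hE'
    (outcomeRows r) (fun i hi l hl => by
      rw [Function.update_self]; exact outcomeRows_eq_sum r hi hl)
    (by simp [ha.at 3, inputMem]) (by simp [ha.at 4, inputMem]) (solutionRows r) rfl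
  exact ⟨(σ, t), h⟩

/-- The memory after the second classical part, and its cost. -/
def postResult (r : Fin m → Fin (numCopies d) × Fin n → ZMod d) : Mem × ℕ := (exists_post r).choose

theorem exists_finish (r : Fin m → Fin (numCopies d) × Fin n → ZMod d)
    (s : Fin (extraCopies n (solutionRows r).length) × Fin n → ZMod d) : ∃ p : Mem × ℕ,
    Exec Program.finish (Function.update (postResult r).1 6 (tabulate (digits s))) p.1 p.2 ∧
    p.2 ≤ Program.finish.timeBound (valueLimit d n m) ∧ Mem.Bdd (valueLimit d n m) p.1 ∧
    ∀ k < extraCopies n (solutionRows r).length, p.1 7 k =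
      phaseExponent n ((solutionRows r).getD k 0) fun j => tabulate (digits s) (j + n * k) := by
  obtain ⟨-, -, hb, hE, h3, h5, -⟩ := (exists_post r).choose_spec
  rw [← postResult] at hb hE h3 h5
  have hE' : Env n d m (Function.update (postResult r).1 6 (tabulate (digits s))) := by
    obtain ⟨h1, h2, h3, h4, h5⟩ := hE
    exact ⟨by simpa, by simpa, by simpa, by simpa, by simpa⟩
  obtain ⟨σ, t, h⟩ := spec_finish (fits_valueLimit d n m)
    (hb.update_array 6 (tabulate_le fun i => (digits_le _ _).trans (le_valueLimit d n m))) hE'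
    (h3.congr (by simp)) (by simpa)
  simp only [Function.update_self] at h
  exact ⟨(σ, t), h⟩

/-- The classical parts of the algorithm. -/
def stabilizerProgram : HybridProgram := ⟨Program.prep, Program.post, Program.finish⟩

variable (d n m) in
/-- The execution of the algorithm. -/
def stabilizerExecution : stabilizerProgram.Execution d n m where
  mem₁ := (prepResult d n m).1
  cost₁ := (prepResult d n m).2
  circuit := prepCircuit d (numCopies d) n
  exec₁ := (exists_prep d n m).choose_spec.1
  holds₁ := by
    rw [prepCircuit_code]
    exact (exists_prep d n m).choose_spec.2.2.2.2.2
  mem₂ r := (postResult r).1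
  cost₂ r := (postResult r).2
  points r := (solutionRows r).map toPoint
  extra r := extraCopies n (solutionRows r).length
  readout r := readoutCircuit _ n fun k => (solutionRows r).getD k 0
  exec₂ r := (exists_post r).choose_spec.1
  holds_points r := by
    have h : (postResult r).1.Holds 3 (rowDigits (n + n) (solutionRows r)) :=
      (exists_post r).choose_spec.2.2.2.2.1
    rw [rowDigits] at h
    simpa only [List.map_map, Function.comp_def, pointDigits_toPoint] using h
  holds_extra r := (exists_post r).choose_spec.2.2.2.2.2.1
  holds_readout r := by
    rw [readoutCircuit_code]
    exact (exists_post r).choose_spec.2.2.2.2.2.2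
  mem₃ r s := (exists_finish r s).choose.1
  cost₃ r s := (exists_finish r s).choose.2
  exec₃ r s := (exists_finish r s).choose_spec.1

theorem stabilizerExecution_time_le (r : Fin m → Fin (numCopies d) × Fin n → ZMod d)
    (s : Fin (extraCopies n (solutionRows r).length) × Fin n → ZMod d) :
    (stabilizerExecution d n m).time r s ≤
      (Program.prep.timeBound (valueLimit d n m) + Program.post.timeBound (valueLimit d n m) +
        Program.finish.timeBound (valueLimit d n m)) + (valueLimit d n m * valueLimit d n m +
        valueLimit d n m + (valueLimit d n m * valueLimit d n m + valueLimit d n m) *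
          valueLimit d n m) := by
  have hF := fits_valueLimit d n m
  have h1 : (prepResult d n m).2 ≤ _ := (exists_prep d n m).choose_spec.2.1
  have h2 : (postResult r).2 ≤ _ := (exists_post r).choose_spec.2.1
  have h3 := (exists_finish r s).choose_spec.2.1
  have h4 : m * (prepCircuit d (numCopies d) n).length ≤ valueLimit d n m * valueLimit d n m := by
    refine Nat.mul_le_mul hF.rounds ((le_of_eq ?_).trans ((prepCode_length_le d n (numCopies d)).trans
      hF.prep))
    rw [← prepCircuit_code, List.length_map]
  have hx := extraCopies_le n (solutionRows r).length
  have h5 : (readoutCircuit (extraCopies n (solutionRows r).length) n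
      fun k => (solutionRows r).getD k 0).length ≤ valueLimit d n m :=
    (readoutCircuit_length_le _).trans ((Nat.mul_le_mul_right _ hx).trans hF.readout)
  have h6 : (m * numCopies d + extraCopies n (solutionRows r).length) * n ≤ (valueLimit d n m * valueLimit d n m + valueLimit d n m) * valueLimit d n m := by
    have hw := hF.width
    exact Nat.mul_le_mul (Nat.add_le_add (Nat.mul_le_mul hF.rounds ((numCopies_le d).trans hF.dim))
      (by omega)) (by omega)
  simp only [HybridProgram.Execution.time, HybridProgram.Execution.copies, stabilizerExecution]
  omega

theorem exists_time_le : ∃ c : ℕ, ∀ (d n m : ℕ) [Fact d.Prime]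
    (r : Fin m → Fin (numCopies d) × Fin n → ZMod d)
    (s : Fin ((stabilizerExecution d n m).extra r) × Fin n → ZMod d),
    (stabilizerExecution d n m).time r s ≤ (n + d + m) ^ c := by
  obtain ⟨c, hc⟩ := ((((PolyBdd.cmd_timeBound Program.prep).add
    (PolyBdd.cmd_timeBound Program.post)).add (PolyBdd.cmd_timeBound Program.finish)).add
    (((PolyBdd.id.mul .id).add .id).add (((PolyBdd.id.mul .id).add .id).mul .id))).comp_pow
      four_ne_zero
  refine ⟨c, fun d n m _ r s => (stabilizerExecution_time_le r s).trans (hc _ ?_)⟩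
  have := (Fact.out : d.Prime).two_le
  omega

/-! ## Success probability -/

variable {ψ : Vec d (Fin n)} {S : Subgroup (Op d (Fin n))ˣ} {ε δ : ℝ}

theorem forall_linearForm_outcomeRows (r : Fin m → Fin (numCopies d) × Fin n → ZMod d)
    (x : PhaseSpace d n) :
    (∀ i < m, linearForm (outcomeRows r i) x = 0) ↔ ∀ i, symp (outcomePoint (r i)) x = 0 := by
  rw [Fin.forall_iff]
  refine forall₂_congr fun i hi => ?_
  rw [outcomeRows, dif_pos hi, linearForm_sympCoeff]

theorem Determines.closure_eq {r : Fin m → Fin (numCopies d) × Fin n → ZMod d} (h : Determines ψ r) :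
    (AddSubgroup.closure {x : PhaseSpace d n | x ∈ (stabilizerExecution d n m).points r} :
      Set (PhaseSpace d n)) = weylSet ψ := by
  ext x
  rw [← h x, ← forall_linearForm_outcomeRows]
  exact mem_closure_kernelPoints (outcomeRows r) m x

/-- The points found span the isotropic set `Weyl(ψ)`, so there are at most `n` of them and all are
measured. -/
theorem Determines.extraCopies_eq {r : Fin m → Fin (numCopies d) × Fin n → ZMod d}
    (h : Determines ψ r) (hψ : ψ ≠ 0) :
    extraCopies n (solutionRows r).length = (solutionRows r).length := by
  refine if_pos ?_
  have := kernelPoints_length_le (n := n) (outcomeRows r) m fun x y hx hy => by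
    rw [forall_linearForm_outcomeRows, h] at hx hy
    exact symp_eq_zero_of_mem_weylSet hψ hx hy
  rwa [kernelPoints, List.length_map] at this

/-- Once the points generate `Weyl(ψ)`, each possible readout outcome yields exactly the phases with
which the Weyl operators fix `ψ`. -/
theorem Determines.output_eq (h1 : star ψ ⬝ᵥ ψ = 1) (hε : 0 < ε)
    (hS : IsHiddenStabilizerGroup ψ S ε) {r : Fin m → Fin (numCopies d) × Fin n → ZMod d}
    (h : Determines ψ r) {s : Fin ((stabilizerExecution d n m).extra r) × Fin n → ZMod d}
    (hs : ((stabilizerExecution d n m).readout r).prob ψ s ≠ 0) :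
    (stabilizerExecution d n m).output r s = S := by
  have hψ := ne_zero_of_unit h1
  refine closure_eq_of_phases h1 hε hS (((stabilizerExecution d n m).points r).get) _
    (by rw [Set.range_list_get]; exact h.closure_eq) fun i => ?_
  have hi : (i : ℕ) < (solutionRows r).length :=
    i.2.trans_eq (List.length_map _)
  have hget : ((stabilizerExecution d n m).points r).get i =
      toPoint ((solutionRows r).getD i 0) := by
    rw [List.getD_eq_getElem _ _ hi]
    exact List.getElem_map toPoint
  have hmem : toPoint ((solutionRows r).getD i 0) ∈ weylSet ψ := by
    rw [← hget, ← h.closure_eq]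
    exact AddSubgroup.subset_closure (List.get_mem _ _)
  obtain ⟨μ, hμ⟩ := (mem_weylSet_iff hψ _).1 hmem
  have hi' : (i : ℕ) < extraCopies n (solutionRows r).length := by rwa [h.extraCopies_eq hψ]
  have hκ : (stabilizerExecution d n m).mem₃ r s 7 i = _ :=
    (exists_finish r s).choose_spec.2.2.2 i hi'
  rw [hget, hκ, Matrix.smul_mulVec, hμ, smul_smul, phaseExponent_congr _ fun j hj => ?_,
    tau_pow_phaseExponent _ ψ s hs ⟨i, hi'⟩ μ hμ, one_smul]
  rw [dif_pos hj]
  exact tabulate_digits s ⟨i, hi'⟩ ⟨j, hj⟩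

theorem probPhaseless_ge (h1 : star ψ ⬝ᵥ ψ = 1) (hε : 0 < ε) (hδ : 0 < δ) (hδ1 : δ < 1)
    (hS : IsHiddenStabilizerGroup ψ S ε)
    (hm : 8 * (n * Real.log d + Real.log (1 / δ)) / min 1 (d * ε) ≤ m) :
    1 - δ ≤ (stabilizerExecution d n m).probPhaseless ψ := by
  classical
  refine (sub_le_sub_left (pow_mul_pow_le hε hδ hδ1 hm) 1).trans
    ((sum_determines_ge h1 hε hS m).trans (Finset.sum_le_sum fun r _ => ?_))
  have hr : 0 ≤ (stabilizerExecution d n m).roundsProb ψ r :=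
    Finset.prod_nonneg fun i _ => Circuit.prob_nonneg _ _ _
  by_cases h : Determines ψ r
  · rw [if_pos h, if_pos h.closure_eq]
    exact le_rfl
  · rw [if_neg h]
    split_ifs
    · exact hr
    · exact le_rfl

/-- The readout adds no error: after a successful first stage all readout outcomes of non-zero
probability give `S`, so the inner sum is `1`. -/
theorem probIdentifies_ge (h1 : star ψ ⬝ᵥ ψ = 1) (hε : 0 < ε) (hδ : 0 < δ) (hδ1 : δ < 1)
    (hS : IsHiddenStabilizerGroup ψ S ε)
    (hm : 8 * (n * Real.log d + Real.log (1 / δ)) / min 1 (d * ε) ≤ m) :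
    1 - δ ≤ (stabilizerExecution d n m).probIdentifies ψ S := by
  classical
  refine (sub_le_sub_left (pow_mul_pow_le hε hδ hδ1 hm) 1).trans
    ((sum_determines_ge h1 hε hS m).trans (Finset.sum_le_sum fun r _ => ?_))
  have hr : 0 ≤ (stabilizerExecution d n m).roundsProb ψ r :=
    Finset.prod_nonneg fun i _ => Circuit.prob_nonneg _ _ _
  by_cases h : Determines ψ r
  · rw [if_pos h]
    refine le_of_eq ?_
    rw [Finset.sum_congr rfl (g := ((stabilizerExecution d n m).readout r).prob ψ) fun s _ => ?_,
      Circuit.sum_prob _ h1, mul_one]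
    · rfl
    · by_cases hs : ((stabilizerExecution d n m).readout r).prob ψ s = 0
      · rw [hs, ite_self]
      · rw [if_pos (h.output_eq h1 hε hS hs)]
  · rw [if_neg h]
    refine mul_nonneg hr (Finset.sum_nonneg fun s _ => ?_)
    split_ifs
    · exact Circuit.prob_nonneg _ _ _
    · exact le_rfl

end

end Qudit

end

open Qudit in
theorem mainTheorem2 :
    ∃ (A : HybridProgram) (C : ℝ) (c : ℕ), ∀ (d n m : ℕ) [Fact d.Prime],
      ∃ E : A.Execution d n m,
        E.circuit.CoherentOn d ∧ E.circuit.DepthLE (c * d) ∧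
        (∃ f : (Fin (numCopies d) × Fin n → ZMod d) → PhaseSpace d n,
          E.circuit.ImplementsCharacterPOVM f ∧
          ∀ r r', (∀ i, f (r i) = f (r' i)) → E.points r = E.points r') ∧
        (∀ r, E.copies r ≤ m * numCopies d + n ∧
          (E.readout r).CoherentOn 1 ∧ (E.readout r).DepthLE (c * d)) ∧
        (∀ r s, E.time r s ≤ c * (n + d + m) ^ c) ∧
        ∀ (ψ : Vec d (Fin n)) (S : Subgroup (Op d (Fin n))ˣ) (ε δ : ℝ),
          star ψ ⬝ᵥ ψ = 1 → 0 < ε → 0 < δ → δ < 1 → IsHiddenStabilizerGroup ψ S ε →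
          C * (n * Real.log d + Real.log (1 / δ)) / min 1 (d * ε) ≤ m →
            1 - δ ≤ E.probPhaseless ψ ∧ 1 - δ ≤ E.probIdentifies ψ S := by
  obtain ⟨c, hc⟩ := exists_time_le
  -- The successor makes the constant positive, as it serves both as a factor in the depth and time
  -- bounds and as an exponent.
  refine ⟨stabilizerProgram, 8, c + 1, fun d n m _ => ⟨stabilizerExecution d n m,
    prepCircuit_coherentOn, prepCircuit_depthLE.mono (Nat.le_mul_of_pos_left d c.succ_pos),
    ⟨outcomePoint, prepCircuit_implements, fun r r' h => ?_⟩,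
    fun r => ⟨Nat.add_le_add_left (extraCopies_le _ _) _, readoutCircuit_coherentOn _,
      (readoutCircuit_depthLE _).mono (Nat.le_mul_of_pos_left d c.succ_pos)⟩,
    fun r s => ?_,
    fun ψ S ε δ h1 hε hδ hδ1 hS hm => ⟨probPhaseless_ge h1 hε hδ hδ1 hS hm,
      probIdentifies_ge h1 hε hδ hδ1 hS hm⟩⟩⟩
  · have : outcomeRows r = outcomeRows r' := by
      funext i
      simp only [outcomeRows, h]
    simp only [stabilizerExecution, solutionRows, this]
  · have hN : 0 < n + d + m := by have := (Fact.out : d.Prime).pos; omega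
    calc (stabilizerExecution d n m).time r s ≤ (n + d + m) ^ c := hc d n m r s
      _ ≤ (n + d + m) ^ (c + 1) := Nat.pow_le_pow_right hN (Nat.le_succ c)
      _ ≤ _ := Nat.le_mul_of_pos_left _ c.succ_pos
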